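/- Let $\mathbb D$ be the open unit disc. A one-parameter semigroup $(\phi_t)_{t\ge 0}$ consists of holomorphic self-maps of $\mathbb D$ with $\phi_0=\mathrm{id}$, $\phi_{s+t}=\phi_s\circ\phi_t$ and $\phi_t(z)\to z$ as $t\to0^+$; its infinitesimal generator is the holomorphic $G:\mathbb D\to\mathbb C$ with $\frac{d}{dt}\phi_t(z)=G(\phi_t(z))$ for all $z\in\mathbb D$, $t\ge0$. The Denjoy–Wolff point of a holomorphic self-map $\varphi\ne\mathrm{id}$ of $\mathbb D$ is its fixed point in $\mathbb D$ or, if there is none, its boundary regular fixed point $\tau$ with $\varphi'(\tau)\le1$. A point $\sigma\in\partial\mathbb D$ is a boundary regular fixed point (BRFP) of $\varphi$ if $\varphi$ has angular limit $\sigma$ and a finite angular derivative $\varphi'(\sigma)$ at $\sigma$; it is a BRFP of $(\phi_t)$ if it is a BRFP of every $\phi_t$, and the spectral value of $(\phi_t)$ at $\sigma$ is then the angular limit of $G(z)/(\sigma-z)$ as $z\to\sigma$. Let $n\ge1$, let $F=\{\sigma_1,\dots,\sigma_n\}\subset\partial\mathbb D$ consist of $n$ pairwise distinct points, let $\Lambda=(\lambda_1,\dots,\lambda_n)\in(-\infty,0)^n$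 and $\tau\in\overline{\mathbb D}\setminus F$. Denote by $\mathrm{Gen}_\tau(F,\Lambda)$ the class of all infinitesimal generators $G$ of one-parameter semigroups $(\phi_t)$ such that $\tau$ is the Denjoy–Wolff point of every $\phi_t\neq\mathrm{id}$ (so $G\equiv0$ is allowed) and each $\sigma_k$ is a BRFP of $(\phi_t)$ with spectral value $\lambda_k'$ satisfying $\lambda_k\le\lambda_k'\le0$. Put $$p_0(z;F,\Lambda)=\sum_{k=1}^n\alpha_k\frac{\sigma_k+z}{\sigma_k-z},\qquad \alpha_k=\frac{|\tau-\sigma_k|^2}{2|\lambda_k|}.$$ **Theorem.** (1) Every extreme point $G\not\equiv0$ of $\mathrm{Gen}_\tau(F,\Lambda)$ is of the form $$G(z)=\frac{(\tau-z)(1-\overline\tau z)}{ib+\sum_{j=1}^{n-1}a_j\frac{s_j+z}{s_j-z}+p_0(z;F,\Lambda)},\qquad z\in\mathbb D,$$ with some $b\in\mathbb R$, $a_1,\dots,a_{n-1}\ge0$ and $s_1,\dots,s_{n-1}\in\partial\mathbb D$ (points $s_j\in F$ are not excluded). (2) Let $\lambda<0$, $\sigma\in\partial\mathbb D$ and $\tau\in\overline{\mathbb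 D}\setminus\{\sigma\}$. A function $G:\mathbb D\to\mathbb C$ belongs to $\mathrm{Gen}_\tau(\{\sigma\},(\lambda))$ if and only if there is a Borel probability measure $\mu$ on $\partial\mathbb D$ such that $$G(z)=\frac{|\lambda|}{|\sigma-\tau|^2}(\tau-z)(1-\overline\tau z)(1-\overline\sigma z)\int_{\partial\mathbb D}\frac{1-\kappa}{1-\kappa\overline\sigma z}\,d\mu(\kappa)\qquad\text{for all }z\in\mathbb D.$$ -/

import Mathlib

open Filter Topology MeasureTheory
open scoped ComplexConjugate Complex.UnitDisc

/-- The unit circle `∂𝔻`, with its Borel σ-algebra. -/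
abbrev UnitCircle : Type := Metric.sphere (0 : ℂ) 1

/-- A complex-valued function on the open unit disc is holomorphic. -/
def IsHolomorphicOnDisc (f : 𝔻 → ℂ) : Prop :=
  ∃ g : ℂ → ℂ, DifferentiableOn ℂ g (Metric.ball 0 1) ∧ ∀ z : 𝔻, f z = g z

/-- `f` has the angular (non-tangential) limit `l` at the boundary point `σ`: it tends to `l` as
`z → σ` inside every Stolz region `{z : |σ - z| < M (1 - |z|)}`. -/
def HasAngularLimit (f : 𝔻 → ℂ) (σ l : ℂ) : Prop :=
  ∀ M : ℝ, Tendsto f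
    (comap (fun z : 𝔻 => (z : ℂ)) (𝓝 σ) ⊓ 𝓟 {z : 𝔻 | ‖σ - (z : ℂ)‖ < M * (1 - ‖(z : ℂ)‖)}) (𝓝 l)

/-- `σ ∈ ∂𝔻` is a boundary fixed point of the self-map `f`, with finite angular derivative `d`. -/
def HasBoundaryFixedPointDeriv (f : 𝔻 → 𝔻) (σ d : ℂ) : Prop :=
  ‖σ‖ = 1 ∧ HasAngularLimit (fun z => (f z : ℂ)) σ σ ∧
    HasAngularLimit (fun z => ((f z : ℂ) - σ) / ((z : ℂ) - σ)) σ d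

/-- `σ` is a boundary regular fixed point (BRFP) of the self-map `f`. -/
def IsBRFP (f : 𝔻 → 𝔻) (σ : ℂ) : Prop :=
  ∃ d : ℂ, HasBoundaryFixedPointDeriv f σ d

/-- `τ` is the Denjoy-Wolff point of the holomorphic self-map `f ≠ id`: either `τ` is a fixed point
of `f` in `𝔻`, or `f` has no fixed point in `𝔻` and `τ` is a BRFP of `f` with `f'(τ) ≤ 1`. -/
def IsDWPoint (f : 𝔻 → 𝔻) (τ : ℂ) : Prop :=
  (∃ a : 𝔻, (a : ℂ) = τ ∧ f a = a) ∨
    ((∀ a : 𝔻, f a ≠ a) ∧ ∃ d : ℝ, d ≤ 1 ∧ HasBoundaryFixedPointDeriv f τ (d : ℂ))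

/-- `(φ t)`, `t ≥ 0`, is a one-parameter semigroup of holomorphic self-maps of the unit disc
(the values of `φ` at negative times are irrelevant). -/
structure IsOneParameterSemigroup (φ : ℝ → 𝔻 → 𝔻) : Prop where
  holomorphic : ∀ t, 0 ≤ t → IsHolomorphicOnDisc (fun z => (φ t z : ℂ))
  map_zero : ∀ z, φ 0 z = z
  map_add : ∀ s t, 0 ≤ s → 0 ≤ t → ∀ z, φ (s + t) z = φ s (φ t z)
  tendsto_zero : ∀ z, Tendsto (fun t => φ t z) (𝓝[>] 0) (𝓝 z)

/-- `G` is the infinitesimal generator of `(φ t)`: it is holomorphic in `𝔻` and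
`d/dt φ t z = G (φ t z)` for all `t ≥ 0` (one-sided derivative at `t = 0`) and all `z ∈ 𝔻`. -/
def IsInfinitesimalGenerator (φ : ℝ → 𝔻 → 𝔻) (G : 𝔻 → ℂ) : Prop :=
  IsHolomorphicOnDisc G ∧ ∀ z : 𝔻, ∀ t : ℝ, 0 ≤ t →
    HasDerivWithinAt (fun s : ℝ => (φ s z : ℂ)) (G (φ t z)) (Set.Ici 0) t

/-- `τ` is the Denjoy-Wolff point of every element `φ t ≠ id` of the semigroup. For the trivial
semigroup every `τ` has this property, in accordance with the convention that the generator
`G ≡ 0` belongs to `Gen_τ` for every `τ`. -/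
def IsSemigroupDWPoint (φ : ℝ → 𝔻 → 𝔻) (τ : ℂ) : Prop :=
  ∀ t, 0 ≤ t → φ t ≠ id → IsDWPoint (φ t) τ

/-- `σ` is a BRFP of the semigroup `(φ t)` with generator `G`, and `l` is the spectral value of
the semigroup at `σ`, i.e. the angular limit of `G(z)/(σ - z)` at `σ`. -/
def HasSpectralValueAt (φ : ℝ → 𝔻 → 𝔻) (G : 𝔻 → ℂ) (σ : ℂ) (l : ℝ) : Prop :=
  (∀ t, 0 ≤ t → IsBRFP (φ t) σ) ∧ HasAngularLimit (fun z => G z / (σ - (z : ℂ))) σ (l : ℂ)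

/-- The class `Gen_τ(F, Λ)`, with `F = {σ 1, …, σ n}` and `Λ = (Λ 1, …, Λ n)`: all infinitesimal
generators of one-parameter semigroups with Denjoy-Wolff point `τ` (or trivial) having BRFPs
`σ k` with spectral values `l k` such that `Λ k ≤ l k ≤ 0`. -/
def GenClass (τ : ℂ) {n : ℕ} (σ : Fin n → UnitCircle) (Λ : Fin n → ℝ) : Set (𝔻 → ℂ) :=
  {G | ∃ φ : ℝ → 𝔻 → 𝔻, IsOneParameterSemigroup φ ∧ IsInfinitesimalGenerator φ G ∧
    IsSemigroupDWPoint φ τ ∧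
    ∀ k, ∃ l : ℝ, Λ k ≤ l ∧ l ≤ 0 ∧ HasSpectralValueAt φ G (σ k) l}

/-- `p₀(z; F, Λ) = ∑ₖ αₖ (σₖ + z) / (σₖ - z)` with `αₖ = |τ - σₖ|² / (2 |λₖ|)`. -/
noncomputable def pZero (τ : ℂ) {n : ℕ} (σ : Fin n → UnitCircle) (Λ : Fin n → ℝ) (z : ℂ) : ℂ :=
  ∑ k, ((‖τ - (σ k : ℂ)‖ ^ 2 / (2 * |Λ k|) : ℝ) : ℂ) * (((σ k : ℂ) + z) / ((σ k : ℂ) - z))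

/-! ### Herglotz integrals -/

/-! Everything is translated into Herglotz data. By Berkson–Porta, a generator with Denjoy–Wolff
point τ is G = (τ - z)(1 - τ̄z)p with Re p ≥ 0, and Herglotz's theorem writes p as iβ plus the
integral of Cayley kernels against a finite measure ν on the circle. For σ ≠ τ on the circle, having
σ as a BRFP with a spectral value amounts to p vanishing at σ with a finite angular derivative
(`NullAt`): ν has no atom at σ, |κ - σ|⁻² is ν-integrable, and the boundary value is 0. The spectral
value is then -|τ - σ|² · 2∫|κ - σ|⁻² dν, so the bound λ_k becomes a linear inequality in ν.

`exists_herglotz_of_mem_genClass` goes from generators to data: Schwarz–Pick gives Julia's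
inequality, its derivative at t = 0 gives Re p ≥ 0, and Fatou's lemma gives the integrability.
`mem_genClass_of_nullAt` goes back: the field is dissipative for the hyperbolic metric, so
trajectories exist for all times and depend holomorphically on the initial point; monotonicity of
the real part of a Cayley transform along the flow produces the boundary fixed points.

For a single σ, p equals (1 - σ̄z) times the integral of a kernel against 2|κ - σ|⁻²ν, which after
normalisation has mass at most 1. The missing mass can be put where the kernel vanishes, which gives
the representation by probability measures.

For extreme points, the admissible (β, ν) obey n real linear equations (p vanishes at each σ_k) and
n linear inequalities; let J be the set of saturated ones. If ν charged n + |J| disjoint sets, a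
step function h and a real b would satisfy all active constraints, and ν(1 ± εh), β ± εb would split
G. So ν has N < n + |J| atoms. Then p is rational, its zeros are simple and lie on the circle, and
1/p is again a Herglotz sum, with N atoms located at these zeros. Every σ_k is among them, with
weight at least α_k and exactly α_k for k in J. Subtracting p₀ removes the atoms of J and leaves at
most n - 1. -/

/-- The Herglotz integral `iβ + ∫ (κ + z) / (κ - z) dν(κ)`. -/
noncomputable def herglotz (β : ℝ) (ν : Measure UnitCircle) (z : ℂ) : ℂ :=
  Complex.I * β + ∫ κ : UnitCircle, ((κ : ℂ) + z) / ((κ : ℂ) - z) ∂ν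

theorem UnitCircle.norm_coe (κ : UnitCircle) : ‖(κ : ℂ)‖ = 1 := by
  simp

theorem UnitCircle.coe_ne_zero (κ : UnitCircle) : (κ : ℂ) ≠ 0 := by
  intro h
  have := κ.norm_coe
  simp [h] at this

theorem UnitCircle.conj_mul_coe (κ : UnitCircle) : conj (κ : ℂ) * κ = 1 := by
  rw [Complex.conj_mul', κ.norm_coe]; simp

theorem UnitCircle.conj_coe (κ : UnitCircle) : conj (κ : ℂ) = (κ : ℂ)⁻¹ :=
  eq_inv_of_mul_eq_one_left κ.conj_mul_coe

theorem one_sub_norm_le_norm_coe_sub (κ : UnitCircle) (z : ℂ) : 1 - ‖z‖ ≤ ‖(κ : ℂ) - z‖ := by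
  have := norm_sub_norm_le (κ : ℂ) z
  rwa [κ.norm_coe] at this

theorem coe_sub_ne_zero (κ : UnitCircle) {z : ℂ} (hz : ‖z‖ < 1) : (κ : ℂ) - z ≠ 0 := by
  have := one_sub_norm_le_norm_coe_sub κ z
  exact norm_pos_iff.1 (by linarith)

theorem norm_cayley_le (κ : UnitCircle) {z : ℂ} (hz : ‖z‖ < 1) :
    ‖((κ : ℂ) + z) / ((κ : ℂ) - z)‖ ≤ 2 / (1 - ‖z‖) := by
  have h1 : ‖(κ : ℂ) + z‖ ≤ 2 := (norm_add_le _ _).trans (by rw [κ.norm_coe]; linarith)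
  rw [norm_div]
  exact div_le_div₀ (by norm_num) h1 (by linarith) (one_sub_norm_le_norm_coe_sub κ z)

theorem re_cayley (a z : ℂ) : ((a + z) / (a - z)).re = (‖a‖ ^ 2 - ‖z‖ ^ 2) / ‖a - z‖ ^ 2 := by
  have := congrFun (poissonKernel_eq_re_herglotzRieszKernel (c := 0) (w := z)) a
  simpa [poissonKernel, herglotzRieszKernel] using this.symm

theorem re_cayley_coe (κ : UnitCircle) (z : ℂ) :
    (((κ : ℂ) + z) / ((κ : ℂ) - z)).re = (1 - ‖z‖ ^ 2) / ‖(κ : ℂ) - z‖ ^ 2 := by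
  rw [re_cayley, κ.norm_coe]; norm_num

theorem continuous_cayley {z : ℂ} (hz : ‖z‖ < 1) :
    Continuous fun κ : UnitCircle => ((κ : ℂ) + z) / ((κ : ℂ) - z) :=
  Continuous.div (by fun_prop) (by fun_prop) fun κ => coe_sub_ne_zero κ hz

theorem integrable_cayley (ν : Measure UnitCircle) [IsFiniteMeasure ν] {z : ℂ} (hz : ‖z‖ < 1) :
    Integrable (fun κ : UnitCircle => ((κ : ℂ) + z) / ((κ : ℂ) - z)) ν :=
  Integrable.of_bound (continuous_cayley hz).aestronglyMeasurable _
    (Eventually.of_forall fun κ => norm_cayley_le κ hz)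

theorem herglotz_re (β : ℝ) (ν : Measure UnitCircle) [IsFiniteMeasure ν] {z : ℂ} (hz : ‖z‖ < 1) :
    (herglotz β ν z).re = ∫ κ : UnitCircle, (1 - ‖z‖ ^ 2) / ‖(κ : ℂ) - z‖ ^ 2 ∂ν := by
  have := integral_re (integrable_cayley ν hz)
  simp only [RCLike.re_to_complex, re_cayley_coe] at this
  simp [herglotz, this]

theorem herglotz_re_nonneg (β : ℝ) (ν : Measure UnitCircle) [IsFiniteMeasure ν] {z : ℂ}
    (hz : ‖z‖ < 1) : 0 ≤ (herglotz β ν z).re := by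
  rw [herglotz_re β ν hz]
  refine integral_nonneg fun κ => div_nonneg ?_ (by positivity)
  nlinarith [norm_nonneg z]

theorem herglotz_re_pos (β : ℝ) (ν : Measure UnitCircle) [IsFiniteMeasure ν] (hν : ν ≠ 0) {z : ℂ}
    (hz : ‖z‖ < 1) : 0 < (herglotz β ν z).re := by
  rw [herglotz_re β ν hz, integral_pos_iff_support_of_nonneg]
  · have : Function.support (fun κ : UnitCircle => (1 - ‖z‖ ^ 2) / ‖(κ : ℂ) - z‖ ^ 2)
        = Set.univ := by
      refine Set.eq_univ_of_forall fun κ => ?_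
      have h1 := coe_sub_ne_zero κ hz
      have h2 : (1 - ‖z‖ ^ 2) ≠ 0 := by nlinarith [norm_nonneg z]
      simp [h1, h2]
    rw [this]
    exact Measure.measure_univ_pos.2 hν
  · refine fun κ => div_nonneg ?_ (by positivity)
    nlinarith [norm_nonneg z]
  · have := (integrable_cayley ν hz).re
    simpa only [RCLike.re_to_complex, re_cayley_coe] using this

theorem hasDerivAt_herglotz (β : ℝ) (ν : Measure UnitCircle) [IsFiniteMeasure ν] {w : ℂ}
    (hw : ‖w‖ < 1) : HasDerivAt (herglotz β ν)
      (∫ κ : UnitCircle, 2 * (κ : ℂ) / ((κ : ℂ) - w) ^ 2 ∂ν) w := by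
  -- On the disc of radius d around w every point keeps distance at least d from the circle, so the
  -- differentiated kernel is bounded by 2/d².
  set d := (1 - ‖w‖) / 2 with hd
  have hd0 : 0 < d := by rw [hd]; linarith
  have hsub : ∀ x ∈ Metric.ball w d, ‖x‖ < 1 - d := by
    intro x hx
    rw [mem_ball_iff_norm] at hx
    have := norm_add_le (x - w) w
    rw [sub_add_cancel] at this
    linarith
  have key := hasDerivAt_integral_of_dominated_loc_of_deriv_le (μ := ν) (𝕜 := ℂ) (x₀ := w)
    (F := fun z (κ : UnitCircle) => ((κ : ℂ) + z) / ((κ : ℂ) - z))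
    (F' := fun z (κ : UnitCircle) => 2 * (κ : ℂ) / ((κ : ℂ) - z) ^ 2)
    (bound := fun _ => 2 / d ^ 2) (Metric.ball_mem_nhds w hd0)
    (by
      filter_upwards [Metric.ball_mem_nhds w hd0] with x hx
      exact (continuous_cayley (by linarith [hsub x hx])).aestronglyMeasurable)
    (integrable_cayley ν hw)
    (Measurable.aestronglyMeasurable (by fun_prop))
    (by
      refine Eventually.of_forall fun κ x hx => ?_
      have h1 := one_sub_norm_le_norm_coe_sub κ x
      have h2 := hsub x hx
      rw [norm_div, norm_mul, norm_pow, κ.norm_coe]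
      simp only [Complex.norm_ofNat, mul_one]
      gcongr
      linarith)
    (integrable_const _)
    (by
      refine Eventually.of_forall fun κ x hx => ?_
      have h1 := coe_sub_ne_zero κ (z := x) (by linarith [hsub x hx])
      have h3 := ((hasDerivAt_id' x).const_add (κ : ℂ)).div ((hasDerivAt_id' x).const_sub (κ : ℂ)) h1
      simpa [sub_sub, ← two_mul, Pi.div_def] using h3)
  exact key.2.const_add _

theorem differentiableOn_herglotz (β : ℝ) (ν : Measure UnitCircle) [IsFiniteMeasure ν] :
    DifferentiableOn ℂ (herglotz β ν) (Metric.ball 0 1) := fun _ hw =>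
  (hasDerivAt_herglotz β ν (mem_ball_zero_iff.1 hw)).differentiableAt.differentiableWithinAt

/-! ### Existence of the Herglotz representation -/

theorem exists_measure_integral_eq_circleAverage {g : ℂ → ℝ}
    (hg : ContinuousOn g (Metric.sphere 0 1)) (hg0 : ∀ z ∈ Metric.sphere (0 : ℂ) 1, 0 ≤ g z) :
    ∃ ν : FiniteMeasure UnitCircle, ∀ H : ℂ → ℝ, ContinuousOn H (Metric.sphere 0 1) →
      ∫ κ : UnitCircle, H κ ∂(ν : Measure UnitCircle)
        = Real.circleAverage (fun z => H z * g z) 0 1 := by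
  have hmem : ∀ θ : ℝ, circleMap 0 1 θ ∈ Metric.sphere (0 : ℂ) 1 := fun θ =>
    circleMap_mem_sphere 0 zero_le_one θ
  set e : ℝ → UnitCircle := fun θ => ⟨circleMap 0 1 θ, hmem θ⟩ with he
  have hec : Continuous e := (continuous_circleMap 0 1).subtype_mk hmem
  have hgc : Continuous fun θ : ℝ => g (circleMap 0 1 θ) / (2 * Real.pi) :=
    (hg.comp_continuous (continuous_circleMap 0 1) hmem).div_const _
  have hgi : IntegrableOn (fun θ : ℝ => g (circleMap 0 1 θ) / (2 * Real.pi))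
      (Set.Ioc 0 (2 * Real.pi)) := hgc.integrableOn_Ioc
  set μ := (volume.restrict (Set.Ioc 0 (2 * Real.pi))).withDensity
    (fun θ : ℝ => ENNReal.ofReal (g (circleMap 0 1 θ) / (2 * Real.pi))) with hμ
  have hfin : IsFiniteMeasure μ := isFiniteMeasure_withDensity_ofReal hgi.2
  refine ⟨⟨μ.map e, inferInstance⟩, fun H hH => ?_⟩
  have hHc : Continuous fun κ : UnitCircle => H κ :=
    hH.comp_continuous continuous_subtype_val fun κ => κ.2
  show ∫ κ : UnitCircle, H κ ∂(μ.map e) = _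
  rw [integral_map hec.measurable.aemeasurable hHc.aestronglyMeasurable, hμ,
    integral_withDensity_eq_integral_toReal_smul hgc.measurable.ennreal_ofReal
      (Eventually.of_forall fun _ => ENNReal.ofReal_lt_top), Real.circleAverage_def,
    intervalIntegral.integral_of_le (by positivity), smul_eq_mul, ← integral_const_mul]
  congr 1 with θ
  rw [ENNReal.toReal_ofReal (div_nonneg (hg0 _ (hmem θ)) (by positivity))]
  simp only [he, smul_eq_mul]
  field_simp

/-- Each dilation f(r·) is continuous up to the circle, so its real part is the Poisson integral of
the measure with density Re f(rκ). These measures all have mass Re f(0), hence lie in a weakly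
compact set, and a cluster point as r → 1 represents Re f; only an imaginary constant is then left
to determine. -/
theorem exists_herglotz {f : ℂ → ℂ} (hf : DifferentiableOn ℂ f (Metric.ball 0 1))
    (hre : ∀ z : ℂ, ‖z‖ < 1 → 0 ≤ (f z).re) :
    ∃ (β : ℝ) (ν : Measure UnitCircle), IsFiniteMeasure ν ∧
      ∀ z : ℂ, ‖z‖ < 1 → f z = herglotz β ν z := by
  have hdil : ∀ r ∈ Set.Ioo (0 : ℝ) 1, ∃ ν : FiniteMeasure UnitCircle, ν.mass = (f 0).re ∧
      ∀ w : ℂ, ‖w‖ < 1 → ∫ κ : UnitCircle, (1 - ‖w‖ ^ 2) / ‖(κ : ℂ) - w‖ ^ 2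
        ∂(ν : Measure UnitCircle) = (f (r * w)).re := by
    intro r hr
    have hmap : Set.MapsTo (fun z : ℂ => (r : ℂ) * z) (Metric.closedBall 0 1) (Metric.ball 0 1) := by
      intro z hz
      rw [mem_closedBall_zero_iff] at hz
      rw [mem_ball_zero_iff, norm_mul, Complex.norm_real, Real.norm_of_nonneg hr.1.le]
      nlinarith [hr.1, hr.2, norm_nonneg z]
    have hd : DifferentiableOn ℂ (fun z : ℂ => f (r * z)) (Metric.closedBall 0 1) :=
      hf.comp (by fun_prop) hmap
    have hdc : DiffContOnCl ℂ (fun z : ℂ => f (r * z)) (Metric.ball 0 1) :=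
      DifferentiableOn.diffContOnCl (by rwa [closure_ball _ one_ne_zero])
    have hcs : ContinuousOn (fun z : ℂ => f (r * z)) (Metric.sphere 0 1) :=
      hd.continuousOn.mono Metric.sphere_subset_closedBall
    obtain ⟨ν, hν⟩ := exists_measure_integral_eq_circleAverage
      (g := fun z => (f (r * z)).re) (Complex.continuous_re.comp_continuousOn hcs)
      (fun z hz => hre _ (mem_ball_zero_iff.1 (hmap (Metric.sphere_subset_closedBall hz))))
    have hP : ∀ w : ℂ, ‖w‖ < 1 → ∫ κ : UnitCircle, (1 - ‖w‖ ^ 2) / ‖(κ : ℂ) - w‖ ^ 2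
        ∂(ν : Measure UnitCircle) = (f (r * w)).re := by
      intro w hw
      have hne : ∀ z ∈ Metric.sphere (0 : ℂ) 1, ‖z - w‖ ^ 2 ≠ 0 := fun z hz =>
        pow_ne_zero 2 (norm_ne_zero_iff.2 (coe_sub_ne_zero ⟨z, hz⟩ hw))
      have hPc : ContinuousOn (fun z : ℂ => (1 - ‖w‖ ^ 2) / ‖z - w‖ ^ 2) (Metric.sphere 0 1) :=
        ContinuousOn.div (by fun_prop) (by fun_prop) hne
      rw [hν (fun z => (1 - ‖w‖ ^ 2) / ‖z - w‖ ^ 2) hPc]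
      have h1 := hdc.circleAverage_poissonKernel_smul' (w := w) (by simpa using hw)
      have hci : CircleIntegrable
          (fun z => ((‖z - 0‖ ^ 2 - ‖w - 0‖ ^ 2) / ‖z - 0 - (w - 0)‖ ^ 2) • f (r * z)) 0 1 := by
        refine ContinuousOn.circleIntegrable zero_le_one (ContinuousOn.fun_smul ?_ hcs)
        exact ContinuousOn.div (by fun_prop) (by fun_prop) (by simpa using hne)
      have h2 := Complex.reCLM.circleAverage_comp_comm hci
      rw [h1] at h2
      simp only [Complex.reCLM_apply] at h2
      rw [← h2]
      refine Real.circleAverage_congr_sphere fun z hz => ?_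
      have hz1 : ‖z‖ = 1 := by simpa using hz
      simp only [Function.comp, Complex.reCLM_apply, sub_zero, Complex.smul_re, smul_eq_mul, hz1,
        one_pow]
    refine ⟨ν, ?_, hP⟩
    have h0 := hP 0 (by simp)
    simp only [norm_zero, UnitCircle.norm_coe, sub_zero, mul_zero] at h0
    norm_num at h0
    rw [← h0]
  choose! u hu1 hu2 using hdil
  set C : NNReal := ⟨(f 0).re, hre 0 (by simp)⟩ with hC
  have hK := isCompact_setOfPred_finiteMeasure_eq_of_compactSpace UnitCircle C
  have hev : ∀ᶠ r in 𝓝[<] (1 : ℝ), r ∈ Set.Ioo (0 : ℝ) 1 :=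
    Ioo_mem_nhdsLT one_pos
  have huK : ∀ᶠ r in 𝓝[<] (1 : ℝ), u r ∈ {μ : FiniteMeasure UnitCircle | μ.mass = C} := by
    filter_upwards [hev] with r hr
    exact NNReal.coe_injective (hu1 r hr)
  obtain ⟨ν, -, hνc⟩ := hK.exists_mapClusterPt (f := 𝓝[<] (1 : ℝ)) (u := u) (by
    rw [le_principal_iff]; exact huK)
  -- An ultrafilter finer than r → 1 plays the role of a convergent subsequence.
  obtain ⟨U, hU, hUν⟩ := mapClusterPt_iff_ultrafilter.1 hνc
  have hlim : ∀ w : ℂ, ‖w‖ < 1 → ∫ κ : UnitCircle, (1 - ‖w‖ ^ 2) / ‖(κ : ℂ) - w‖ ^ 2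
      ∂(ν : Measure UnitCircle) = (f w).re := by
    intro w hw
    have hc : Continuous fun κ : UnitCircle => (1 - ‖w‖ ^ 2) / ‖(κ : ℂ) - w‖ ^ 2 :=
      Continuous.div (by fun_prop) (by fun_prop)
        fun κ => pow_ne_zero 2 (norm_ne_zero_iff.2 (coe_sub_ne_zero κ hw))
    have h1 := FiniteMeasure.tendsto_iff_forall_integral_tendsto.1 hUν
      (BoundedContinuousFunction.mkOfCompact ⟨_, hc⟩)
    simp only [BoundedContinuousFunction.mkOfCompact_apply, ContinuousMap.coe_mk] at h1
    have h2 : Tendsto (fun r : ℝ => (f (r * w)).re) U (𝓝 (f w).re) := by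
      have hcont : ContinuousAt (fun r : ℝ => (f (r * w)).re) 1 := by
        refine Complex.continuous_re.continuousAt.comp ?_
        have hfw : ContinuousAt f (((1 : ℝ) : ℂ) * w) := by
          rw [Complex.ofReal_one, one_mul]
          exact (hf.differentiableAt (Metric.isOpen_ball.mem_nhds (by simpa using hw))).continuousAt
        exact ContinuousAt.comp (f := fun r : ℝ => (r : ℂ) * w) hfw (by fun_prop)
      have := hcont.tendsto
      simp only [Complex.ofReal_one, one_mul] at this
      exact this.mono_left (hU.trans nhdsWithin_le_nhds)
    refine tendsto_nhds_unique (h1.congr' ?_) h2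
    filter_upwards [hU hev] with r hr
    exact hu2 r hr w hw
  have hdiff : AnalyticOnNhd ℂ (fun z => f z - herglotz 0 ν z) (Metric.ball 0 1) :=
    (hf.sub (differentiableOn_herglotz 0 ν)).analyticOnNhd Metric.isOpen_ball
  obtain ⟨c, hc⟩ := hdiff.eq_re_add_const_mul_I_of_re_eq_const (c₀ := 0)
    (by
      intro z hz
      rw [mem_ball_zero_iff] at hz
      simp only [Complex.sub_re]
      rw [herglotz_re 0 _ hz, hlim z hz, sub_self])
    Metric.isOpen_ball (Metric.isConnected_ball one_pos)
  refine ⟨c, ν, inferInstance, fun z hz => ?_⟩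
  have := hc z (by simpa using hz)
  rw [sub_eq_iff_eq_add] at this
  rw [this]
  simp [herglotz]
  ring

/-! ### Angular limits of Herglotz integrals -/

/-- The filter of non-tangential approach to `σ` inside the Stolz region of aperture `M`. -/
noncomputable def stolzFilter (σ : ℂ) (M : ℝ) : Filter 𝔻 :=
  comap (fun z : 𝔻 => (z : ℂ)) (𝓝 σ) ⊓ 𝓟 {z : 𝔻 | ‖σ - (z : ℂ)‖ < M * (1 - ‖(z : ℂ)‖)}

/-- Dominated convergence along a filter requires countable generation. -/
instance (σ : ℂ) (M : ℝ) : (stolzFilter σ M).IsCountablyGenerated := by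
  unfold stolzFilter; infer_instance

theorem tendsto_coe_stolzFilter (σ : ℂ) (M : ℝ) :
    Tendsto (fun z : 𝔻 => (z : ℂ)) (stolzFilter σ M) (𝓝 σ) :=
  tendsto_comap.mono_left inf_le_left

theorem eventually_stolzFilter (σ : ℂ) (M : ℝ) :
    ∀ᶠ z : 𝔻 in stolzFilter σ M, ‖σ - (z : ℂ)‖ < M * (1 - ‖(z : ℂ)‖) :=
  Filter.le_def.1 inf_le_right _ (mem_principal_self _)

theorem UnitCircle.coe_ne_coe_disc (σ : UnitCircle) (z : 𝔻) : (σ : ℂ) - (z : ℂ) ≠ 0 :=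
  coe_sub_ne_zero σ z.norm_lt_one

theorem UnitCircle.one_sub_conj_mul (σ : UnitCircle) (z : ℂ) :
    1 - conj (σ : ℂ) * z = conj (σ : ℂ) * (σ - z) := by
  rw [mul_sub, σ.conj_mul_coe]

theorem UnitCircle.one_sub_conj_mul_ne_zero (σ : UnitCircle) {z : ℂ} (hz : ‖z‖ < 1) :
    1 - conj (σ : ℂ) * z ≠ 0 := by
  rw [σ.one_sub_conj_mul]
  exact mul_ne_zero ((map_ne_zero _).2 σ.coe_ne_zero) (coe_sub_ne_zero σ hz)

theorem UnitCircle.norm_one_sub_conj_mul (σ : UnitCircle) (z : ℂ) :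
    ‖1 - conj (σ : ℂ) * z‖ = ‖(σ : ℂ) - z‖ := by
  rw [σ.one_sub_conj_mul, norm_mul, RCLike.norm_conj, σ.norm_coe, one_mul]

/-- Since 1 - |z| ≤ |κ - z|, the Stolz condition bounds the quotient uniformly in κ. This is the
source of every dominating function for angular limits. -/
theorem norm_div_coe_sub_le (σ κ : UnitCircle) {M : ℝ} {z : 𝔻}
    (hz : ‖(σ : ℂ) - (z : ℂ)‖ < M * (1 - ‖(z : ℂ)‖)) :
    ‖(σ : ℂ) - (z : ℂ)‖ / ‖(κ : ℂ) - (z : ℂ)‖ ≤ M := by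
  have h1 := one_sub_norm_le_norm_coe_sub κ z
  have h2 := z.norm_lt_one
  have h3 := norm_nonneg ((σ : ℂ) - (z : ℂ))
  have hM : 0 < M := by
    by_contra hM
    nlinarith
  rw [div_le_iff₀ (by linarith)]
  nlinarith

theorem UnitCircle.norm_real_mul {r : ℝ} (hr : 0 ≤ r) (σ : UnitCircle) : ‖(r : ℂ) * σ‖ = r := by
  rw [norm_mul, σ.norm_coe, mul_one, Complex.norm_real, Real.norm_of_nonneg hr]

/-- On a radius |σ - rσ| = 1 - r, so aperture 2 suffices and every angular limit is a radial limit.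
The value of `e` outside (0, 1) is irrelevant. -/
theorem exists_tendsto_stolzFilter (σ : UnitCircle) :
    ∃ e : ℝ → 𝔻, (∀ r ∈ Set.Ioo (0 : ℝ) 1, (e r : ℂ) = r * σ) ∧
      Tendsto e (𝓝[<] 1) (stolzFilter σ 2) := by
  have hev : ∀ᶠ r in 𝓝[<] (1 : ℝ), r ∈ Set.Ioo (0 : ℝ) 1 := Ioo_mem_nhdsLT one_pos
  classical
  set e : ℝ → 𝔻 := fun r => if h : ‖(r : ℂ) * σ‖ < 1 then .mk _ h else 0 with he
  have hev2 : ∀ r ∈ Set.Ioo (0 : ℝ) 1, (e r : ℂ) = r * σ := by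
    intro r hr
    have : ‖(r : ℂ) * σ‖ < 1 := by rw [σ.norm_real_mul hr.1.le]; exact hr.2
    simp only [he, dif_pos this, Complex.UnitDisc.coe_mk]
  refine ⟨e, hev2, tendsto_inf.2 ⟨tendsto_comap_iff.2 ?_, tendsto_principal.2 ?_⟩⟩
  · have h1 : Tendsto (fun r : ℝ => (r : ℂ) * σ) (𝓝[<] 1) (𝓝 σ) := by
      have : ContinuousAt (fun r : ℝ => (r : ℂ) * σ) 1 := by fun_prop
      have := this.tendsto
      simp only [Complex.ofReal_one, one_mul] at this
      exact this.mono_left nhdsWithin_le_nhds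
    refine h1.congr' ?_
    filter_upwards [hev] with r hr
    exact (hev2 r hr).symm
  · filter_upwards [hev] with r hr
    have h1 : (σ : ℂ) - r * σ = ((1 - r : ℝ) : ℂ) * σ := by push_cast; ring
    rw [hev2 r hr, σ.norm_real_mul hr.1.le, h1, σ.norm_real_mul (by linarith [hr.2])]
    linarith [hr.2]

theorem tendsto_radius_stolzFilter (σ : UnitCircle) {f : 𝔻 → ℂ} {F : ℂ → ℂ} {l : ℂ}
    (hF : ∀ z : 𝔻, f z = F z) (h : HasAngularLimit f σ l) :
    Tendsto (fun r : ℝ => F (r * σ)) (𝓝[<] 1) (𝓝 l) := by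
  have hev : ∀ᶠ r in 𝓝[<] (1 : ℝ), r ∈ Set.Ioo (0 : ℝ) 1 := Ioo_mem_nhdsLT one_pos
  obtain ⟨e, he, ht⟩ := exists_tendsto_stolzFilter σ
  refine ((h 2).comp ht).congr' ?_
  filter_upwards [hev] with r hr
  simp only [Function.comp, hF, he r hr]

/-- In a Stolz region the kernel times 1 - σ̄z is bounded by 2M; it tends to 0 for κ ≠ σ and to 2
for κ = σ, so the limit isolates the atom at σ. -/
theorem hasAngularLimit_herglotz_mul (β : ℝ) (ν : Measure UnitCircle) [IsFiniteMeasure ν]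
    (σ : UnitCircle) :
    HasAngularLimit (fun z => herglotz β ν z * (1 - conj (σ : ℂ) * z)) σ
      ((2 * ν.real {σ} : ℝ) : ℂ) := by
  intro M
  have hz := tendsto_coe_stolzFilter σ M
  have h0 : Tendsto (fun z : 𝔻 => 1 - conj (σ : ℂ) * (z : ℂ)) (stolzFilter σ M) (𝓝 0) := by
    have := (hz.const_mul (conj (σ : ℂ))).const_sub 1
    rwa [σ.conj_mul_coe, sub_self] at this
  have key : Tendsto (fun z : 𝔻 => ∫ κ : UnitCircle,
      ((κ : ℂ) + z) / ((κ : ℂ) - z) * (1 - conj (σ : ℂ) * z) ∂ν) (stolzFilter σ M)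
      (𝓝 (∫ κ : UnitCircle, Set.indicator {σ} (fun _ => (2 : ℂ)) κ ∂ν)) := by
    refine tendsto_integral_filter_of_dominated_convergence (fun _ => 2 * M) ?_ ?_
      (integrable_const _) ?_
    · exact Eventually.of_forall fun z =>
        ((continuous_cayley z.norm_lt_one).mul continuous_const).aestronglyMeasurable
    · filter_upwards [eventually_stolzFilter σ M] with z hzM
      refine Eventually.of_forall fun κ => ?_
      have h1 := norm_div_coe_sub_le σ κ hzM
      have h2 : ‖(κ : ℂ) + z‖ ≤ 2 :=
        (norm_add_le _ _).trans (by rw [κ.norm_coe]; linarith [z.norm_lt_one])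
      rw [norm_mul, norm_div, σ.norm_one_sub_conj_mul, div_mul_eq_mul_div, mul_div_assoc]
      gcongr
    · refine Eventually.of_forall fun κ => ?_
      by_cases hκ : κ = σ
      · subst hκ
        have h1 : ∀ z : 𝔻, ((κ : ℂ) + z) / ((κ : ℂ) - z) * (1 - conj (κ : ℂ) * z)
            = 1 + conj (κ : ℂ) * z := by
          intro z
          have := κ.coe_ne_coe_disc z
          rw [κ.one_sub_conj_mul]
          field_simp
          linear_combination κ.conj_mul_coe
        simp only [h1, Set.mem_singleton_iff, Set.indicator_of_mem]
        have := (hz.const_mul (conj (κ : ℂ))).const_add 1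
        rw [κ.conj_mul_coe] at this
        norm_num at this
        exact this
      · rw [Set.indicator_of_notMem (by simpa using hκ)]
        have hne : (κ : ℂ) - σ ≠ 0 := sub_ne_zero.2 fun h => hκ (Subtype.ext h)
        have := ((hz.const_add (κ : ℂ)).div (hz.const_sub (κ : ℂ)) hne).mul h0
        rwa [mul_zero] at this
  have hI : ∫ κ : UnitCircle, Set.indicator {σ} (fun _ => (2 : ℂ)) κ ∂ν
      = ((2 * ν.real {σ} : ℝ) : ℂ) := by
    rw [integral_indicator (measurableSet_singleton σ)]
    simp [mul_comm, Measure.real]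
  rw [hI] at key
  have h1 := (h0.const_mul (Complex.I * β)).add key
  rw [mul_zero, zero_add] at h1
  refine h1.congr fun z => ?_
  rw [integral_mul_const, herglotz]
  ring

/-- If the Cayley transforms of `z` and `φ z` at `σ` differ by a factor `c > 0` and a summand with
nonnegative real part, then `σ` is a boundary fixed point of `φ`. -/
theorem hasBoundaryFixedPointDeriv_of_cayley {φ : 𝔻 → 𝔻} {σ : UnitCircle} {c : ℝ} (hc : 0 < c)
    {β : ℝ} {ν : Measure UnitCircle} [IsFiniteMeasure ν]
    (h : ∀ z : 𝔻, ((σ : ℂ) + φ z) / ((σ : ℂ) - φ z)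
      = c * (((σ : ℂ) + z) / ((σ : ℂ) - z)) + herglotz β ν z) :
    HasBoundaryFixedPointDeriv φ σ (((c + ν.real {σ})⁻¹ : ℝ) : ℂ) := by
  have hν : 0 ≤ ν.real {σ} := measureReal_nonneg
  have hpos : ((2 * c + 2 * ν.real {σ} : ℝ) : ℂ) ≠ 0 := by
    rw [Ne, Complex.ofReal_eq_zero]; positivity
  have hquot : HasAngularLimit (fun z => ((φ z : ℂ) - σ) / ((z : ℂ) - σ)) σ
      (((c + ν.real {σ})⁻¹ : ℝ) : ℂ) := by
    intro M
    have hz := tendsto_coe_stolzFilter σ M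
    have h0 : Tendsto (fun z : 𝔻 => 1 - conj (σ : ℂ) * (z : ℂ)) (stolzFilter σ M) (𝓝 0) := by
      have := (hz.const_mul (conj (σ : ℂ))).const_sub 1
      rwa [σ.conj_mul_coe, sub_self] at this
    have h1 : Tendsto (fun z : 𝔻 => 1 + conj (σ : ℂ) * (z : ℂ)) (stolzFilter σ M) (𝓝 2) := by
      have := (hz.const_mul (conj (σ : ℂ))).const_add 1
      rw [σ.conj_mul_coe] at this
      norm_num at this
      exact this
    have h2 := ((h0.add (h1.const_mul (c : ℂ))).add (hasAngularLimit_herglotz_mul β ν σ M))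
    have h3 : (0 + (c : ℂ) * 2 + ((2 * ν.real {σ} : ℝ) : ℂ)) = ((2 * c + 2 * ν.real {σ} : ℝ) : ℂ) := by
      push_cast; ring
    rw [h3] at h2
    have h4 := (h2.inv₀ hpos).const_mul 2
    have h5 : 2 * ((2 * c + 2 * ν.real {σ} : ℝ) : ℂ)⁻¹ = (((c + ν.real {σ})⁻¹ : ℝ) : ℂ) := by
      rw [← mul_add]
      push_cast
      rw [mul_inv, ← mul_assoc]
      norm_num
    rw [h5] at h4
    refine h4.congr fun z => ?_
    have hz0 := σ.coe_ne_coe_disc z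
    have hw0 := σ.coe_ne_coe_disc (φ z)
    have hs := σ.coe_ne_zero
    -- With w = φ z one has 1 + (σ + w)/(σ - w) = 2σ/(σ - w); multiplied by 1 - σ̄z this is twice
    -- the reciprocal of the difference quotient at σ.
    have e1 : (1 - conj (σ : ℂ) * z) + c * (1 + conj (σ : ℂ) * z)
        + herglotz β ν z * (1 - conj (σ : ℂ) * z)
        = 2 * ((σ : ℂ) - z) / ((σ : ℂ) - φ z) := by
      have e2 : c * (1 + conj (σ : ℂ) * z)
          = c * (((σ : ℂ) + z) / ((σ : ℂ) - z)) * (1 - conj (σ : ℂ) * z) := by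
        rw [σ.conj_coe]; field_simp
      rw [e2, add_assoc, ← add_mul, ← h z, σ.conj_coe]
      field_simp
      ring
    show 2 * (1 - conj (σ : ℂ) * (z : ℂ) + c * (1 + conj (σ : ℂ) * z)
      + herglotz β ν z * (1 - conj (σ : ℂ) * z))⁻¹ = _
    rw [e1, ← neg_sub (σ : ℂ) (φ z : ℂ), ← neg_sub (σ : ℂ) (z : ℂ), neg_div_neg_eq]
    field_simp
  refine ⟨σ.norm_coe, fun M => ?_, hquot⟩
  have hz := tendsto_coe_stolzFilter σ M
  have h1 := ((hquot M).mul (hz.sub_const (σ : ℂ))).add_const (σ : ℂ)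
  rw [sub_self, mul_zero, zero_add] at h1
  refine h1.congr fun z => ?_
  have : (z : ℂ) - σ ≠ 0 := by
    rw [← neg_sub]; exact neg_ne_zero.2 (σ.coe_ne_coe_disc z)
  field_simp
  ring

/-! ### Boundary zeros of Herglotz integrals and their angular derivatives -/

/-- The Herglotz integral with data `(β, ν)` vanishes at `σ ∈ ∂𝔻` and has a finite angular
derivative there. -/
structure NullAt (β : ℝ) (ν : Measure UnitCircle) (σ : UnitCircle) : Prop where
  measure_singleton : ν {σ} = 0
  integrable : Integrable (fun κ : UnitCircle => (‖(κ : ℂ) - σ‖ ^ 2)⁻¹) ν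
  -- The integral is taken with z on the circle; the junk value of the kernel at κ = σ is harmless
  -- by the first field, and the second makes the integral converge absolutely.
  eq_zero : herglotz β ν σ = 0

theorem ae_ne_of_measure_singleton {ν : Measure UnitCircle} {σ : UnitCircle} (h : ν {σ} = 0) :
    ∀ᵐ κ ∂ν, κ ≠ σ := by
  rw [ae_iff]
  simpa using h

theorem norm_cayley_boundary_le (κ σ : UnitCircle) :
    ‖((κ : ℂ) + σ) / ((κ : ℂ) - σ)‖ ≤ 1 + (‖(κ : ℂ) - σ‖ ^ 2)⁻¹ := by
  have h1 : ‖(κ : ℂ) + σ‖ ≤ 2 := (norm_add_le _ _).trans (by rw [κ.norm_coe, σ.norm_coe]; norm_num)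
  rw [norm_div, ← inv_pow, div_eq_mul_inv]
  have h2 : 0 ≤ ‖(κ : ℂ) - σ‖⁻¹ := by positivity
  nlinarith [sq_nonneg (‖(κ : ℂ) - σ‖⁻¹ - 1)]

theorem integrable_cayley_boundary {ν : Measure UnitCircle} [IsFiniteMeasure ν] {σ : UnitCircle}
    (h : Integrable (fun κ : UnitCircle => (‖(κ : ℂ) - σ‖ ^ 2)⁻¹) ν) :
    Integrable (fun κ : UnitCircle => ((κ : ℂ) + σ) / ((κ : ℂ) - σ)) ν := by
  refine ((integrable_const (1 : ℝ)).add h).mono' (Measurable.aestronglyMeasurable (by fun_prop)) ?_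
  exact Eventually.of_forall fun κ => norm_cayley_boundary_le κ σ

/-- On the circle conjugation is inversion, so |κ - σ|² = -(κ - σ)²/(κσ). Splitting off 1 - σ̄z and
|κ - σ|⁻² leaves a quotient that is bounded in Stolz regions and tends to 1 at σ for κ ≠ σ. -/
theorem cayley_sub_cayley {κ σ : UnitCircle} (h : κ ≠ σ) {z : ℂ} (hz : ‖z‖ < 1) :
    ((κ : ℂ) + z) / ((κ : ℂ) - z) - ((κ : ℂ) + σ) / ((κ : ℂ) - σ)
      = (1 - conj (σ : ℂ) * z) * (2 * ((1 - conj (κ : ℂ) * σ) / (1 - conj (κ : ℂ) * z))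
        * ((‖(κ : ℂ) - σ‖ ^ 2)⁻¹ : ℝ)) := by
  have h1 := coe_sub_ne_zero κ hz
  have h2 : (κ : ℂ) - σ ≠ 0 := sub_ne_zero.2 fun h' => h (Subtype.ext h')
  have h3 := κ.coe_ne_zero
  have h4 := σ.coe_ne_zero
  have h5 : ((‖(κ : ℂ) - σ‖ ^ 2 : ℝ) : ℂ) = -((κ : ℂ) - σ) ^ 2 / (κ * σ) := by
    push_cast
    rw [← Complex.conj_mul', map_sub, κ.conj_coe, σ.conj_coe]
    field_simp
    ring
  rw [Complex.ofReal_inv, h5, κ.one_sub_conj_mul, κ.one_sub_conj_mul, σ.one_sub_conj_mul,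
    κ.conj_coe, σ.conj_coe]
  field_simp
  ring

theorem herglotz_sub_herglotz {β : ℝ} {ν : Measure UnitCircle} [IsFiniteMeasure ν] {σ : UnitCircle}
    (h0 : ν {σ} = 0) (h : Integrable (fun κ : UnitCircle => (‖(κ : ℂ) - σ‖ ^ 2)⁻¹) ν)
    {z : ℂ} (hz : ‖z‖ < 1) :
    herglotz β ν z - herglotz β ν σ = (1 - conj (σ : ℂ) * z) *
      ∫ κ : UnitCircle, 2 * ((1 - conj (κ : ℂ) * σ) / (1 - conj (κ : ℂ) * z))
        * ((‖(κ : ℂ) - σ‖ ^ 2)⁻¹ : ℝ) ∂ν := by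
  rw [herglotz, herglotz, add_sub_add_left_eq_sub, ← integral_sub (integrable_cayley ν hz)
    (integrable_cayley_boundary h), ← integral_const_mul]
  refine integral_congr_ae ?_
  filter_upwards [ae_ne_of_measure_singleton h0] with κ hκ
  exact cayley_sub_cayley hκ hz

/-- Dominated convergence: |κ - σ| ≤ |κ - z| + |σ - z| bounds the quotient in the kernel by 1 + M,
and off the null set {σ} it tends to 1. -/
theorem hasAngularLimit_kernel_integral {ν : Measure UnitCircle} {σ : UnitCircle}
    (h0 : ν {σ} = 0) (h : Integrable (fun κ : UnitCircle => (‖(κ : ℂ) - σ‖ ^ 2)⁻¹) ν) :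
    HasAngularLimit (fun z => ∫ κ : UnitCircle,
      2 * ((1 - conj (κ : ℂ) * σ) / (1 - conj (κ : ℂ) * z)) * ((‖(κ : ℂ) - σ‖ ^ 2)⁻¹ : ℝ) ∂ν) σ
      ((2 * ∫ κ : UnitCircle, (‖(κ : ℂ) - σ‖ ^ 2)⁻¹ ∂ν : ℝ) : ℂ) := by
  intro M
  have hz := tendsto_coe_stolzFilter σ M
  have hI : ((2 * ∫ κ : UnitCircle, (‖(κ : ℂ) - σ‖ ^ 2)⁻¹ ∂ν : ℝ) : ℂ)
      = ∫ κ : UnitCircle, 2 * 1 * (((‖(κ : ℂ) - σ‖ ^ 2)⁻¹ : ℝ) : ℂ) ∂ν := by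
    rw [integral_const_mul, integral_complex_ofReal]; push_cast; ring
  rw [hI]
  refine tendsto_integral_filter_of_dominated_convergence
    (fun κ => 2 * (1 + M) * (‖(κ : ℂ) - σ‖ ^ 2)⁻¹) ?_ ?_ (h.const_mul _) ?_
  · exact Eventually.of_forall fun z => Measurable.aestronglyMeasurable (by fun_prop)
  · filter_upwards [eventually_stolzFilter σ M] with z hzM
    refine Eventually.of_forall fun κ => ?_
    have h1 := norm_div_coe_sub_le σ κ hzM
    have h2 : 0 < ‖(κ : ℂ) - z‖ := norm_pos_iff.2 (κ.coe_ne_coe_disc z)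
    have h3 : ‖(κ : ℂ) - σ‖ / ‖(κ : ℂ) - z‖ ≤ 1 + M := by
      have h4 : ‖(κ : ℂ) - σ‖ ≤ ‖(κ : ℂ) - z‖ + ‖(σ : ℂ) - z‖ := by
        have := norm_sub_le ((κ : ℂ) - z) ((σ : ℂ) - z)
        rwa [sub_sub_sub_cancel_right] at this
      calc ‖(κ : ℂ) - σ‖ / ‖(κ : ℂ) - z‖
          ≤ (‖(κ : ℂ) - z‖ + ‖(σ : ℂ) - z‖) / ‖(κ : ℂ) - z‖ := by gcongr
        _ = 1 + ‖(σ : ℂ) - z‖ / ‖(κ : ℂ) - z‖ := by rw [add_div, div_self h2.ne']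
        _ ≤ 1 + M := by gcongr
    rw [norm_mul, norm_mul, norm_div, κ.norm_one_sub_conj_mul, κ.norm_one_sub_conj_mul,
      Complex.norm_real, Real.norm_of_nonneg (by positivity), Complex.norm_ofNat]
    gcongr
  · filter_upwards [ae_ne_of_measure_singleton h0] with κ hκ
    have hne : 1 - conj (κ : ℂ) * σ ≠ 0 := by
      rw [κ.one_sub_conj_mul]
      exact mul_ne_zero ((map_ne_zero _).2 κ.coe_ne_zero)
        (sub_ne_zero.2 fun h' => hκ (Subtype.ext h'))
    have h1 := ((hz.const_mul (conj (κ : ℂ))).const_sub 1).inv₀ hne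
    have h2 := ((h1.const_mul (1 - conj (κ : ℂ) * σ)).const_mul 2).mul_const
      (((‖(κ : ℂ) - σ‖ ^ 2)⁻¹ : ℝ) : ℂ)
    rw [mul_inv_cancel₀ hne] at h2
    exact h2

theorem NullAt.herglotz_eq {β : ℝ} {ν : Measure UnitCircle} [IsFiniteMeasure ν] {σ : UnitCircle}
    (h : NullAt β ν σ) {z : ℂ} (hz : ‖z‖ < 1) :
    herglotz β ν z = (1 - conj (σ : ℂ) * z) *
      ∫ κ : UnitCircle, 2 * ((1 - conj (κ : ℂ) * σ) / (1 - conj (κ : ℂ) * z))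
        * ((‖(κ : ℂ) - σ‖ ^ 2)⁻¹ : ℝ) ∂ν := by
  rw [← herglotz_sub_herglotz h.measure_singleton h.integrable hz, h.eq_zero, sub_zero]

theorem NullAt.hasAngularLimit {β : ℝ} {ν : Measure UnitCircle} [IsFiniteMeasure ν]
    {σ : UnitCircle} (h : NullAt β ν σ) :
    HasAngularLimit (fun z => herglotz β ν z / (1 - conj (σ : ℂ) * z)) σ
      ((2 * ∫ κ : UnitCircle, (‖(κ : ℂ) - σ‖ ^ 2)⁻¹ ∂ν : ℝ) : ℂ) := by
  intro M
  refine (hasAngularLimit_kernel_integral h.measure_singleton h.integrable M).congr fun z => ?_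
  rw [h.herglotz_eq z.norm_lt_one, mul_div_cancel_left₀]
  exact σ.one_sub_conj_mul_ne_zero z.norm_lt_one

/-- The real part of the quotient at rσ is the integral of (1 + r)/|κ - rσ|² against ν. By Fatou the
pointwise lower limit is integrable; it is 2|κ - σ|⁻² for κ ≠ σ and infinite at κ = σ, which also
rules out an atom there. -/
theorem integrable_of_tendsto_radius {β : ℝ} {ν : Measure UnitCircle} [IsFiniteMeasure ν]
    {σ : UnitCircle} {c : ℝ}
    (h : Tendsto (fun r : ℝ => herglotz β ν (r * σ) / (1 - r)) (𝓝[<] 1) (𝓝 c)) :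
    ν {σ} = 0 ∧ Integrable (fun κ : UnitCircle => (‖(κ : ℂ) - σ‖ ^ 2)⁻¹) ν := by
  -- The shift by 2 keeps r n in (0, 1) already for n = 0.
  set r : ℕ → ℝ := fun n => 1 - 1 / (n + 2 : ℝ) with hr
  have hrI : ∀ n, r n ∈ Set.Ioo (0 : ℝ) 1 := by
    intro n
    have h1 : (0 : ℝ) < n + 2 := by positivity
    have h2 : 1 / (n + 2 : ℝ) < 1 := by rw [div_lt_one h1]; linarith [Nat.cast_nonneg (α := ℝ) n]
    have h3 : 0 < 1 / (n + 2 : ℝ) := by positivity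
    exact ⟨by simp only [hr]; linarith, by simp only [hr]; linarith⟩
  have hr1 : Tendsto r atTop (𝓝 1) := by
    have h1 : Tendsto (fun n : ℕ => 1 / (n + 2 : ℝ)) atTop (𝓝 0) :=
      tendsto_const_nhds.div_atTop (tendsto_natCast_atTop_atTop.atTop_add tendsto_const_nhds)
    simpa [hr] using h1.const_sub 1
  have hr2 : Tendsto r atTop (𝓝[<] 1) :=
    tendsto_nhdsWithin_iff.2 ⟨hr1, Eventually.of_forall fun n => (hrI n).2⟩
  have hnorm : ∀ n, ‖(r n : ℂ) * σ‖ = r n := fun n => by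
    rw [norm_mul, σ.norm_coe, mul_one, Complex.norm_real, Real.norm_of_nonneg (hrI n).1.le]
  set g : ℕ → UnitCircle → ℝ := fun n κ => (1 + r n) * (‖(κ : ℂ) - r n * σ‖ ^ 2)⁻¹ with hg
  have hg0 : ∀ n κ, 0 ≤ g n κ := fun n κ =>
    mul_nonneg (by linarith [(hrI n).1]) (by positivity)
  have hgc : ∀ n, Continuous (g n) := fun n =>
    continuous_const.mul (Continuous.inv₀ (by fun_prop) fun κ => pow_ne_zero 2
      (norm_ne_zero_iff.2 (coe_sub_ne_zero κ (by rw [hnorm]; exact (hrI n).2))))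
  have hgi : ∀ n, Integrable (g n) ν := fun n =>
    (hgc n).integrable_of_hasCompactSupport (HasCompactSupport.of_compactSpace _)
  have hint : ∀ n, ∫ κ, g n κ ∂ν = (herglotz β ν (r n * σ) / (1 - r n)).re := by
    intro n
    have h1 : (1 - r n : ℂ) = ((1 - r n : ℝ) : ℂ) := by push_cast; ring
    have h2 : 1 - r n ≠ 0 := by linarith [(hrI n).2]
    rw [h1, Complex.div_ofReal_re, herglotz_re β ν (by rw [hnorm]; exact (hrI n).2), hnorm,
      ← integral_div]
    congr 1 with κ
    simp only [hg]
    rw [div_div, mul_comm _ (1 - r n), ← div_div, div_eq_mul_inv]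
    congr 1
    field_simp
    ring
  have hlim : Tendsto (fun n => ∫⁻ κ, ENNReal.ofReal (g n κ) ∂ν) atTop (𝓝 (ENNReal.ofReal c)) := by
    have h1 : Tendsto (fun n => ∫ κ, g n κ ∂ν) atTop (𝓝 c) := by
      simp only [hint]
      exact (Complex.continuous_re.tendsto _).comp (h.comp hr2)
    refine ((ENNReal.continuous_ofReal.tendsto _).comp h1).congr fun n => ?_
    exact ofReal_integral_eq_lintegral_ofReal (hgi n) (Eventually.of_forall (hg0 n))
  have hfatou : ∫⁻ κ, liminf (fun n => ENNReal.ofReal (g n κ)) atTop ∂ν ≤ ENNReal.ofReal c := by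
    refine (lintegral_liminf_le fun n => (hgc n).measurable.ennreal_ofReal).trans ?_
    rw [hlim.liminf_eq]
  have hfin : ∫⁻ κ, liminf (fun n => ENNReal.ofReal (g n κ)) atTop ∂ν ≠ ⊤ :=
    ne_top_of_le_ne_top ENNReal.ofReal_ne_top hfatou
  have hliminf_ne : ∀ κ : UnitCircle, κ ≠ σ → liminf (fun n => ENNReal.ofReal (g n κ)) atTop
      = ENNReal.ofReal (2 * (‖(κ : ℂ) - σ‖ ^ 2)⁻¹) := by
    intro κ hκ
    refine Tendsto.liminf_eq ((ENNReal.continuous_ofReal.tendsto _).comp ?_)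
    have hne : ‖(κ : ℂ) - ((1 : ℝ) : ℂ) * σ‖ ^ 2 ≠ 0 := by
      rw [Complex.ofReal_one, one_mul]
      exact pow_ne_zero 2 (norm_ne_zero_iff.2 (sub_ne_zero.2 fun h' => hκ (Subtype.ext h')))
    have hcont : ContinuousAt (fun x : ℝ => (1 + x) * (‖(κ : ℂ) - x * σ‖ ^ 2)⁻¹) 1 :=
      ContinuousAt.mul (by fun_prop) (ContinuousAt.inv₀ (by fun_prop) hne)
    have := hcont.tendsto.comp hr1
    simp only [Complex.ofReal_one, one_mul] at this
    norm_num at this ⊢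
    exact this
  have hliminf_eq : liminf (fun n => ENNReal.ofReal (g n σ)) atTop = ⊤ := by
    refine Tendsto.liminf_eq (ENNReal.tendsto_ofReal_atTop.comp ?_)
    have h1 : ∀ n : ℕ, (n : ℝ) ≤ g n σ := by
      intro n
      have h2 : (σ : ℂ) - r n * σ = ((1 - r n : ℝ) : ℂ) * σ := by push_cast; ring
      have h3 : 1 - r n = 1 / (n + 2 : ℝ) := by simp [hr]
      simp only [hg]
      rw [h2, norm_mul, σ.norm_coe, mul_one, Complex.norm_real,
        Real.norm_of_nonneg (by linarith [(hrI n).2]), h3]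
      have h4 := (hrI n).1
      have h5 : (0 : ℝ) ≤ n := Nat.cast_nonneg n
      simp only [one_div, inv_pow, inv_inv]
      nlinarith
    exact tendsto_atTop_mono h1 tendsto_natCast_atTop_atTop
  have hmeas : Measurable fun κ => liminf (fun n => ENNReal.ofReal (g n κ)) atTop :=
    Measurable.liminf fun n => (hgc n).measurable.ennreal_ofReal
  have h0 : ν {σ} = 0 := by
    have := ae_lt_top hmeas hfin
    refine measure_mono_null ?_ (ae_iff.1 this)
    intro κ hκ
    rw [Set.mem_singleton_iff.1 hκ]
    simp [hliminf_eq]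
  refine ⟨h0, ?_⟩
  have h2 : Integrable (fun κ : UnitCircle => 2 * (‖(κ : ℂ) - σ‖ ^ 2)⁻¹) ν := by
    refine ⟨Measurable.aestronglyMeasurable (by fun_prop), ?_⟩
    rw [hasFiniteIntegral_iff_ofReal (Eventually.of_forall fun κ => by positivity)]
    refine lt_of_le_of_lt (lintegral_mono_ae ?_) (lt_top_iff_ne_top.2 hfin)
    filter_upwards [ae_ne_of_measure_singleton h0] with κ hκ
    rw [hliminf_ne κ hκ]
  simpa using h2.const_mul (1 / 2)

theorem nullAt_of_hasAngularLimit {β : ℝ} {ν : Measure UnitCircle} [IsFiniteMeasure ν]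
    {σ : UnitCircle} {c : ℝ}
    (h : HasAngularLimit (fun z => herglotz β ν z / (1 - conj (σ : ℂ) * z)) σ c) :
    NullAt β ν σ ∧ 2 * ∫ κ : UnitCircle, (‖(κ : ℂ) - σ‖ ^ 2)⁻¹ ∂ν = c := by
  have hev : ∀ᶠ r in 𝓝[<] (1 : ℝ), r ∈ Set.Ioo (0 : ℝ) 1 := Ioo_mem_nhdsLT one_pos
  have hcs : ∀ r : ℝ, 1 - conj (σ : ℂ) * (r * σ) = 1 - r := fun r => by
    rw [mul_left_comm, σ.conj_mul_coe, mul_one]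
  have h1 := tendsto_radius_stolzFilter σ (F := fun z => herglotz β ν z / (1 - conj (σ : ℂ) * z))
    (fun _ => rfl) h
  simp only [hcs] at h1
  obtain ⟨h0, hi⟩ := integrable_of_tendsto_radius h1
  have h2 := tendsto_radius_stolzFilter σ (F := fun z => ∫ κ : UnitCircle,
      2 * ((1 - conj (κ : ℂ) * σ) / (1 - conj (κ : ℂ) * z)) * ((‖(κ : ℂ) - σ‖ ^ 2)⁻¹ : ℝ) ∂ν)
    (fun _ => rfl) (hasAngularLimit_kernel_integral h0 hi)
  have h3 : Tendsto (fun r : ℝ => (1 - r : ℂ)) (𝓝[<] 1) (𝓝 0) := by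
    have : ContinuousAt (fun r : ℝ => (1 - r : ℂ)) 1 := by fun_prop
    have := this.tendsto
    simp only [Complex.ofReal_one, sub_self] at this
    exact this.mono_left nhdsWithin_le_nhds
  have hz : herglotz β ν σ = 0 := by
    -- The first product tends to 0 and represents p(rσ); the second tends to 0 and represents p(rσ)
    -- - p(σ). Their difference is the constant p(σ), which must therefore vanish.
    have h4 := (h3.mul h1).sub (h3.mul h2)
    simp only [zero_mul, sub_zero] at h4
    refine tendsto_nhds_unique (tendsto_const_nhds.congr' ?_) h4
    filter_upwards [hev] with r hr
    have hn : ‖(r : ℂ) * σ‖ < 1 := by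
      rw [norm_mul, σ.norm_coe, mul_one, Complex.norm_real, Real.norm_of_nonneg hr.1.le]
      exact hr.2
    have h5 := herglotz_sub_herglotz (β := β) h0 hi hn
    rw [hcs] at h5
    have h6 : (1 - r : ℂ) ≠ 0 := by
      rw [← Complex.ofReal_one, ← Complex.ofReal_sub, Ne, Complex.ofReal_eq_zero]
      linarith [hr.2]
    rw [← h5, mul_div_cancel₀ _ h6]
    ring
  have hN : NullAt β ν σ := ⟨h0, hi, hz⟩
  refine ⟨hN, ?_⟩
  have h4 := tendsto_radius_stolzFilter σ
    (F := fun z => herglotz β ν z / (1 - conj (σ : ℂ) * z)) (fun _ => rfl) hN.hasAngularLimit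
  simp only [hcs] at h4
  exact_mod_cast tendsto_nhds_unique h4 h1

/-! ### Schwarz-Pick, Julia's lemma and the Berkson-Porta formula -/

theorem norm_one_sub_conj_mul_sq (a z : ℂ) :
    ‖1 - conj a * z‖ ^ 2 - ‖z - a‖ ^ 2 = (1 - ‖a‖ ^ 2) * (1 - ‖z‖ ^ 2) := by
  simp only [← Complex.normSq_eq_norm_sq, Complex.normSq_apply, Complex.sub_re, Complex.sub_im,
    Complex.mul_re, Complex.mul_im, Complex.conj_re, Complex.conj_im, Complex.one_re,
    Complex.one_im]
  ring

theorem one_sub_conj_mul_ne_zero {a z : ℂ} (ha : ‖a‖ ≤ 1) (hz : ‖z‖ < 1) : 1 - conj a * z ≠ 0 := by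
  intro h
  have h1 : ‖conj a * z‖ = 1 := by rw [← sub_eq_zero.1 h, norm_one]
  rw [norm_mul, RCLike.norm_conj] at h1
  nlinarith [norm_nonneg a, norm_nonneg z]

theorem norm_mobius_lt_one {a z : ℂ} (ha : ‖a‖ < 1) (hz : ‖z‖ < 1) :
    ‖(z - a) / (1 - conj a * z)‖ < 1 := by
  have h0 : 0 < ‖1 - conj a * z‖ := norm_pos_iff.2 (one_sub_conj_mul_ne_zero ha.le hz)
  rw [norm_div, div_lt_one h0]
  have h1 := norm_one_sub_conj_mul_sq a z
  have h2 : 0 < 1 - ‖a‖ ^ 2 := by nlinarith [norm_nonneg a]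
  have h3 : 0 < 1 - ‖z‖ ^ 2 := by nlinarith [norm_nonneg z]
  have h4 := mul_pos h2 h3
  exact lt_of_pow_lt_pow_left₀ 2 h0.le (by linarith)

/-- The Schwarz-Pick lemma. -/
theorem schwarz_pick {φ : 𝔻 → 𝔻} (hφ : IsHolomorphicOnDisc fun z => (φ z : ℂ)) (a z : 𝔻) :
    ‖1 - conj (φ a : ℂ) * φ z‖ ^ 2 * ((1 - ‖(a : ℂ)‖ ^ 2) * (1 - ‖(z : ℂ)‖ ^ 2))
      ≤ ‖1 - conj (a : ℂ) * z‖ ^ 2 * ((1 - ‖(φ a : ℂ)‖ ^ 2) * (1 - ‖(φ z : ℂ)‖ ^ 2)) := by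
  obtain ⟨g, hg, hgφ⟩ := hφ
  set b : ℂ := (φ a : ℂ) with hb
  have hgm : ∀ w : ℂ, ‖w‖ < 1 → ‖g w‖ < 1 := by
    intro w hw
    have := hgφ (.mk w hw)
    rw [Complex.UnitDisc.coe_mk] at this
    rw [← this]
    exact (φ _).norm_lt_one
  have hga : g a = b := (hgφ a).symm
  have hna : ‖-(a : ℂ)‖ < 1 := by rw [norm_neg]; exact a.norm_lt_one
  -- S is the disc automorphism taking 0 to a, and F below is φ conjugated so as to fix 0; Schwarz's
  -- lemma for F is evaluated at the preimage of z under S.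
  set S : ℂ → ℂ := fun w => (w - -(a : ℂ)) / (1 - conj (-(a : ℂ)) * w) with hS
  have hSm : ∀ w : ℂ, ‖w‖ < 1 → ‖S w‖ < 1 := fun w hw => norm_mobius_lt_one hna hw
  set F : ℂ → ℂ := fun w => (g (S w) - b) / (1 - conj b * g (S w)) with hF
  have hFm : ∀ w : ℂ, ‖w‖ < 1 → ‖F w‖ < 1 := fun w hw =>
    norm_mobius_lt_one (φ a).norm_lt_one (hgm _ (hSm w hw))
  have hSd : DifferentiableOn ℂ S (Metric.ball 0 1) := fun w hw =>
    DifferentiableWithinAt.div (by fun_prop) (by fun_prop)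
      (one_sub_conj_mul_ne_zero hna.le (by simpa using hw))
  have hgS : DifferentiableOn ℂ (fun w => g (S w)) (Metric.ball 0 1) :=
    hg.comp hSd fun w hw => by simpa using hSm w (by simpa using hw)
  have hFd : DifferentiableOn ℂ F (Metric.ball 0 1) := fun w hw =>
    DifferentiableWithinAt.div ((hgS w hw).sub_const _) (((hgS w hw).const_mul _).const_sub _)
      (one_sub_conj_mul_ne_zero (φ a).norm_lt_one.le (hgm _ (hSm w (by simpa using hw))))
  have hF0 : F 0 = 0 := by simp [hF, hS, hga]
  set w : ℂ := ((z : ℂ) - a) / (1 - conj (a : ℂ) * z) with hw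
  have hw1 : ‖w‖ < 1 := norm_mobius_lt_one a.norm_lt_one z.norm_lt_one
  have hd0 : 1 - conj (a : ℂ) * z ≠ 0 := one_sub_conj_mul_ne_zero a.norm_lt_one.le z.norm_lt_one
  have hda : 1 - conj (a : ℂ) * a ≠ 0 := one_sub_conj_mul_ne_zero a.norm_lt_one.le a.norm_lt_one
  have hd0' : 1 - (z : ℂ) * conj (a : ℂ) ≠ 0 := by rwa [mul_comm]
  have hda' : 1 - (a : ℂ) * conj (a : ℂ) ≠ 0 := by rwa [mul_comm]
  have hSw : S w = z := by
    have h1 : 1 - conj (-(a : ℂ)) * w = (1 - conj (a : ℂ) * a) / (1 - conj (a : ℂ) * z) := by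
      rw [hw, map_neg]; field_simp; ring
    have h2 : w - -(a : ℂ) = z * (1 - conj (a : ℂ) * a) / (1 - conj (a : ℂ) * z) := by
      rw [hw]; field_simp; ring
    simp only [hS]
    rw [h1, h2]
    field_simp
  have key := Complex.norm_le_norm_of_mapsTo_ball hFd
    (fun w hw => by simpa using (hFm w (by simpa using hw)).le) hF0 hw1
  have hFw : F w = ((φ z : ℂ) - b) / (1 - conj b * φ z) := by
    simp only [hF, hSw]
    rw [← hgφ z]
  rw [hFw, hw, norm_div, norm_div] at key
  have h1 : 0 < ‖1 - conj b * φ z‖ :=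
    norm_pos_iff.2 (one_sub_conj_mul_ne_zero (φ a).norm_lt_one.le (φ z).norm_lt_one)
  have h2 : 0 < ‖1 - conj (a : ℂ) * z‖ := norm_pos_iff.2 hd0
  rw [div_le_div_iff₀ h1 h2] at key
  have h3 := pow_le_pow_left₀ (by positivity) key 2
  rw [← norm_one_sub_conj_mul_sq, ← norm_one_sub_conj_mul_sq]
  rw [mul_pow, mul_pow] at h3
  linarith

/-- Julia's lemma. -/
theorem julia_of_boundaryFixedPoint {φ : 𝔻 → 𝔻} (hφ : IsHolomorphicOnDisc fun z => (φ z : ℂ))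
    {τ : ℂ} {d : ℝ} (hd : d ≤ 1) (h : HasBoundaryFixedPointDeriv φ τ d) (z : 𝔻) :
    ‖1 - conj τ * φ z‖ ^ 2 * (1 - ‖(z : ℂ)‖ ^ 2)
      ≤ ‖1 - conj τ * z‖ ^ 2 * (1 - ‖(φ z : ℂ)‖ ^ 2) := by
  obtain ⟨hτ, hfix, hder⟩ := h
  obtain ⟨τ, rfl⟩ : ∃ s : UnitCircle, (s : ℂ) = τ := ⟨⟨τ, by simpa using hτ⟩, rfl⟩
  have hev : ∀ᶠ r in 𝓝[<] (1 : ℝ), r ∈ Set.Ioo (0 : ℝ) 1 := Ioo_mem_nhdsLT one_pos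
  obtain ⟨e, he, ht⟩ := exists_tendsto_stolzFilter τ
  have l1 : Tendsto (fun r => (φ (e r) : ℂ)) (𝓝[<] 1) (𝓝 τ) := (hfix 2).comp ht
  have l2 : Tendsto (fun r => ((φ (e r) : ℂ) - τ) / ((e r : ℂ) - τ)) (𝓝[<] 1) (𝓝 d) :=
    (hder 2).comp ht
  have l3 : Tendsto (fun r => (e r : ℂ)) (𝓝[<] 1) (𝓝 τ) := (tendsto_coe_stolzFilter τ 2).comp ht
  have l4 : Tendsto (fun r : ℝ => 1 + r) (𝓝[<] 1) (𝓝 2) := by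
    have : ContinuousAt (fun r : ℝ => 1 + r) 1 := by fun_prop
    have := this.tendsto
    norm_num at this
    exact this.mono_left nhdsWithin_le_nhds
  have hsub : ∀ r ∈ Set.Ioo (0 : ℝ) 1, (e r : ℂ) - τ = -((1 - r : ℝ) : ℂ) * τ := by
    intro r hr
    rw [he r hr]; push_cast; ring
  -- The limit below yields |d| rather than d. The radial quotient equals (1 - τ̄φ(rτ))/(1 - r),
  -- whose real part is nonnegative.
  have hd0 : 0 ≤ d := by
    have := (Complex.continuous_re.tendsto _).comp l2
    rw [Complex.ofReal_re] at this
    refine ge_of_tendsto this ?_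
    filter_upwards [hev] with r hr
    have h1 : ((φ (e r) : ℂ) - τ) / ((e r : ℂ) - τ)
        = (1 - conj (τ : ℂ) * φ (e r)) / ((1 - r : ℝ) : ℂ) := by
      have h2 : ((1 - r : ℝ) : ℂ) ≠ 0 := by
        rw [Ne, Complex.ofReal_eq_zero]; linarith [hr.2]
      have h3 := τ.coe_ne_zero
      rw [hsub r hr, τ.conj_coe]
      field_simp
      ring
    show 0 ≤ (((φ (e r) : ℂ) - τ) / ((e r : ℂ) - τ)).re
    rw [h1, Complex.div_ofReal_re]
    refine div_nonneg ?_ (by linarith [hr.2])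
    have h4 := Complex.re_le_norm (conj (τ : ℂ) * φ (e r))
    rw [norm_mul, RCLike.norm_conj, τ.norm_coe, one_mul] at h4
    rw [Complex.sub_re, Complex.one_re]
    linarith [(φ (e r)).norm_lt_one]
  have lconj : ∀ {u : ℝ → ℂ} (v : ℂ), Tendsto u (𝓝[<] 1) (𝓝 (τ : ℂ)) →
      Tendsto (fun r => ‖1 - conj (u r) * v‖ ^ 2) (𝓝[<] 1) (𝓝 (‖1 - conj (τ : ℂ) * v‖ ^ 2)) :=
    fun v hu => ((((Complex.continuous_conj.tendsto _).comp hu).mul_const v).const_sub 1).norm.pow 2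
  have L := (lconj (φ z : ℂ) l1).mul (l4.mul_const (1 - ‖(z : ℂ)‖ ^ 2))
  have R := (lconj (z : ℂ) l3).mul ((l2.norm.const_mul 2).mul_const (1 - ‖(φ z : ℂ)‖ ^ 2))
  -- Schwarz–Pick with a = rτ, divided by 1 - r: on the right 1 - |φ(rτ)|² is at most 2|τ - φ(rτ)|,
  -- and |τ - φ(rτ)|/(1 - r) tends to d.
  have key := le_of_tendsto_of_tendsto L R (by
    filter_upwards [hev] with r hr
    have hr1 : 0 < 1 - r := by linarith [hr.2]
    have hne : ‖(e r : ℂ)‖ = r := by rw [he r hr, τ.norm_real_mul hr.1.le]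
    have h1 := schwarz_pick hφ (e r) z
    rw [hne] at h1
    have h2 : ‖((φ (e r) : ℂ) - τ) / ((e r : ℂ) - τ)‖ = ‖(τ : ℂ) - φ (e r)‖ / (1 - r) := by
      rw [norm_div, hsub r hr, norm_mul, norm_neg, τ.norm_coe, mul_one, Complex.norm_real,
        Real.norm_of_nonneg hr1.le, norm_sub_rev]
    have h3 : 1 - ‖(φ (e r) : ℂ)‖ ^ 2 ≤ 2 * ‖(τ : ℂ) - φ (e r)‖ := by
      have h4 := one_sub_norm_le_norm_coe_sub τ (φ (e r) : ℂ)
      nlinarith [(φ (e r)).norm_lt_one, norm_nonneg (φ (e r) : ℂ)]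
    have h5 : 0 ≤ 1 - ‖(φ z : ℂ)‖ ^ 2 := by nlinarith [(φ z).norm_lt_one, norm_nonneg (φ z : ℂ)]
    rw [h2]
    have h6 : ‖1 - conj (φ (e r) : ℂ) * φ z‖ ^ 2 * ((1 + r) * (1 - ‖(z : ℂ)‖ ^ 2)) * (1 - r)
        ≤ ‖1 - conj (e r : ℂ) * z‖ ^ 2 * (2 * ‖(τ : ℂ) - φ (e r)‖ * (1 - ‖(φ z : ℂ)‖ ^ 2)) := by
      calc _ = ‖1 - conj (φ (e r) : ℂ) * φ z‖ ^ 2 * ((1 - r ^ 2) * (1 - ‖(z : ℂ)‖ ^ 2)) := by ring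
        _ ≤ _ := h1
        _ ≤ _ := by gcongr
    rw [← mul_le_mul_iff_of_pos_right hr1]
    refine h6.trans (le_of_eq ?_)
    field_simp)
  rw [Complex.norm_real, Real.norm_of_nonneg hd0] at key
  have h5 : 0 ≤ 1 - ‖(φ z : ℂ)‖ ^ 2 := by nlinarith [(φ z).norm_lt_one, norm_nonneg (φ z : ℂ)]
  have h6 : ‖1 - conj (τ : ℂ) * z‖ ^ 2 * (2 * d * (1 - ‖(φ z : ℂ)‖ ^ 2))
      ≤ ‖1 - conj (τ : ℂ) * z‖ ^ 2 * (2 * 1 * (1 - ‖(φ z : ℂ)‖ ^ 2)) := by gcongr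
  linarith

/-- For an interior fixed point a, Schwarz–Pick divided by 1 - |a|² is the same inequality as
Julia's at a boundary point, so both kinds of τ can be treated together. -/
theorem julia_of_isDWPoint {φ : 𝔻 → 𝔻} (hφ : IsHolomorphicOnDisc fun z => (φ z : ℂ))
    {τ : ℂ} (h : IsDWPoint φ τ) (z : 𝔻) :
    ‖1 - conj τ * φ z‖ ^ 2 * (1 - ‖(z : ℂ)‖ ^ 2)
      ≤ ‖1 - conj τ * z‖ ^ 2 * (1 - ‖(φ z : ℂ)‖ ^ 2) := by
  rcases h with ⟨a, rfl, ha⟩ | ⟨-, d, hd, h⟩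
  · have h1 := schwarz_pick hφ a z
    rw [ha] at h1
    have h2 : 0 < 1 - ‖(a : ℂ)‖ ^ 2 := by nlinarith [a.norm_lt_one, norm_nonneg (a : ℂ)]
    rw [← mul_le_mul_iff_of_pos_right h2]
    linarith
  · exact julia_of_boundaryFixedPoint hφ hd h z

/-! ### Infinitesimal form of Julia's inequality -/

theorem HasDerivWithinAt.nonneg_of_nonneg {u : ℝ → ℝ} {u' t : ℝ}
    (h : HasDerivWithinAt u u' (Set.Ici t) t) (h0 : u t = 0) (hu : ∀ s, t ≤ s → 0 ≤ u s) :
    0 ≤ u' := by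
  have h1 := (hasDerivWithinAt_iff_tendsto_slope' (Set.self_notMem_Ioi)).1
    (hasDerivWithinAt_Ioi_iff_Ici.2 h)
  refine ge_of_tendsto h1 ?_
  filter_upwards [self_mem_nhdsWithin] with s hs
  have hs' : t < s := hs
  rw [slope_def_field, h0, sub_zero]
  exact div_nonneg (hu s hs'.le) (by linarith)

theorem re_div_nonneg_of_re_mul_conj {G A : ℂ} (h : 0 ≤ (G * conj A).re) : 0 ≤ (G / A).re := by
  rw [div_eq_mul_inv, Complex.inv_def, ← mul_assoc, Complex.re_mul_ofReal]
  exact mul_nonneg h (inv_nonneg.2 (Complex.normSq_nonneg _))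

/-- Julia's inequality for φ_t is an equality at t = 0, so the right derivative of the difference of
its sides is nonnegative there; it equals 2 Re(G(z) · conj((τ - z)(1 - τ̄z))). At z = τ the quotient
is 0 by convention. -/
theorem generator_re_nonneg {φ : ℝ → 𝔻 → 𝔻} {G : 𝔻 → ℂ} {τ : ℂ} (hφ : IsOneParameterSemigroup φ)
    (hG : IsInfinitesimalGenerator φ G) (hτ : IsSemigroupDWPoint φ τ) (z : 𝔻) :
    0 ≤ (G z / ((τ - z) * (1 - conj τ * z))).re := by
  have hjulia : ∀ t, 0 ≤ t → ‖1 - conj τ * φ t z‖ ^ 2 * (1 - ‖(z : ℂ)‖ ^ 2)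
      ≤ ‖1 - conj τ * z‖ ^ 2 * (1 - ‖(φ t z : ℂ)‖ ^ 2) := by
    intro t ht
    by_cases hid : φ t = id
    · rw [hid]; simp
    · exact julia_of_isDWPoint (hφ.holomorphic t ht) (hτ t ht hid) z
  have hd := hG.2 z 0 le_rfl
  rw [hφ.map_zero] at hd
  have h1 := ((((hd.const_mul (conj τ)).const_sub 1).norm_sq).mul_const
    (1 - ‖(z : ℂ)‖ ^ 2)).const_sub 0
  have h2 := ((hd.norm_sq).const_sub 1).const_mul (‖1 - conj τ * z‖ ^ 2)
  have h3 := (h1.add h2).nonneg_of_nonneg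
    (by simp [hφ.map_zero]) (fun s hs => by have := hjulia s hs; simp; linarith)
  rw [hφ.map_zero, Complex.inner, Complex.inner] at h3
  refine re_div_nonneg_of_re_mul_conj ?_
  refine le_of_mul_le_mul_left ?_ (two_pos : (0 : ℝ) < 2)
  rw [mul_zero]
  refine h3.trans (le_of_eq ?_)
  simp only [← Complex.normSq_eq_norm_sq, Complex.normSq_apply, Complex.sub_re, Complex.sub_im,
    Complex.mul_re, Complex.mul_im, Complex.conj_re, Complex.conj_im, Complex.one_re,
    Complex.one_im, Complex.neg_re, Complex.neg_im, map_sub, map_mul, map_one, Complex.conj_conj]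
  ring

/-- The Berkson-Porta formula for the generator of a semigroup. -/
theorem exists_berkson_porta {φ : ℝ → 𝔻 → 𝔻} {G : 𝔻 → ℂ} {τ : ℂ} (hτ1 : ‖τ‖ ≤ 1)
    (hφ : IsOneParameterSemigroup φ) (hG : IsInfinitesimalGenerator φ G)
    (hτ : IsSemigroupDWPoint φ τ) :
    ∃ p : ℂ → ℂ, DifferentiableOn ℂ p (Metric.ball 0 1) ∧ (∀ z : ℂ, ‖z‖ < 1 → 0 ≤ (p z).re) ∧
      ∀ z : 𝔻, G z = (τ - z) * (1 - conj τ * z) * p z := by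
  obtain ⟨g, hg, hgG⟩ := hG.1
  have hne : ∀ z ∈ Metric.ball (0 : ℂ) 1, 1 - conj τ * z ≠ 0 := fun z hz =>
    one_sub_conj_mul_ne_zero hτ1 (by simpa using hz)
  have hre : ∀ z : ℂ, ‖z‖ < 1 → 0 ≤ (g z / ((τ - z) * (1 - conj τ * z))).re := by
    intro z hz
    have := generator_re_nonneg hφ hG hτ (.mk z hz)
    rwa [hgG] at this
  rcases hτ1.lt_or_eq with hlt | heq
  · have hg0 : g τ = 0 := by
      have hfix : ∀ t ∈ Set.Ici (0 : ℝ), (φ t (.mk τ hlt) : ℂ) = τ := by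
        intro t ht
        by_cases hid : φ t = id
        · rw [hid]; rfl
        · rcases hτ t ht hid with ⟨a, ha, hfa⟩ | ⟨-, d, -, hd⟩
          · have : a = .mk τ hlt := Complex.UnitDisc.coe_injective ha
            rw [← this, hfa, ha]
          · exact absurd hd.1 hlt.ne
      have h1 := hG.2 (.mk τ hlt) 0 le_rfl
      rw [hφ.map_zero, hgG] at h1
      have h2 : HasDerivWithinAt (fun s : ℝ => (φ s (.mk τ hlt) : ℂ)) 0 (Set.Ici 0) 0 :=
        (hasDerivWithinAt_const 0 (Set.Ici 0) τ).congr hfix (hfix 0 Set.self_mem_Ici)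
      exact (uniqueDiffWithinAt_Ici 0).eq_deriv _ h1 h2
    -- For interior τ the quotient has a removable singularity at τ because G(τ) = 0: `dslope` fills
    -- it in, and the sign of the real part passes to τ by continuity.
    have hτb : Metric.ball (0 : ℂ) 1 ∈ 𝓝 τ := Metric.isOpen_ball.mem_nhds (by simpa using hlt)
    have hpd : DifferentiableOn ℂ (fun z => -dslope g τ z / (1 - conj τ * z)) (Metric.ball 0 1) :=
      (((Complex.differentiableOn_dslope hτb).2 hg).neg).div (by fun_prop) hne
    have hds : ∀ z, z ≠ τ → dslope g τ z = g z / (z - τ) := by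
      intro z hz
      rw [dslope_of_ne _ hz, slope_def_field, hg0, sub_zero]
    have hpe : ∀ z, z ≠ τ →
        -dslope g τ z / (1 - conj τ * z) = g z / ((τ - z) * (1 - conj τ * z)) := by
      intro z hz
      rw [hds z hz, ← div_div, ← div_neg, neg_sub]
    refine ⟨_, hpd, fun z hz => ?_, fun z => ?_⟩
    · by_cases hzτ : z = τ
      · subst hzτ
        have hc : Tendsto (fun w => (-dslope g z w / (1 - conj z * w)).re) (𝓝[≠] z)
            (𝓝 (-dslope g z z / (1 - conj z * z)).re) :=
          ((Complex.continuous_re.continuousAt.comp (f := fun w => -dslope g z w / (1 - conj z * w))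
            (hpd.differentiableAt hτb).continuousAt).tendsto).mono_left nhdsWithin_le_nhds
        refine ge_of_tendsto hc ?_
        filter_upwards [self_mem_nhdsWithin, nhdsWithin_le_nhds hτb] with w hw hwb
        rw [hpe w hw]
        exact hre w (by simpa using hwb)
      · rw [hpe z hzτ]
        exact hre z hz
    · rw [hgG]
      by_cases hzτ : (z : ℂ) = τ
      · rw [hzτ, hg0]; simp
      · rw [hpe _ hzτ, mul_div_cancel₀]
        exact mul_ne_zero (sub_ne_zero.2 (Ne.symm hzτ)) (hne _ (by simpa using z.norm_lt_one))
  · have hne2 : ∀ z ∈ Metric.ball (0 : ℂ) 1, (τ - z) * (1 - conj τ * z) ≠ 0 := by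
      intro z hz
      refine mul_ne_zero (sub_ne_zero.2 ?_) (hne z hz)
      rintro rfl
      rw [mem_ball_zero_iff] at hz
      linarith
    refine ⟨fun z => g z / ((τ - z) * (1 - conj τ * z)), hg.div (by fun_prop) hne2, hre,
      fun z => ?_⟩
    rw [hgG, mul_div_cancel₀]
    exact hne2 z (by simpa using z.norm_lt_one)

/-- This real factor -|τ - σ|² converts the angular derivative of p at σ into the spectral value of
the generator. -/
theorem berkson_porta_factor_boundary (τ : ℂ) (σ : UnitCircle) :
    (τ - σ) * (1 - conj τ * σ) = -((‖τ - σ‖ ^ 2 : ℝ) : ℂ) * σ := by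
  push_cast
  rw [← Complex.conj_mul', map_sub, σ.conj_coe]
  have := σ.coe_ne_zero
  field_simp
  ring

/-- Dividing G(z)/(σ - z) by the Berkson–Porta factor turns a spectral value l into the angular
limit -l/|τ - σ|² of p/(1 - σ̄z). That limit equals 2∫|κ - σ|⁻² dν, so l ≥ λ is the stated bound. -/
theorem exists_herglotz_of_mem_genClass {τ : ℂ} (hτ1 : ‖τ‖ ≤ 1) {n : ℕ} {σ : Fin n → UnitCircle}
    (hσ : ∀ k, τ ≠ (σ k : ℂ)) {Λ : Fin n → ℝ} (hΛ : ∀ k, Λ k < 0) {G : 𝔻 → ℂ}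
    (hG : G ∈ GenClass τ σ Λ) :
    ∃ (β : ℝ) (ν : Measure UnitCircle), IsFiniteMeasure ν ∧
      (∀ z : 𝔻, G z = (τ - z) * (1 - conj τ * z) * herglotz β ν z) ∧
      ∀ k, NullAt β ν (σ k) ∧
        2 * ∫ κ : UnitCircle, (‖(κ : ℂ) - σ k‖ ^ 2)⁻¹ ∂ν ≤ |Λ k| / ‖τ - σ k‖ ^ 2 := by
  obtain ⟨φ, hφ, hgen, hdw, hbr⟩ := hG
  obtain ⟨p, hp, hpre, hpG⟩ := exists_berkson_porta hτ1 hφ hgen hdw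
  obtain ⟨β, ν, hν, hpν⟩ := exists_herglotz hp hpre
  refine ⟨β, ν, hν, fun z => by rw [hpG, hpν z z.norm_lt_one], fun k => ?_⟩
  obtain ⟨l, hl1, hl2, -, hlim⟩ := hbr k
  have hpos : 0 < ‖τ - σ k‖ ^ 2 := by
    have := norm_pos_iff.2 (sub_ne_zero.2 (hσ k)); positivity
  have hA0 : (τ - σ k) * (1 - conj τ * σ k) ≠ 0 := by
    rw [berkson_porta_factor_boundary]
    exact mul_ne_zero (neg_ne_zero.2 (Complex.ofReal_ne_zero.2 hpos.ne')) (σ k).coe_ne_zero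
  have hA : ∀ M, Tendsto (fun z : 𝔻 => (τ - z) * (1 - conj τ * z)) (stolzFilter (σ k) M)
      (𝓝 ((τ - σ k) * (1 - conj τ * σ k))) := fun M =>
    have hz := tendsto_coe_stolzFilter (σ k) M
    (hz.const_sub τ).mul ((hz.const_mul (conj τ)).const_sub 1)
  have hlim2 : HasAngularLimit (fun z => herglotz β ν z / (1 - conj (σ k : ℂ) * z)) (σ k)
      ((-l / ‖τ - σ k‖ ^ 2 : ℝ) : ℂ) := by
    intro M
    have h1 := ((hlim M).mul ((hA M).inv₀ hA0)).mul_const (σ k : ℂ)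
    have h2 : (l : ℂ) * ((τ - σ k) * (1 - conj τ * σ k))⁻¹ * σ k
        = ((-l / ‖τ - σ k‖ ^ 2 : ℝ) : ℂ) := by
      have := (σ k).coe_ne_zero
      have h3 : ((‖τ - σ k‖ ^ 2 : ℝ) : ℂ) ≠ 0 := Complex.ofReal_ne_zero.2 hpos.ne'
      rw [berkson_porta_factor_boundary, Complex.ofReal_div]
      field_simp
      push_cast
      ring
    rw [h2] at h1
    refine h1.congr' ?_
    filter_upwards [(hA M).eventually_ne hA0] with z hz
    have h4 := (σ k).coe_ne_coe_disc z
    have h5 := (σ k).coe_ne_zero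
    rw [hpG, hpν z z.norm_lt_one, (σ k).one_sub_conj_mul, (σ k).conj_coe]
    generalize (τ - z) * (1 - conj τ * z) = A at hz
    field_simp
  obtain ⟨hN, hc⟩ := nullAt_of_hasAngularLimit hlim2
  refine ⟨hN, ?_⟩
  rw [hc, abs_of_neg (hΛ k)]
  gcongr

/-! ### The flow of a semicomplete vector field in the disc -/

/-- `α` is a trajectory in the unit disc of the vector field `G` on the time interval `[0, b]`. -/
def IsTrajectory (G : ℂ → ℂ) (b : ℝ) (α : ℝ → ℂ) : Prop :=
  ∀ t ∈ Set.Icc 0 b, ‖α t‖ < 1 ∧ HasDerivWithinAt α (G (α t)) (Set.Icc 0 b) t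

/-- The infinitesimal form of the non-expansion of the hyperbolic metric by the flow of `G`. -/
def IsDissipative (G : ℂ → ℂ) : Prop :=
  ∀ z : ℂ, ‖z‖ < 1 → (deriv G z).re * (1 - ‖z‖ ^ 2) + 2 * (conj z * G z).re ≤ 0

theorem Complex.inner_eq_re_conj_mul (w z : ℂ) : inner ℝ w z = (conj w * z).re := by
  rw [Complex.inner, mul_comm]

theorem one_sub_norm_sq_pos {z : ℂ} (hz : ‖z‖ < 1) : 0 < 1 - ‖z‖ ^ 2 := by
  nlinarith [norm_nonneg z]

theorem IsTrajectory.continuousOn {G : ℂ → ℂ} {b : ℝ} {α : ℝ → ℂ} (hα : IsTrajectory G b α) :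
    ContinuousOn α (Set.Icc 0 b) := fun t ht => (hα t ht).2.continuousWithinAt

theorem IsTrajectory.hasDerivAt {G : ℂ → ℂ} {b : ℝ} {α : ℝ → ℂ} (hα : IsTrajectory G b α)
    {t : ℝ} (ht : t ∈ Set.Ioo 0 b) : HasDerivAt α (G (α t)) t :=
  (hα t (Set.Ioo_subset_Icc_self ht)).2.hasDerivAt (Icc_mem_nhds ht.1 ht.2)

theorem IsTrajectory.hasDerivWithinAt_Ici {G : ℂ → ℂ} {b : ℝ} {α : ℝ → ℂ}
    (hα : IsTrajectory G b α) {t : ℝ} (ht : t ∈ Set.Ico 0 b) :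
    HasDerivWithinAt α (G (α t)) (Set.Ici t) t :=
  (hα t (Set.Ico_subset_Icc_self ht)).2.mono_of_mem_nhdsWithin (by
    filter_upwards [Ico_mem_nhdsGE ht.2] with s hs
    exact ⟨ht.1.trans hs.1, hs.2.le⟩)

theorem IsTrajectory.mono {G : ℂ → ℂ} {b c : ℝ} {α : ℝ → ℂ} (hα : IsTrajectory G b α)
    (hc : c ≤ b) : IsTrajectory G c α := fun t ht =>
  ⟨(hα t ⟨ht.1, ht.2.trans hc⟩).1,
    (hα t ⟨ht.1, ht.2.trans hc⟩).2.mono (Set.Icc_subset_Icc_right hc)⟩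

/-- Dissipativity says precisely that the squared hyperbolic speed |G(α)|²/(1 - |α|²)² has
nonpositive derivative along the trajectory. -/
theorem IsTrajectory.speed_le {G : ℂ → ℂ} (hG : DifferentiableOn ℂ G (Metric.ball 0 1))
    (hD : IsDissipative G) {b : ℝ} {α : ℝ → ℂ} (hα : IsTrajectory G b α) {t : ℝ}
    (ht : t ∈ Set.Icc 0 b) :
    ‖G (α t)‖ ≤ ‖G (α 0)‖ / (1 - ‖α 0‖ ^ 2) * (1 - ‖α t‖ ^ 2) := by
  have hpos : ∀ s ∈ Set.Icc 0 b, 0 < 1 - ‖α s‖ ^ 2 := fun s hs => one_sub_norm_sq_pos (hα s hs).1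
  have hGd : ∀ s ∈ Set.Icc 0 b, HasDerivAt G (deriv G (α s)) (α s) := fun s hs =>
    (hG.differentiableAt (Metric.isOpen_ball.mem_nhds (by simpa using (hα s hs).1))).hasDerivAt
  set N : ℝ → ℝ := fun s => ‖G (α s)‖ ^ 2 / (1 - ‖α s‖ ^ 2) ^ 2 with hN
  have hcG : ContinuousOn (fun s => G (α s)) (Set.Icc 0 b) := fun s hs =>
    (hGd s hs).continuousAt.comp_continuousWithinAt (hα.continuousOn s hs)
  have hNc : ContinuousOn N (Set.Icc 0 b) :=
    (hcG.norm.pow 2).div ((continuousOn_const.sub (hα.continuousOn.norm.pow 2)).pow 2)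
      fun s hs => pow_ne_zero 2 (hpos s hs).ne'
  have hNd : ∀ s ∈ Set.Ioo 0 b, ∃ d ≤ 0, HasDerivAt N d s := by
    intro s hs
    have hs' := Set.Ioo_subset_Icc_self hs
    have h1 := hα.hasDerivAt hs
    have h2 : HasDerivAt (fun s => G (α s)) (G (α s) • deriv G (α s)) s :=
      HasDerivAt.scomp s (hGd s hs') h1
    have h3 := h2.norm_sq.div ((h1.norm_sq.const_sub 1).pow 2) (pow_ne_zero 2 (hpos s hs').ne')
    refine ⟨_, ?_, h3⟩
    have e := hD (α s) (hα s hs').1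
    have hp := hpos s hs'
    refine div_nonpos_of_nonpos_of_nonneg ?_ (by positivity)
    rw [Complex.inner_eq_re_conj_mul, Complex.inner_eq_re_conj_mul]
    have e1 : (conj (G (α s)) * (G (α s) • deriv G (α s))).re
        = ‖G (α s)‖ ^ 2 * (deriv G (α s)).re := by
      rw [smul_eq_mul, ← mul_assoc, Complex.conj_mul', ← Complex.ofReal_pow, Complex.re_ofReal_mul]
    rw [e1]
    have e2 : 0 ≤ 2 * ‖G (α s)‖ ^ 2 * (1 - ‖α s‖ ^ 2) := by positivity
    have e3 := mul_nonpos_of_nonneg_of_nonpos e2 e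
    simp only [Pi.pow_apply, Nat.cast_ofNat, Nat.add_one_sub_one, pow_one]
    linarith
  have hanti : AntitoneOn N (Set.Icc 0 b) := by
    refine antitoneOn_of_deriv_nonpos (convex_Icc 0 b) hNc ?_ ?_
    · intro s hs
      rw [interior_Icc] at hs
      obtain ⟨d, -, hd⟩ := hNd s hs
      exact hd.differentiableAt.differentiableWithinAt
    · intro s hs
      rw [interior_Icc] at hs
      obtain ⟨d, hd0, hd⟩ := hNd s hs
      rwa [hd.deriv]
  have h0 : (0 : ℝ) ∈ Set.Icc 0 b := ⟨le_rfl, ht.1.trans ht.2⟩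
  have h1 := hanti h0 ht ht.1
  simp only [hN] at h1
  rw [← div_pow, ← div_pow] at h1
  have h2 := (pow_le_pow_iff_left₀ (div_nonneg (norm_nonneg _) (hpos t ht).le)
    (div_nonneg (norm_nonneg _) (hpos 0 h0).le) two_ne_zero).1 h1
  rwa [div_le_iff₀ (hpos t ht)] at h2

/-- Bounded hyperbolic speed K gives (1 - |α|²)' ≥ -2K(1 - |α|²), so the circle is not reached in
finite time. -/
theorem IsTrajectory.one_sub_norm_sq_ge {G : ℂ → ℂ} (hG : DifferentiableOn ℂ G (Metric.ball 0 1))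
    (hD : IsDissipative G) {b : ℝ} {α : ℝ → ℂ} (hα : IsTrajectory G b α) {t : ℝ}
    (ht : t ∈ Set.Icc 0 b) :
    (1 - ‖α 0‖ ^ 2) * Real.exp (-(2 * (‖G (α 0)‖ / (1 - ‖α 0‖ ^ 2)) * t)) ≤ 1 - ‖α t‖ ^ 2 := by
  set K := ‖G (α 0)‖ / (1 - ‖α 0‖ ^ 2) with hK
  have h0 : (0 : ℝ) ∈ Set.Icc 0 b := ⟨le_rfl, ht.1.trans ht.2⟩
  have hmono : MonotoneOn (fun s => (1 - ‖α s‖ ^ 2) * Real.exp (2 * K * s)) (Set.Icc 0 b) := by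
    have hder : ∀ s ∈ Set.Ioo 0 b, ∃ d ≥ 0,
        HasDerivAt (fun s => (1 - ‖α s‖ ^ 2) * Real.exp (2 * K * s)) d s := by
      intro s hs
      have hs' := Set.Ioo_subset_Icc_self hs
      have h1 := hα.hasDerivAt hs
      have h2 := (h1.norm_sq.const_sub 1).mul (((hasDerivAt_id s).const_mul (2 * K)).exp)
      refine ⟨_, ?_, h2⟩
      have h3 := hα.speed_le hG hD hs'
      have h4 := Complex.re_le_norm (conj (α s) * G (α s))
      rw [norm_mul, RCLike.norm_conj] at h4
      have h5 : ‖α s‖ * ‖G (α s)‖ ≤ ‖G (α s)‖ :=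
        mul_le_of_le_one_left (norm_nonneg _) (hα s hs').1.le
      have h6 : ((starRingEnd ℂ) (α s) * G (α s)).re ≤ K * (1 - ‖α s‖ ^ 2) := by linarith
      have h7 := Real.exp_pos (2 * K * s)
      have h8 := mul_nonneg (sub_nonneg.2 h6) h7.le
      rw [Complex.inner_eq_re_conj_mul]
      simp only [id, mul_one, ge_iff_le]
      linarith
    refine monotoneOn_of_deriv_nonneg (convex_Icc 0 b) ?_ ?_ ?_
    · exact (continuousOn_const.sub (hα.continuousOn.norm.pow 2)).mul (by fun_prop)
    · intro s hs
      rw [interior_Icc] at hs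
      obtain ⟨d, -, hd⟩ := hder s hs
      exact hd.differentiableAt.differentiableWithinAt
    · intro s hs
      rw [interior_Icc] at hs
      obtain ⟨d, hd0, hd⟩ := hder s hs
      rwa [hd.deriv]
  have h1 := hmono h0 ht ht.1
  simp only [mul_zero, Real.exp_zero, mul_one] at h1
  rw [Real.exp_neg, ← div_eq_mul_inv, div_le_iff₀ (Real.exp_pos _)]
  exact h1

/-- Multiplying G by a smooth bump makes it globally Lipschitz and bounded, as the ODE existence,
uniqueness and comparison theorems require; trajectories staying in |z| ≤ r do not notice the
change. -/
theorem exists_lipschitz_cutoff {G : ℂ → ℂ} (hG : DifferentiableOn ℂ G (Metric.ball 0 1)) {r : ℝ}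
    (hr0 : 0 < r) (hr : r < 1) :
    ∃ (v : ℂ → ℂ) (K L : NNReal), LipschitzWith K v ∧ (∀ z, ‖v z‖ ≤ L) ∧
      ∀ z, ‖z‖ ≤ r → v z = G z := by
  let χ : ContDiffBump (0 : ℂ) := ⟨r, (r + 1) / 2, hr0, by linarith⟩
  have hsmooth : ContDiff ℝ 1 fun z => (χ z : ℝ) • G z := by
    rw [contDiff_iff_contDiffAt]
    intro z
    by_cases hz : ‖z‖ < 1
    · have h1 : ContDiffAt ℂ 1 G z :=
        (hG.analyticAt (Metric.isOpen_ball.mem_nhds (by simpa using hz))).contDiffAt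
      exact χ.contDiffAt.smul (h1.restrict_scalars ℝ)
    · refine (contDiffAt_const (c := (0 : ℂ))).congr_of_eventuallyEq ?_
      have : {w : ℂ | (r + 1) / 2 < ‖w‖} ∈ 𝓝 z :=
        (isOpen_lt continuous_const continuous_norm).mem_nhds
          (by show (r + 1) / 2 < ‖z‖; linarith [not_lt.1 hz])
      filter_upwards [this] with w hw
      have hw' : (r + 1) / 2 < ‖w‖ := hw
      rw [χ.zero_of_le_dist (by rw [dist_zero_right]; exact hw'.le), zero_smul]
  have hsupp : HasCompactSupport fun z => (χ z : ℝ) • G z := χ.hasCompactSupport.smul_right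
  obtain ⟨K, hK⟩ := ContDiff.lipschitzWith_of_hasCompactSupport hsupp hsmooth one_ne_zero
  obtain ⟨L, hL⟩ := hsupp.exists_bound_of_continuous hsmooth.continuous
  refine ⟨_, K, ⟨max L 0, le_max_right _ _⟩, hK, fun z => (hL z).trans (le_max_left _ _),
    fun z hz => ?_⟩
  rw [χ.one_of_mem_closedBall (by simpa using hz), one_smul]

/-- The a priori bound determines a radius r that no trajectory from z can reach up to time T. A
solution of the field cut off at r is a trajectory of G until it first meets |z| = r, so it never
does. -/
theorem exists_trajectory {G : ℂ → ℂ} (hG : DifferentiableOn ℂ G (Metric.ball 0 1))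
    (hD : IsDissipative G) {z : ℂ} (hz : ‖z‖ < 1) {T : ℝ} (hT : 0 ≤ T) :
    ∃ α : ℝ → ℂ, α 0 = z ∧ IsTrajectory G T α := by
  set K := ‖G z‖ / (1 - ‖z‖ ^ 2) with hK
  have hz2 := one_sub_norm_sq_pos hz
  have hK0 : 0 ≤ K := by positivity
  have hu : 0 < (1 - ‖z‖ ^ 2) * Real.exp (-(2 * K * T)) := by positivity
  obtain ⟨r, hr0, hr1, hzr, hru⟩ : ∃ r : ℝ, 0 < r ∧ r < 1 ∧ ‖z‖ < r ∧
      1 - r ^ 2 < (1 - ‖z‖ ^ 2) * Real.exp (-(2 * K * T)) := by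
    have hc : Tendsto (fun r : ℝ => 1 - r ^ 2) (𝓝[<] 1) (𝓝 0) := by
      have : ContinuousAt (fun r : ℝ => 1 - r ^ 2) 1 := by fun_prop
      have := this.tendsto
      norm_num at this
      exact this.mono_left nhdsWithin_le_nhds
    obtain ⟨r, h3, h1, h2⟩ := ((hc.eventually (gt_mem_nhds hu)).and (Ioo_mem_nhdsLT hz)).exists
    exact ⟨r, (norm_nonneg z).trans_lt h1, h2, h1, h3⟩
  obtain ⟨v, Kv, L, hv, hL, hvG⟩ := exists_lipschitz_cutoff hG hr0 hr1
  -- At speed at most L nothing leaves the ball of radius L·T within time T, so the solution covers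
  -- all of [0, T].
  have hPL : IsPicardLindelof (fun _ => v) (⟨0, le_rfl, hT⟩ : Set.Icc 0 T) z
      (L * ⟨T, hT⟩) 0 L Kv :=
    IsPicardLindelof.of_time_independent (fun x _ => hL x) hv.lipschitzOnWith (by simp [hT]; rfl)
  obtain ⟨α, hα0, hα⟩ := hPL.exists_eq_forall_mem_Icc_hasDerivWithinAt₀
  have hα0 : α 0 = z := hα0
  have hαc : ContinuousOn α (Set.Icc 0 T) := fun t ht => (hα t ht).continuousWithinAt
  have htraj : ∀ b ≤ T, (∀ t ∈ Set.Icc 0 b, ‖α t‖ ≤ r) → IsTrajectory G b α := by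
    intro b hb h t ht
    have h1 := (hα t ⟨ht.1, ht.2.trans hb⟩).mono (Set.Icc_subset_Icc_right hb)
    rw [hvG _ (h t ht)] at h1
    exact ⟨(h t ht).trans_lt hr1, h1⟩
  refine ⟨α, hα0, htraj T le_rfl ?_⟩
  by_contra! hex
  obtain ⟨t₁, ht₁, hlt⟩ := hex
  set S : Set ℝ := Set.Icc 0 T ∩ (fun t => ‖α t‖) ⁻¹' Set.Ici r with hS
  have hScl : IsClosed S := hαc.norm.preimage_isClosed_of_isClosed isClosed_Icc isClosed_Ici
  have hSne : S.Nonempty := ⟨t₁, ht₁, hlt.le⟩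
  have hSb : BddBelow S := ⟨0, fun t ht => ht.1.1⟩
  have hmem := hScl.csInf_mem hSne hSb
  set t₀ := sInf S with ht₀
  have hbelow : ∀ t ∈ Set.Ico 0 t₀, ‖α t‖ < r := by
    intro t ht
    by_contra hge
    have : t ∈ S := ⟨⟨ht.1, ht.2.le.trans hmem.1.2⟩, not_lt.1 hge⟩
    exact absurd (csInf_le hSb this) (not_le.2 ht.2)
  have ht0pos : 0 < t₀ := by
    rcases hmem.1.1.lt_or_eq with h | h
    · exact h
    · have h2 : r ≤ ‖α t₀‖ := hmem.2
      rw [← h, hα0] at h2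
      linarith
  have hle : ∀ t ∈ Set.Icc 0 t₀, ‖α t‖ ≤ r := by
    have hcl : closure (Set.Ico 0 t₀) = Set.Icc 0 t₀ := closure_Ico ht0pos.ne
    have hcont : ContinuousOn (fun t => ‖α t‖) (closure (Set.Ico 0 t₀)) := by
      rw [hcl]; exact hαc.norm.mono (Set.Icc_subset_Icc_right hmem.1.2)
    intro t ht
    exact le_on_closure (fun s hs => (hbelow s hs).le) hcont continuousOn_const (hcl ▸ ht)
  have hge := (htraj t₀ hmem.1.2 hle).one_sub_norm_sq_ge hG hD ⟨ht0pos.le, le_rfl⟩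
  rw [hα0] at hge
  have h2 : r ≤ ‖α t₀‖ := hmem.2
  have h3 : Real.exp (-(2 * K * T)) ≤ Real.exp (-(2 * K * t₀)) := by
    apply Real.exp_le_exp.2
    have := mul_le_mul_of_nonneg_left hmem.1.2 (by positivity : 0 ≤ 2 * K)
    linarith
  have h4 := mul_le_mul_of_nonneg_left h3 hz2.le
  nlinarith

theorem IsTrajectory.exists_radius {G : ℂ → ℂ} {b : ℝ} {α : ℝ → ℂ} (hα : IsTrajectory G b α) :
    ∃ r : ℝ, 0 < r ∧ r < 1 ∧ ∀ t ∈ Set.Icc 0 b, ‖α t‖ ≤ r := by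
  obtain h | h := (Set.Icc (0 : ℝ) b).eq_empty_or_nonempty
  · exact ⟨1 / 2, by norm_num, by norm_num, by simp [h]⟩
  · obtain ⟨t, ht, hmax⟩ := isCompact_Icc.exists_isMaxOn h hα.continuousOn.norm
    have h1 := (hα t ht).1
    refine ⟨(1 + ‖α t‖) / 2, by positivity, by linarith, fun s hs => ?_⟩
    have : ‖α s‖ ≤ ‖α t‖ := hmax hs
    linarith

theorem IsTrajectory.unique {G : ℂ → ℂ} (hG : DifferentiableOn ℂ G (Metric.ball 0 1)) {b : ℝ}
    {α γ : ℝ → ℂ} (hα : IsTrajectory G b α) (hγ : IsTrajectory G b γ) (h0 : α 0 = γ 0) :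
    Set.EqOn α γ (Set.Icc 0 b) := by
  obtain ⟨r, hr0, hr1, hr⟩ := hα.exists_radius
  obtain ⟨s, hs0, hs1, hs⟩ := hγ.exists_radius
  obtain ⟨v, K, L, hv, -, hvG⟩ := exists_lipschitz_cutoff hG (lt_max_of_lt_left hr0)
    (max_lt hr1 hs1)
  refine ODE_solution_unique_of_mem_Icc_right (v := fun _ => v) (s := fun _ => Set.univ) (K := K)
    (fun t _ => hv.lipschitzOnWith) hα.continuousOn ?_ (fun _ _ => trivial) hγ.continuousOn ?_
    (fun _ _ => trivial) h0
  · intro t ht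
    rw [hvG _ ((hr t (Set.Ico_subset_Icc_self ht)).trans (le_max_left _ _))]
    exact hα.hasDerivWithinAt_Ici ht
  · intro t ht
    rw [hvG _ ((hs t (Set.Ico_subset_Icc_self ht)).trans (le_max_right _ _))]
    exact hγ.hasDerivWithinAt_Ici ht

theorem exists_global_trajectory {G : ℂ → ℂ} (hG : DifferentiableOn ℂ G (Metric.ball 0 1))
    (hD : IsDissipative G) (z : 𝔻) :
    ∃ α : ℝ → 𝔻, α 0 = z ∧ ∀ t, 0 ≤ t →
      HasDerivWithinAt (fun s => (α s : ℂ)) (G (α t)) (Set.Ici 0) t := by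
  choose α h0 hα using fun n : ℕ => exists_trajectory hG hD z.norm_lt_one (T := n) n.cast_nonneg
  have hcons : ∀ (n m : ℕ) (t : ℝ), n ≤ m → 0 ≤ t → t ≤ n → α m t = α n t := fun n m t hnm ht htn =>
    IsTrajectory.unique hG ((hα m).mono (Nat.cast_le.2 hnm)) (hα n) ((h0 m).trans (h0 n).symm)
      ⟨ht, htn⟩
  -- The solutions on [0, n] are glued by uniqueness; `max t 0` freezes negative times at the
  -- initial point, so that values stay in the disc.
  have hnorm : ∀ t : ℝ, ‖α ⌈t⌉₊ (max t 0)‖ < 1 := fun t =>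
    (hα _ _ ⟨le_max_right _ _, max_le (Nat.le_ceil t) (Nat.cast_nonneg _)⟩).1
  have heq : ∀ (m : ℕ) (t : ℝ), 0 ≤ t → t ≤ m → α ⌈t⌉₊ (max t 0) = α m t := by
    intro m t ht htm
    rw [max_eq_left ht]
    exact (hcons _ m t (Nat.ceil_le.2 htm) ht (Nat.le_ceil t)).symm
  refine ⟨fun t => .mk _ (hnorm t), ?_, fun t ht => ?_⟩
  · apply Complex.UnitDisc.coe_injective
    simp [h0]
  · simp only [Complex.UnitDisc.coe_mk]
    obtain ⟨m, hm⟩ := exists_nat_gt t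
    have h1 := (hα m t ⟨ht, hm.le⟩).2
    rw [← heq m t ht hm.le] at h1
    have h2 : HasDerivWithinAt (fun s => α ⌈s⌉₊ (max s 0)) (G (α ⌈t⌉₊ (max t 0)))
        (Set.Icc 0 (m : ℝ)) t :=
      h1.congr_of_mem (fun s hs => heq m s hs.1 hs.2) ⟨ht, hm.le⟩
    refine h2.mono_of_mem_nhdsWithin ?_
    filter_upwards [self_mem_nhdsWithin, nhdsWithin_le_nhds (Iio_mem_nhds hm)] with s hs hs2
    exact ⟨hs, le_of_lt hs2⟩

theorem isTrajectory_of_forall {G : ℂ → ℂ} {α : ℝ → 𝔻}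
    (h : ∀ t, 0 ≤ t → HasDerivWithinAt (fun s => (α s : ℂ)) (G (α t)) (Set.Ici 0) t) (b : ℝ) :
    IsTrajectory G b fun s => (α s : ℂ) := fun t ht =>
  ⟨(α t).norm_lt_one, (h t ht.1).mono Set.Icc_subset_Ici_self⟩

/-! ### Holomorphic dependence on the initial point -/

/-- The a priori lower bound m for 1 - |Φ|² is continuous in the initial point, so half its value at
z works for all nearby points at once. -/
theorem exists_uniform_radius {G : ℂ → ℂ} (hG : DifferentiableOn ℂ G (Metric.ball 0 1))
    (hD : IsDissipative G) {T : ℝ} (hT : 0 ≤ T) {Φ : ℂ → ℝ → ℂ}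
    (hΦ : ∀ w : ℂ, ‖w‖ < 1 → Φ w 0 = w ∧ IsTrajectory G T (Φ w)) {z : ℂ} (hz : ‖z‖ < 1) :
    ∃ r : ℝ, 0 < r ∧ r < 1 ∧ ∀ᶠ w in 𝓝 z, ‖w‖ < 1 ∧ ∀ t ∈ Set.Icc 0 T, ‖Φ w t‖ ≤ r := by
  have hzb : Metric.ball (0 : ℂ) 1 ∈ 𝓝 z := Metric.isOpen_ball.mem_nhds (by simpa using hz)
  set m : ℂ → ℝ := fun w => (1 - ‖w‖ ^ 2) * Real.exp (-(2 * (‖G w‖ / (1 - ‖w‖ ^ 2)) * T)) with hm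
  have hz2 := one_sub_norm_sq_pos hz
  have hmc : ContinuousAt m z := by
    have h1 : ContinuousAt G z := (hG.differentiableAt hzb).continuousAt
    have h2 : ContinuousAt (fun w : ℂ => 1 - ‖w‖ ^ 2) z := by fun_prop
    exact h2.mul (((((h1.norm.div h2 hz2.ne').const_mul 2).mul_const T).neg).rexp)
  have hmz : 0 < m z := mul_pos hz2 (Real.exp_pos _)
  have hmz1 : m z ≤ 1 := by
    have h1 : Real.exp (-(2 * (‖G z‖ / (1 - ‖z‖ ^ 2)) * T)) ≤ 1 :=
      Real.exp_le_one_iff.2 (neg_nonpos.2 (by positivity))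
    exact mul_le_one₀ (by nlinarith [norm_nonneg z]) (Real.exp_pos _).le h1
  refine ⟨Real.sqrt (1 - m z / 2), Real.sqrt_pos.2 (by linarith), ?_, ?_⟩
  · rw [Real.sqrt_lt' one_pos]; linarith
  · filter_upwards [hzb, hmc.eventually (lt_mem_nhds (half_lt_self hmz))] with w hw hmw
    rw [mem_ball_zero_iff] at hw
    refine ⟨hw, fun t ht => ?_⟩
    obtain ⟨h0, htr⟩ := hΦ w hw
    have h1 := htr.one_sub_norm_sq_ge hG hD ht
    rw [h0] at h1
    have hw2 := one_sub_norm_sq_pos hw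
    have h2 : m w ≤ (1 - ‖w‖ ^ 2) * Real.exp (-(2 * (‖G w‖ / (1 - ‖w‖ ^ 2)) * t)) := by
      refine mul_le_mul_of_nonneg_left (Real.exp_le_exp.2 ?_) hw2.le
      have := mul_le_mul_of_nonneg_left ht.2 (by positivity : 0 ≤ 2 * (‖G w‖ / (1 - ‖w‖ ^ 2)))
      linarith
    refine Real.le_sqrt_of_sq_le ?_
    linarith

/-- The mean value inequality for x ↦ G(x) - G'(a)x on the segment, with a Lipschitz bound for G'
obtained by cutting G' off. -/
theorem exists_second_order_bound {G : ℂ → ℂ} (hG : DifferentiableOn ℂ G (Metric.ball 0 1)) {r : ℝ}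
    (hr0 : 0 < r) (hr : r < 1) : ∃ (C M : NNReal), ∀ a b : ℂ, ‖a‖ ≤ r → ‖b‖ ≤ r →
      ‖deriv G a‖ ≤ M ∧ ‖G b - G a - deriv G a * (b - a)‖ ≤ C * ‖b - a‖ ^ 2 := by
  obtain ⟨v, C, M, hv, hM, hvG⟩ := exists_lipschitz_cutoff (hG.deriv Metric.isOpen_ball) hr0 hr
  refine ⟨C, M, fun a b ha hb => ⟨by rw [← hvG a ha]; exact hM a, ?_⟩⟩
  have hseg : ∀ x ∈ segment ℝ a b, ‖x‖ ≤ r := fun x hx => by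
    have := (convex_closedBall (0 : ℂ) r).segment_subset (by simpa using ha) (by simpa using hb) hx
    simpa using this
  have key := (convex_segment a b).norm_image_sub_le_of_norm_hasDerivWithin_le
    (f := fun x => G x - deriv G a * x) (f' := fun x => deriv G x - deriv G a) (𝕜 := ℂ)
    (C := C * ‖b - a‖) (x := a) (y := b)
    (fun x hx => by
      have h1 : HasDerivAt G (deriv G x) x := (hG.differentiableAt
        (Metric.isOpen_ball.mem_nhds (by simpa using (hseg x hx).trans_lt hr))).hasDerivAt
      have h2 := h1.sub ((hasDerivAt_id x).const_mul (deriv G a))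
      simp only [mul_one] at h2
      exact h2.hasDerivWithinAt)
    (fun x hx => by
      have h1 := hv.dist_le_mul x a
      rw [dist_eq_norm, dist_eq_norm, hvG x (hseg x hx), hvG a ha] at h1
      refine h1.trans (mul_le_mul_of_nonneg_left ?_ C.2)
      exact norm_sub_le_of_mem_segment hx)
    (left_mem_segment ℝ a b) (right_mem_segment ℝ a b)
  have e : G b - deriv G a * b - (G a - deriv G a * a) = G b - G a - deriv G a * (b - a) := by ring
  rw [e] at key
  linarith [sq ‖b - a‖]

theorem exists_linear_ode_solution {c : ℝ → ℂ} {T : ℝ} (hT : 0 ≤ T)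
    (hc : ContinuousOn c (Set.Icc 0 T)) :
    ∃ y : ℝ → ℂ, y 0 = 1 ∧ ∀ t ∈ Set.Icc 0 T, HasDerivAt y (c t * y t) t := by
  -- Extending the coefficient constantly beyond [0, T] gives two-sided derivatives at the endpoints
  -- too.
  have h1 : Continuous (Set.IccExtend hT ((Set.Icc 0 T).domRestrict c)) :=
    hc.domRestrict.Icc_extend'
  refine ⟨fun t => Complex.exp (∫ s in (0 : ℝ)..t, Set.IccExtend hT ((Set.Icc 0 T).domRestrict c) s),
    by simp, fun t ht => ?_⟩
  have h2 := (h1.integral_hasStrictDerivAt 0 t).hasDerivAt.cexp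
  rw [Set.IccExtend_of_mem hT _ ht, mul_comm] at h2
  exact h2

/-- The complex derivative is y(T), where y solves the variational equation y' = G'(Φ_z)y, y(0) = 1.
The remainder Φ_w - Φ_z - (w - z)y satisfies a linear differential inequality with forcing of order
|w - z|², so Gronwall makes it quadratic in w - z. -/
theorem differentiableOn_flow {G : ℂ → ℂ} (hG : DifferentiableOn ℂ G (Metric.ball 0 1))
    (hD : IsDissipative G) {T : ℝ} (hT : 0 ≤ T) {Φ : ℂ → ℝ → ℂ}
    (hΦ : ∀ w : ℂ, ‖w‖ < 1 → Φ w 0 = w ∧ IsTrajectory G T (Φ w)) :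
    DifferentiableOn ℂ (fun w => Φ w T) (Metric.ball 0 1) := by
  intro z hz
  rw [mem_ball_zero_iff] at hz
  obtain ⟨r, hr0, hr1, hr⟩ := exists_uniform_radius hG hD hT hΦ hz
  obtain ⟨hz0, hztr⟩ := hΦ z hz
  have hzr := (hr.self_of_nhds).2
  obtain ⟨v, K, L, hv, -, hvG⟩ := exists_lipschitz_cutoff hG hr0 hr1
  obtain ⟨C, M, hCM⟩ := exists_second_order_bound hG hr0 hr1
  have hcG : ContinuousOn (fun t => deriv G (Φ z t)) (Set.Icc 0 T) := fun t ht =>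
    ((hG.deriv Metric.isOpen_ball).differentiableAt (Metric.isOpen_ball.mem_nhds
      (by simpa using (hztr t ht).1))).continuousAt.comp_continuousWithinAt (hztr.continuousOn t ht)
  obtain ⟨y, hy0, hy⟩ := exists_linear_ode_solution hT hcG
  -- The added 1 ensures a nonzero rate, for which the Gronwall bound has its closed form.
  set M' : ℝ := M + 1 with hM'
  have hM'0 : M' ≠ 0 := by positivity
  set B : ℝ := C * Real.exp (K * T) ^ 2 / M' * (Real.exp (M' * T) - 1) with hB
  have hdist : ∀ w, ‖w‖ < 1 → (∀ t ∈ Set.Icc 0 T, ‖Φ w t‖ ≤ r) → ∀ t ∈ Set.Icc 0 T,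
      ‖Φ w t - Φ z t‖ ≤ ‖w - z‖ * Real.exp (K * T) := by
    intro w hw hwr t ht
    obtain ⟨hw0, hwtr⟩ := hΦ w hw
    have h1 := dist_le_of_trajectories_ODE (v := fun _ => v) (K := K) (δ := ‖w - z‖)
      (fun _ => hv) hwtr.continuousOn
      (fun s hs => by
        rw [hvG _ (hwr s (Set.Ico_subset_Icc_self hs))]; exact hwtr.hasDerivWithinAt_Ici hs)
      hztr.continuousOn
      (fun s hs => by
        rw [hvG _ (hzr s (Set.Ico_subset_Icc_self hs))]; exact hztr.hasDerivWithinAt_Ici hs)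
      (by rw [hw0, hz0, dist_eq_norm]) t ht
    rw [dist_eq_norm, sub_zero] at h1
    refine h1.trans (mul_le_mul_of_nonneg_left (Real.exp_le_exp.2 ?_) (norm_nonneg _))
    exact mul_le_mul_of_nonneg_left ht.2 K.2
  have hest : ∀ᶠ w in 𝓝 z, ‖Φ w T - Φ z T - (w - z) * y T‖ ≤ B * ‖w - z‖ ^ 2 := by
    filter_upwards [hr] with w hw
    obtain ⟨hw1, hwr⟩ := hw
    obtain ⟨hw0, hwtr⟩ := hΦ w hw1
    have h1 := norm_le_gronwallBound_of_norm_deriv_right_le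
      (f := fun t => Φ w t - Φ z t - (w - z) * y t)
      (f' := fun t => G (Φ w t) - G (Φ z t) - (w - z) * (deriv G (Φ z t) * y t))
      (δ := 0) (K := M') (ε := C * (‖w - z‖ * Real.exp (K * T)) ^ 2) (a := 0) (b := T)
      ((hwtr.continuousOn.sub hztr.continuousOn).sub (continuousOn_const.mul
        fun t ht => (hy t ht).continuousAt.continuousWithinAt))
      (fun t ht => ((hwtr.hasDerivWithinAt_Ici ht).sub (hztr.hasDerivWithinAt_Ici ht)).sub
        ((hy t (Set.Ico_subset_Icc_self ht)).hasDerivWithinAt.const_mul _))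
      (by simp [hw0, hz0, hy0])
      (fun t ht => by
        have ht' := Set.Ico_subset_Icc_self ht
        obtain ⟨hM, hC⟩ := hCM (Φ z t) (Φ w t) (hzr t ht') (hwr t ht')
        have e : G (Φ w t) - G (Φ z t) - (w - z) * (deriv G (Φ z t) * y t)
            = deriv G (Φ z t) * (Φ w t - Φ z t - (w - z) * y t)
              + (G (Φ w t) - G (Φ z t) - deriv G (Φ z t) * (Φ w t - Φ z t)) := by ring
        rw [e]
        refine (norm_add_le _ _).trans (add_le_add ?_ (hC.trans ?_))
        · rw [norm_mul]
          exact mul_le_mul_of_nonneg_right (by linarith) (norm_nonneg _)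
        · have := hdist w hw1 hwr t ht'
          gcongr)
      T ⟨hT, le_rfl⟩
    refine h1.trans (le_of_eq ?_)
    rw [gronwallBound_of_K_ne_0 hM'0, hB]
    simp only [zero_mul, zero_add, sub_zero, mul_pow]
    ring
  have hder : HasDerivAt (fun w => Φ w T) (y T) z := by
    rw [hasDerivAt_iff_tendsto]
    have hlim : Tendsto (fun w => B * ‖w - z‖) (𝓝 z) (𝓝 0) := by
      have : Continuous fun w : ℂ => B * ‖w - z‖ := by fun_prop
      simpa using this.tendsto z
    refine squeeze_zero' (Eventually.of_forall fun w => by positivity) ?_ hlim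
    filter_upwards [hest] with w hw
    by_cases hwz : w = z
    · simp [hwz]
    · have : 0 < ‖w - z‖ := norm_pos_iff.2 (sub_ne_zero.2 hwz)
      rw [smul_eq_mul, inv_mul_le_iff₀ this]
      linarith
  exact hder.differentiableAt.differentiableWithinAt

theorem exists_semigroup {G : ℂ → ℂ} (hG : DifferentiableOn ℂ G (Metric.ball 0 1))
    (hD : IsDissipative G) :
    ∃ φ : ℝ → 𝔻 → 𝔻, IsOneParameterSemigroup φ ∧
      IsInfinitesimalGenerator φ (fun z => G z) := by
  choose α h0 hα using exists_global_trajectory hG hD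
  refine ⟨fun t z => α z t, ⟨fun t ht => ?_, h0, fun s t hs ht z => ?_, fun z => ?_⟩,
    ⟨G, hG, fun _ => rfl⟩, hα⟩
  · classical
    set Φ : ℂ → ℝ → ℂ := fun w s => if h : ‖w‖ < 1 then (α (.mk w h) s : ℂ) else 0 with hΦ
    have hΦ' : ∀ w (h : ‖w‖ < 1), Φ w = fun s => (α (.mk w h) s : ℂ) := fun w h => by
      funext s; simp only [hΦ, dif_pos h]
    refine ⟨fun w => Φ w t, differentiableOn_flow hG hD ht fun w hw => ?_, fun z => ?_⟩
    · rw [hΦ' w hw]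
      exact ⟨by simp [h0], isTrajectory_of_forall (hα _) t⟩
    · simp only [hΦ' z z.norm_lt_one, Complex.UnitDisc.mk_coe]
  · have h1 : IsTrajectory G s (fun r => (α z (r + t) : ℂ)) := by
      intro r hr
      refine ⟨(α z _).norm_lt_one, ?_⟩
      have h2 := hα z (r + t) (by linarith [hr.1])
      have h3 := h2.scomp r ((hasDerivAt_id r).add_const t).hasDerivWithinAt
        (s := Set.Icc 0 s) (fun x hx => by
          show 0 ≤ x + t
          linarith [hx.1])
      simpa [Function.comp_def] using h3
    exact Complex.UnitDisc.coe_injective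
      (h1.unique hG (isTrajectory_of_forall (hα (α z t)) s) (by simp [h0]) ⟨hs, le_rfl⟩)
  · have h1 := (hα z 0 le_rfl).continuousWithinAt.tendsto
    rw [h0] at h1
    exact (Complex.UnitDisc.isEmbedding_coe.tendsto_nhds_iff).2
      (h1.mono_left (nhdsWithin_mono _ Set.Ioi_subset_Ici_self))

/-! ### Sufficiency of the Berkson-Porta representation -/

/-- Pointwise in κ, the norm of the differentiated kernel times 1 - |z|² is twice the Poisson
kernel. -/
theorem norm_deriv_herglotz_le (β : ℝ) (ν : Measure UnitCircle) [IsFiniteMeasure ν] {z : ℂ}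
    (hz : ‖z‖ < 1) :
    ‖deriv (herglotz β ν) z‖ * (1 - ‖z‖ ^ 2) ≤ 2 * (herglotz β ν z).re := by
  rw [(hasDerivAt_herglotz β ν hz).deriv, herglotz_re β ν hz]
  have h1 := one_sub_norm_sq_pos hz
  have h2 := norm_integral_le_integral_norm (μ := ν)
    (fun κ : UnitCircle => 2 * (κ : ℂ) / ((κ : ℂ) - z) ^ 2)
  have h3 : ∀ κ : UnitCircle, ‖2 * (κ : ℂ) / ((κ : ℂ) - z) ^ 2‖ * (1 - ‖z‖ ^ 2)
      = 2 * ((1 - ‖z‖ ^ 2) / ‖(κ : ℂ) - z‖ ^ 2) := by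
    intro κ
    rw [norm_div, norm_mul, norm_pow, κ.norm_coe, Complex.norm_ofNat]
    ring
  calc _ ≤ (∫ κ : UnitCircle, ‖2 * (κ : ℂ) / ((κ : ℂ) - z) ^ 2‖ ∂ν) * (1 - ‖z‖ ^ 2) := by gcongr
    _ = _ := by
      rw [← integral_mul_const, ← integral_const_mul]
      exact integral_congr_ae (Eventually.of_forall h3)

/-- With A = (τ - z)(1 - τ̄z), the terms containing p itself add up to -S·Re p for S = |τ - z|² + |1
- τ̄z|² ≥ 2|A|, while the term with p' is at most 2|A|·Re p. -/
theorem isDissipative_berkson_porta (τ : ℂ) (β : ℝ) (ν : Measure UnitCircle) [IsFiniteMeasure ν] :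
    IsDissipative fun z => (τ - z) * (1 - conj τ * z) * herglotz β ν z := by
  intro z hz
  set h := herglotz β ν z with hh
  set A := (τ - z) * (1 - conj τ * z) with hA
  have hd : HasDerivAt (fun z => (τ - z) * (1 - conj τ * z) * herglotz β ν z)
      ((-(1 - conj τ * z) - (τ - z) * conj τ) * h + A * deriv (herglotz β ν) z) z := by
    have h1 := (((hasDerivAt_id z).const_sub τ).mul
      (((hasDerivAt_id z).const_mul (conj τ)).const_sub 1)).mul
      (hasDerivAt_herglotz β ν hz)
    rw [← (hasDerivAt_herglotz β ν hz).deriv] at h1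
    exact h1.congr_deriv (by simp only [id, Pi.mul_apply]; ring)
  rw [hd.deriv]
  have hre : 0 ≤ h.re := herglotz_re_nonneg β ν hz
  have h1 := one_sub_norm_sq_pos hz
  have h2 := norm_deriv_herglotz_le β ν hz
  set S : ℝ := ‖τ - z‖ ^ 2 + ‖1 - conj τ * z‖ ^ 2 with hS
  have hAS : 2 * ‖A‖ ≤ S := by
    rw [hA, norm_mul]
    linarith [two_mul_le_add_sq ‖τ - z‖ ‖1 - conj τ * z‖]
  have key : (-(1 - conj τ * z) - (τ - z) * conj τ) * ((1 - ‖z‖ ^ 2 : ℝ) : ℂ) + 2 * conj z * A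
      = -(S : ℂ) := by
    rw [hS, hA]
    push_cast
    rw [← Complex.conj_mul', ← Complex.conj_mul', ← Complex.conj_mul']
    simp only [map_sub, map_mul, map_one, Complex.conj_conj]
    ring
  have e1 : (((-(1 - conj τ * z) - (τ - z) * conj τ) * h + A * deriv (herglotz β ν) z).re
      * (1 - ‖z‖ ^ 2)) + 2 * (conj z * (A * h)).re
      = -S * h.re + (A * deriv (herglotz β ν) z).re * (1 - ‖z‖ ^ 2) := by
    have e2 := congrArg (fun x => (x * h).re) key
    rw [show -(S : ℂ) * h = ((-S : ℝ) : ℂ) * h by push_cast; ring, Complex.re_ofReal_mul] at e2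
    rw [← e2]
    have e3 : ((-(1 - conj τ * z) - (τ - z) * conj τ) * ((1 - ‖z‖ ^ 2 : ℝ) : ℂ)
        + 2 * conj z * A) * h = ((1 - ‖z‖ ^ 2 : ℝ) : ℂ)
          * ((-(1 - conj τ * z) - (τ - z) * conj τ) * h) + ((2 : ℝ) : ℂ) * (conj z * (A * h)) := by
      push_cast; ring
    rw [e3, Complex.add_re, Complex.add_re, Complex.re_ofReal_mul, Complex.re_ofReal_mul]
    ring
  rw [e1]
  have h3 : (A * deriv (herglotz β ν) z).re ≤ ‖A‖ * ‖deriv (herglotz β ν) z‖ :=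
    (Complex.re_le_norm _).trans (norm_mul_le _ _)
  have h4 : (A * deriv (herglotz β ν) z).re * (1 - ‖z‖ ^ 2) ≤ ‖A‖ * (2 * h.re) :=
    calc _ ≤ ‖A‖ * ‖deriv (herglotz β ν) z‖ * (1 - ‖z‖ ^ 2) := by gcongr
      _ = ‖A‖ * (‖deriv (herglotz β ν) z‖ * (1 - ‖z‖ ^ 2)) := by ring
      _ ≤ _ := by gcongr
  nlinarith

/-! ### Boundary fixed points and Denjoy–Wolff point of the constructed semigroup -/

theorem hasDerivWithinAt_cayley {φ : ℝ → 𝔻 → 𝔻} {G : 𝔻 → ℂ}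
    (hG : IsInfinitesimalGenerator φ G) (σ : UnitCircle) (z : 𝔻) {t : ℝ} (ht : 0 ≤ t) :
    HasDerivWithinAt (fun s => ((σ : ℂ) + φ s z) / ((σ : ℂ) - φ s z))
      (2 * σ * G (φ t z) / ((σ : ℂ) - φ t z) ^ 2) (Set.Ici 0) t := by
  have h1 := hG.2 z t ht
  have h2 := (h1.const_add (σ : ℂ)).div (h1.const_sub (σ : ℂ)) (σ.coe_ne_coe_disc (φ t z))
  exact h2.congr_deriv (by ring)

theorem HasDerivWithinAt.complex_re {W : ℝ → ℂ} {W' : ℂ} {s : Set ℝ} {t : ℝ}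
    (h : HasDerivWithinAt W W' s t) : HasDerivWithinAt (fun t => (W t).re) W'.re s t :=
  (Complex.reCLM.hasFDerivAt (x := W t)).comp_hasDerivWithinAt t h

theorem HasDerivWithinAt.complex_im {W : ℝ → ℂ} {W' : ℂ} {s : Set ℝ} {t : ℝ}
    (h : HasDerivWithinAt W W' s t) : HasDerivWithinAt (fun t => (W t).im) W'.im s t :=
  (Complex.imCLM.hasFDerivAt (x := W t)).comp_hasDerivWithinAt t h

/-- A differential inequality for the Cayley transform at `σ` makes `σ` a regular fixed point of
the whole semigroup. -/
theorem exists_hasBoundaryFixedPointDeriv {φ : ℝ → 𝔻 → 𝔻} {G : 𝔻 → ℂ}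
    (hφ : IsOneParameterSemigroup φ) (hG : IsInfinitesimalGenerator φ G) (σ : UnitCircle) {l : ℝ}
    (h : ∀ z : 𝔻, l * (((σ : ℂ) + z) / ((σ : ℂ) - z)).re
      ≤ (2 * σ * G z / ((σ : ℂ) - z) ^ 2).re) {t : ℝ} (ht : 0 ≤ t) :
    ∃ m : ℝ, 0 ≤ m ∧ HasBoundaryFixedPointDeriv (φ t) σ (((Real.exp (l * t) + m)⁻¹ : ℝ) : ℂ) := by
  have hmono : ∀ z : 𝔻, Real.exp (l * t) * (((σ : ℂ) + z) / ((σ : ℂ) - z)).re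
      ≤ (((σ : ℂ) + φ t z) / ((σ : ℂ) - φ t z)).re := by
    intro z
    -- The hypothesis makes the real part of the Cayley transform, multiplied by e^{-ls},
    -- nondecreasing along the flow.
    set u : ℝ → ℝ := fun s => (((σ : ℂ) + φ s z) / ((σ : ℂ) - φ s z)).re * Real.exp (-l * s) with hu
    have hud : ∀ s, 0 ≤ s → ∃ d ≥ 0, HasDerivWithinAt u d (Set.Ici 0) s := by
      intro s hs
      have h1 := (hasDerivWithinAt_cayley hG σ z hs).complex_re
      have h2 := h1.mul (((hasDerivAt_id s).const_mul (-l)).exp.hasDerivWithinAt (s := Set.Ici 0))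
      refine ⟨_, ?_, h2⟩
      have h3 := mul_nonneg (sub_nonneg.2 (h (φ s z))) (Real.exp_pos (-l * s)).le
      simp only [id, mul_one, ge_iff_le]
      linarith
    have hm : MonotoneOn u (Set.Ici 0) := by
      refine monotoneOn_of_deriv_nonneg (convex_Ici 0) ?_ ?_ ?_
      · intro s hs
        obtain ⟨d, -, hd⟩ := hud s hs
        exact hd.continuousWithinAt
      · intro s hs
        rw [interior_Ici] at hs
        obtain ⟨d, -, hd⟩ := hud s (le_of_lt hs)
        exact (hd.hasDerivAt (Ici_mem_nhds hs)).differentiableAt.differentiableWithinAt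
      · intro s hs
        rw [interior_Ici] at hs
        obtain ⟨d, hd0, hd⟩ := hud s (le_of_lt hs)
        rwa [(hd.hasDerivAt (Ici_mem_nhds hs)).deriv]
    have h1 := hm (Set.self_mem_Ici) ht ht
    simp only [hu, hφ.map_zero, mul_zero, Real.exp_zero, mul_one, neg_mul, Real.exp_neg,
      inv_one] at h1
    rw [← div_eq_mul_inv, le_div_iff₀ (Real.exp_pos _)] at h1
    linarith
  obtain ⟨g, hg, hgφ⟩ : ∃ g : ℂ → ℂ, DifferentiableOn ℂ g (Metric.ball 0 1) ∧
    ∀ z : 𝔻, (φ t z : ℂ) = g z := hφ.holomorphic t ht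
  have hg1 : ∀ w : ℂ, ‖w‖ < 1 → ‖g w‖ < 1 := by
    intro w hw
    have := hgφ (.mk w hw)
    rw [Complex.UnitDisc.coe_mk] at this
    rw [← this]
    exact (φ t _).norm_lt_one
  -- The Cayley transform of φ_t minus e^{lt} times that of z has nonnegative real part. Its
  -- Herglotz measure supplies m as its atom at σ.
  obtain ⟨β, ν, hν, hF⟩ := exists_herglotz
    (f := fun w => ((σ : ℂ) + g w) / ((σ : ℂ) - g w)
      - Real.exp (l * t) * (((σ : ℂ) + w) / ((σ : ℂ) - w)))
    (by
      refine DifferentiableOn.sub ?_ ((DifferentiableOn.div (by fun_prop) (by fun_prop)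
        fun w hw => coe_sub_ne_zero σ (by simpa using hw)).const_mul _)
      exact (hg.const_add _).div (hg.const_sub _)
        fun w hw => coe_sub_ne_zero σ (hg1 w (by simpa using hw)))
    (by
      intro w hw
      have h1 := hmono (.mk w hw)
      rw [hgφ] at h1
      rw [Complex.sub_re, Complex.re_ofReal_mul]
      exact sub_nonneg.2 h1)
  refine ⟨ν.real {σ}, measureReal_nonneg,
    hasBoundaryFixedPointDeriv_of_cayley (β := β) (Real.exp_pos _) fun z => ?_⟩
  rw [hgφ z, ← hF z z.norm_lt_one]
  ring

/-- For interior τ the field vanishes at τ, so τ is fixed. For τ on the circle the Cayley transform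
at τ has derivative 2p along the flow: its real part cannot decrease, which gives an angular
derivative at most 1, and a fixed point inside the disc forces p to be trivial. -/
theorem isSemigroupDWPoint_of_berkson_porta {τ : ℂ} (hτ : ‖τ‖ ≤ 1) {β : ℝ}
    {ν : Measure UnitCircle} [IsFiniteMeasure ν] {φ : ℝ → 𝔻 → 𝔻}
    (hφ : IsOneParameterSemigroup φ)
    (hG : IsInfinitesimalGenerator φ fun z => (τ - z) * (1 - conj τ * z) * herglotz β ν z) :
    IsSemigroupDWPoint φ τ := by
  set Gc : ℂ → ℂ := fun z => (τ - z) * (1 - conj τ * z) * herglotz β ν z with hGc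
  have hGd : DifferentiableOn ℂ Gc (Metric.ball 0 1) :=
    DifferentiableOn.mul (by fun_prop) (differentiableOn_herglotz β ν)
  have hconst : ∀ (z : 𝔻), Gc z = 0 → ∀ t, 0 ≤ t → φ t z = z := by
    intro z hz t ht
    have h1 : IsTrajectory Gc t fun _ => (z : ℂ) := fun s _ =>
      ⟨z.norm_lt_one, by rw [hz]; exact hasDerivWithinAt_const _ _ _⟩
    exact Complex.UnitDisc.coe_injective
      ((isTrajectory_of_forall (G := Gc) (α := fun s => φ s z) (hG.2 z) t).unique hGd h1
        (by simp [hφ.map_zero]) ⟨ht, le_rfl⟩)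
  intro t ht hid
  rcases hτ.lt_or_eq with hlt | heq
  · exact Or.inl ⟨.mk τ hlt, rfl, hconst _ (by simp [hGc]) t ht⟩
  · obtain ⟨τ, rfl⟩ : ∃ s : UnitCircle, (s : ℂ) = τ := ⟨⟨τ, by simpa using heq⟩, rfl⟩
    have hW : ∀ z : 𝔻, 2 * (τ : ℂ) * Gc z / ((τ : ℂ) - z) ^ 2 = 2 * herglotz β ν z := by
      intro z
      have h1 := τ.coe_ne_coe_disc z
      have h2 := τ.coe_ne_zero
      simp only [hGc]
      rw [τ.one_sub_conj_mul, τ.conj_coe]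
      field_simp
    refine Or.inr ⟨fun a ha => hid ?_, ?_⟩
    · have ht0 : 0 < t := by
        refine ht.lt_of_ne fun h => hid ?_
        funext z
        rw [← h, hφ.map_zero]; rfl
      have hd : ∀ s, 0 ≤ s → HasDerivWithinAt
          (fun s => ((τ : ℂ) + φ s a) / ((τ : ℂ) - φ s a)) (2 * herglotz β ν (φ s a))
          (Set.Ici 0) s := fun s hs => by
        have := hasDerivWithinAt_cayley hG τ a hs
        rwa [hW] at this
      have hends : ((τ : ℂ) + φ t a) / ((τ : ℂ) - φ t a) = ((τ : ℂ) + φ 0 a) / ((τ : ℂ) - φ 0 a) := by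
        rw [ha, hφ.map_zero]
      -- A fixed point a of φ_t closes its trajectory at time t, so Rolle's theorem gives a zero of
      -- Re p, impossible unless ν = 0. The imaginary part then gives β = 0 in the same way, so φ_t
      -- would be the identity.
      have hν : ν = 0 := by
        by_contra hν
        obtain ⟨s, hs, hs0⟩ := exists_hasDerivAt_eq_zero ht0
          (f := fun s => (((τ : ℂ) + φ s a) / ((τ : ℂ) - φ s a)).re)
          (f' := fun s => (2 * herglotz β ν (φ s a)).re)
          (fun s hs => ((hd s hs.1).complex_re.continuousWithinAt).mono Set.Icc_subset_Ici_self)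
          (by simp only [hends])
          (fun s hs => (hd s hs.1.le).complex_re.hasDerivAt (Ici_mem_nhds hs.1))
        have h1 := herglotz_re_pos β ν hν (φ s a).norm_lt_one
        have h2 : (2 * herglotz β ν (φ s a)).re = 2 * (herglotz β ν (φ s a)).re := by simp
        simp only [h2] at hs0
        linarith
      subst hν
      have hβ : β = 0 := by
        obtain ⟨s, hs, hs0⟩ := exists_hasDerivAt_eq_zero ht0
          (f := fun s => (((τ : ℂ) + φ s a) / ((τ : ℂ) - φ s a)).im)
          (f' := fun s => (2 * herglotz β 0 (φ s a)).im)
          (fun s hs => ((hd s hs.1).complex_im.continuousWithinAt).mono Set.Icc_subset_Ici_self)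
          (by simp only [hends])
          (fun s hs => (hd s hs.1.le).complex_im.hasDerivAt (Ici_mem_nhds hs.1))
        simpa [herglotz] using hs0
      funext z
      exact hconst z (by simp [hGc, herglotz, hβ]) t ht
    · obtain ⟨m, hm, h⟩ := exists_hasBoundaryFixedPointDeriv hφ hG τ (l := 0) (fun z => by
        rw [hW, zero_mul]
        have := herglotz_re_nonneg β ν z.norm_lt_one
        simpa using this) ht
      refine ⟨_, ?_, h⟩
      rw [zero_mul, Real.exp_zero]
      exact inv_le_one_of_one_le₀ (by linarith)

/-- Adding |τ - σ|² times the Cayley kernel at σ cancels the pole at σ. What remains is a constant,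
which is purely imaginary, plus a nonnegative multiple of the Cayley kernel at κ. -/
theorem cayley_generator_identity (τ : ℂ) (κ σ : UnitCircle) {z : ℂ} (hz : ‖z‖ < 1) :
    2 * ((τ - z) * (1 - conj τ * z)) * ((1 - conj (κ : ℂ) * σ) / (1 - conj (κ : ℂ) * z))
        / ((σ : ℂ) - z) + (‖τ - σ‖ ^ 2 : ℝ) * (((σ : ℂ) + z) / ((σ : ℂ) - z))
      = (conj (σ : ℂ) * τ - σ * conj τ - (τ * conj (κ : ℂ) - conj τ * κ))
        + (‖τ - κ‖ ^ 2 : ℝ) * (((κ : ℂ) + z) / ((κ : ℂ) - z)) := by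
  have h1 := coe_sub_ne_zero κ hz
  have h2 := coe_sub_ne_zero σ hz
  have h3 := κ.coe_ne_zero
  have h4 := σ.coe_ne_zero
  push_cast
  rw [← Complex.conj_mul', ← Complex.conj_mul', map_sub, map_sub, κ.one_sub_conj_mul,
    κ.one_sub_conj_mul, κ.conj_coe, σ.conj_coe]
  generalize conj τ = tb
  field_simp
  ring

theorem re_cayley_generator_nonneg (τ : ℂ) (κ σ : UnitCircle) {z : ℂ} (hz : ‖z‖ < 1) :
    0 ≤ (2 * ((τ - z) * (1 - conj τ * z)) * ((1 - conj (κ : ℂ) * σ) / (1 - conj (κ : ℂ) * z))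
        / ((σ : ℂ) - z) + (‖τ - σ‖ ^ 2 : ℝ) * (((σ : ℂ) + z) / ((σ : ℂ) - z))).re := by
  rw [cayley_generator_identity τ κ σ hz, Complex.add_re, Complex.re_ofReal_mul, re_cayley_coe]
  have h1 : (conj (σ : ℂ) * τ - σ * conj τ - (τ * conj (κ : ℂ) - conj τ * κ)).re = 0 := by
    simp only [Complex.sub_re, Complex.mul_re, Complex.conj_re, Complex.conj_im]
    ring
  rw [h1, zero_add]
  have := one_sub_norm_sq_pos hz
  positivity

/-- Integrating the κ-wise positivity against |κ - σ|⁻² dν gives the differential inequality whose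
rate is the spectral value at σ; this makes σ a BRFP of the flow. -/
theorem NullAt.cayley_inequality {β : ℝ} {ν : Measure UnitCircle} [IsFiniteMeasure ν]
    {σ : UnitCircle} (h : NullAt β ν σ) (τ : ℂ) {z : ℂ} (hz : ‖z‖ < 1) :
    -(‖τ - σ‖ ^ 2 * (2 * ∫ κ : UnitCircle, (‖(κ : ℂ) - σ‖ ^ 2)⁻¹ ∂ν))
        * (((σ : ℂ) + z) / ((σ : ℂ) - z)).re
      ≤ (2 * σ * ((τ - z) * (1 - conj τ * z) * herglotz β ν z) / ((σ : ℂ) - z) ^ 2).re := by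
  set A := (τ - z) * (1 - conj τ * z) with hA
  set W := ((σ : ℂ) + z) / ((σ : ℂ) - z) with hW
  have hσz := coe_sub_ne_zero σ hz
  set X : UnitCircle → ℂ := fun κ =>
    2 * A * ((1 - conj (κ : ℂ) * σ) / (1 - conj (κ : ℂ) * z)) / ((σ : ℂ) - z)
      + (‖τ - σ‖ ^ 2 : ℝ) * W with hX
  have hX0 : ∀ κ, 0 ≤ (X κ).re := fun κ => re_cayley_generator_nonneg τ κ σ hz
  have hne : ∀ κ : UnitCircle, 1 - conj (κ : ℂ) * z ≠ 0 := fun κ => κ.one_sub_conj_mul_ne_zero hz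
  have hcont : Continuous fun κ : UnitCircle => (1 - conj (κ : ℂ) * σ) / (1 - conj (κ : ℂ) * z) :=
    Continuous.div (by fun_prop) (by fun_prop) hne
  have hi1 : Integrable (fun κ : UnitCircle => ((1 - conj (κ : ℂ) * σ) / (1 - conj (κ : ℂ) * z))
      * (((‖(κ : ℂ) - σ‖ ^ 2)⁻¹ : ℝ) : ℂ)) ν := by
    obtain ⟨C, hC⟩ := (isCompact_univ (X := UnitCircle)).exists_bound_of_continuousOn
      hcont.continuousOn
    exact h.integrable.ofReal.bdd_mul hcont.aestronglyMeasurable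
      (Eventually.of_forall fun κ => hC κ trivial)
  have hi2 : Integrable (fun κ : UnitCircle => (((‖(κ : ℂ) - σ‖ ^ 2)⁻¹ : ℝ) : ℂ)) ν :=
    h.integrable.ofReal
  have hint : Integrable (fun κ => X κ * (((‖(κ : ℂ) - σ‖ ^ 2)⁻¹ : ℝ) : ℂ)) ν := by
    have := (hi1.const_mul (2 * A / ((σ : ℂ) - z))).add (hi2.const_mul ((‖τ - σ‖ ^ 2 : ℝ) * W))
    refine this.congr (Eventually.of_forall fun κ => ?_)
    simp only [hX, Pi.add_apply]
    ring
  have e1 : 2 * σ * (A * herglotz β ν z) / ((σ : ℂ) - z) ^ 2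
      + ((‖τ - σ‖ ^ 2 * (2 * ∫ κ : UnitCircle, (‖(κ : ℂ) - σ‖ ^ 2)⁻¹ ∂ν) : ℝ) : ℂ) * W
      = 2 * ∫ κ, X κ * (((‖(κ : ℂ) - σ‖ ^ 2)⁻¹ : ℝ) : ℂ) ∂ν := by
    have e2 : ∫ κ, X κ * (((‖(κ : ℂ) - σ‖ ^ 2)⁻¹ : ℝ) : ℂ) ∂ν
        = 2 * A / ((σ : ℂ) - z) * (∫ κ : UnitCircle, ((1 - conj (κ : ℂ) * σ)
          / (1 - conj (κ : ℂ) * z)) * (((‖(κ : ℂ) - σ‖ ^ 2)⁻¹ : ℝ) : ℂ) ∂ν)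
          + (‖τ - σ‖ ^ 2 : ℝ) * W * ∫ κ : UnitCircle, (((‖(κ : ℂ) - σ‖ ^ 2)⁻¹ : ℝ) : ℂ) ∂ν := by
      rw [← integral_const_mul, ← integral_const_mul,
        ← integral_add (hi1.const_mul _) (hi2.const_mul _)]
      refine integral_congr_ae (Eventually.of_forall fun κ => ?_)
      simp only [hX]
      ring
    rw [e2, h.herglotz_eq hz, integral_complex_ofReal]
    have e3 : ∫ κ : UnitCircle, 2 * ((1 - conj (κ : ℂ) * σ) / (1 - conj (κ : ℂ) * z))
        * (((‖(κ : ℂ) - σ‖ ^ 2)⁻¹ : ℝ) : ℂ) ∂ν = 2 * ∫ κ : UnitCircle, ((1 - conj (κ : ℂ) * σ)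
          / (1 - conj (κ : ℂ) * z)) * (((‖(κ : ℂ) - σ‖ ^ 2)⁻¹ : ℝ) : ℂ) ∂ν := by
      rw [← integral_const_mul]
      exact integral_congr_ae (Eventually.of_forall fun κ => by ring)
    rw [e3, σ.one_sub_conj_mul, σ.conj_coe]
    have hs := σ.coe_ne_zero
    push_cast
    field_simp
  have e4 := congrArg Complex.re e1
  rw [Complex.add_re, Complex.re_ofReal_mul] at e4
  have e5 : 0 ≤ (2 * ∫ κ, X κ * (((‖(κ : ℂ) - σ‖ ^ 2)⁻¹ : ℝ) : ℂ) ∂ν).re := by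
    have e6 := integral_re hint
    simp only [RCLike.re_to_complex] at e6
    rw [show (2 : ℂ) = ((2 : ℝ) : ℂ) by norm_num, Complex.re_ofReal_mul, ← e6]
    refine mul_nonneg zero_le_two (integral_nonneg fun κ => ?_)
    simp only [Complex.re_mul_ofReal, Pi.zero_apply]
    exact mul_nonneg (hX0 κ) (by positivity)
  linarith

theorem mem_genClass_of_nullAt {τ : ℂ} (hτ1 : ‖τ‖ ≤ 1) {n : ℕ} {σ : Fin n → UnitCircle}
    {Λ : Fin n → ℝ} (hσ : ∀ k, τ ≠ (σ k : ℂ)) (hΛ : ∀ k, Λ k < 0) {β : ℝ} {ν : Measure UnitCircle}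
    [IsFiniteMeasure ν] (h : ∀ k, NullAt β ν (σ k) ∧
      2 * ∫ κ : UnitCircle, (‖(κ : ℂ) - σ k‖ ^ 2)⁻¹ ∂ν ≤ |Λ k| / ‖τ - σ k‖ ^ 2) :
    (fun z : 𝔻 => (τ - z) * (1 - conj τ * z) * herglotz β ν z) ∈ GenClass τ σ Λ := by
  obtain ⟨φ, hφ, hG⟩ := exists_semigroup
    (G := fun z => (τ - z) * (1 - conj τ * z) * herglotz β ν z)
    (DifferentiableOn.mul (by fun_prop) (differentiableOn_herglotz β ν))
    (isDissipative_berkson_porta τ β ν)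
  refine ⟨φ, hφ, hG, isSemigroupDWPoint_of_berkson_porta hτ1 hφ hG, fun k => ?_⟩
  obtain ⟨hN, hle⟩ := h k
  set c := 2 * ∫ κ : UnitCircle, (‖(κ : ℂ) - σ k‖ ^ 2)⁻¹ ∂ν with hc
  have hpos : 0 < ‖τ - σ k‖ ^ 2 := by
    have := norm_pos_iff.2 (sub_ne_zero.2 (hσ k)); positivity
  have hc0 : 0 ≤ c := mul_nonneg zero_le_two (integral_nonneg fun κ => by positivity)
  refine ⟨-(‖τ - σ k‖ ^ 2 * c), ?_, ?_, fun t ht => ?_, fun M => ?_⟩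
  · rw [le_div_iff₀ hpos, abs_of_neg (hΛ k)] at hle
    linarith
  · rw [neg_nonpos]; positivity
  · obtain ⟨m, -, hm⟩ := exists_hasBoundaryFixedPointDeriv hφ hG (σ k)
      (fun z => hN.cayley_inequality τ z.norm_lt_one) ht
    exact ⟨_, hm⟩
  · have hz := tendsto_coe_stolzFilter (σ k) M
    have h1 := (((hz.const_sub τ).mul ((hz.const_mul (conj τ)).const_sub 1)).mul
      (hN.hasAngularLimit M)).mul_const (conj (σ k : ℂ))
    have h2 : (τ - σ k) * (1 - conj τ * σ k) * (c : ℂ) * conj (σ k : ℂ)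
        = ((-(‖τ - σ k‖ ^ 2 * c) : ℝ) : ℂ) := by
      rw [berkson_porta_factor_boundary]
      push_cast
      linear_combination (-(‖τ - σ k‖ ^ 2 * c : ℂ)) * (σ k).conj_mul_coe
    rw [h2] at h1
    refine h1.congr fun z => ?_
    have h4 := (σ k).coe_ne_coe_disc z
    have h5 := (σ k).coe_ne_zero
    rw [(σ k).one_sub_conj_mul, (σ k).conj_coe]
    field_simp

/-! ### The integral representation for a single boundary point -/

theorem re_cayley_boundary (κ σ : UnitCircle) : (((κ : ℂ) + σ) / ((κ : ℂ) - σ)).re = 0 := by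
  rw [re_cayley, κ.norm_coe, σ.norm_coe]; norm_num

theorem re_integral_cayley_boundary {ν : Measure UnitCircle} [IsFiniteMeasure ν] {σ : UnitCircle}
    (h : Integrable (fun κ : UnitCircle => (‖(κ : ℂ) - σ‖ ^ 2)⁻¹) ν) :
    (∫ κ : UnitCircle, ((κ : ℂ) + σ) / ((κ : ℂ) - σ) ∂ν).re = 0 := by
  have := integral_re (integrable_cayley_boundary h)
  simp only [RCLike.re_to_complex, re_cayley_boundary, integral_zero] at this
  exact this.symm

theorem integral_withDensity_ofReal {X E : Type*} [MeasurableSpace X] [NormedAddCommGroup E]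
    [NormedSpace ℝ E] {ν : Measure X} {ρ : X → ℝ} (hρ : Measurable ρ) (h0 : ∀ x, 0 ≤ ρ x)
    (f : X → E) :
    ∫ x, f x ∂(ν.withDensity fun x => ENNReal.ofReal (ρ x)) = ∫ x, ρ x • f x ∂ν := by
  rw [integral_withDensity_eq_integral_toReal_smul hρ.ennreal_ofReal
    (Eventually.of_forall fun _ => ENNReal.ofReal_lt_top)]
  exact integral_congr_ae (Eventually.of_forall fun x => by simp [ENNReal.toReal_ofReal (h0 x)])

theorem integrable_withDensity_ofReal_iff {X E : Type*} [MeasurableSpace X] [NormedAddCommGroup E]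
    [NormedSpace ℝ E] {ν : Measure X} {ρ : X → ℝ} (hρ : Measurable ρ) (h0 : ∀ x, 0 ≤ ρ x)
    {f : X → E} :
    Integrable f (ν.withDensity fun x => ENNReal.ofReal (ρ x)) ↔
      Integrable (fun x => ρ x • f x) ν := by
  rw [integrable_withDensity_iff_integrable_smul' hρ.ennreal_ofReal
    (Eventually.of_forall fun _ => ENNReal.ofReal_lt_top)]
  refine integrable_congr (Eventually.of_forall fun x => ?_)
  simp [ENNReal.toReal_ofReal (h0 x)]

/-- The reflection `κ ↦ σ κ̄` of the circle. -/
noncomputable def circleReflection (σ κ : UnitCircle) : UnitCircle :=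
  ⟨(σ : ℂ) * conj (κ : ℂ), by simp⟩

theorem coe_circleReflection (σ κ : UnitCircle) :
    (circleReflection σ κ : ℂ) = σ * conj (κ : ℂ) := rfl

theorem continuous_circleReflection (σ : UnitCircle) : Continuous (circleReflection σ) :=
  Continuous.subtype_mk (by fun_prop) _

theorem coe_circleReflection_mul_conj (σ κ : UnitCircle) :
    (circleReflection σ κ : ℂ) * conj (σ : ℂ) = conj (κ : ℂ) := by
  rw [coe_circleReflection, mul_right_comm, mul_comm (σ : ℂ), σ.conj_mul_coe, one_mul]

theorem conj_circleReflection_mul (σ κ : UnitCircle) :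
    conj (circleReflection σ κ : ℂ) * σ = κ := by
  rw [coe_circleReflection, map_mul, Complex.conj_conj, mul_right_comm, σ.conj_mul_coe, one_mul]

theorem conj_circleReflection (σ κ : UnitCircle) :
    conj (circleReflection σ κ : ℂ) = κ * conj (σ : ℂ) := by
  rw [coe_circleReflection, map_mul, Complex.conj_conj, mul_comm]

theorem continuous_moebius_kernel (σ : UnitCircle) {z : ℂ} (hz : ‖z‖ < 1) :
    Continuous fun κ : UnitCircle => (1 - (κ : ℂ)) / (1 - (κ : ℂ) * conj (σ : ℂ) * z) := by
  refine Continuous.div (by fun_prop) (by fun_prop) fun κ => ?_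
  rw [← conj_circleReflection σ κ]
  exact (circleReflection σ κ).one_sub_conj_mul_ne_zero hz

theorem continuous_boundary_kernel (σ : UnitCircle) {z : ℂ} (hz : ‖z‖ < 1) :
    Continuous fun κ : UnitCircle => (1 - conj (κ : ℂ) * σ) / (1 - conj (κ : ℂ) * z) :=
  Continuous.div (by fun_prop) (by fun_prop) fun κ => κ.one_sub_conj_mul_ne_zero hz

/-- The measure (2/c)|κ - σ|⁻²ν has mass at most 1, and the reflection κ ↦ σκ̄ carries its kernel to
the one in the statement. -/
theorem NullAt.exists_probabilityMeasure {β : ℝ} {ν : Measure UnitCircle} [IsFiniteMeasure ν]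
    {σ : UnitCircle} (h : NullAt β ν σ) {c : ℝ} (hc : 0 < c)
    (hle : 2 * ∫ κ : UnitCircle, (‖(κ : ℂ) - σ‖ ^ 2)⁻¹ ∂ν ≤ c) :
    ∃ μ : Measure UnitCircle, IsProbabilityMeasure μ ∧ ∀ z : ℂ, ‖z‖ < 1 →
      herglotz β ν z = c * (1 - conj (σ : ℂ) * z) *
        ∫ κ : UnitCircle, (1 - (κ : ℂ)) / (1 - (κ : ℂ) * conj (σ : ℂ) * z) ∂μ := by
  set ρ : UnitCircle → ℝ := fun κ => 2 / c * (‖(κ : ℂ) - σ‖ ^ 2)⁻¹ with hρ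
  have hρm : Measurable ρ := by fun_prop
  have hρ0 : ∀ κ, 0 ≤ ρ κ := fun κ => by positivity
  have hρi : Integrable ρ ν := h.integrable.const_mul _
  set m := ∫ κ, ρ κ ∂ν with hm
  have hm0 : 0 ≤ m := integral_nonneg hρ0
  have hm1 : m ≤ 1 := by
    have : m = (2 * ∫ κ : UnitCircle, (‖(κ : ℂ) - σ‖ ^ 2)⁻¹ ∂ν) / c := by
      rw [hm, hρ, integral_const_mul]; ring
    rw [this]
    exact div_le_one_of_le₀ hle hc.le
  set μ₀ := ν.withDensity fun κ => ENNReal.ofReal (ρ κ) with hμ₀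
  have hfin : IsFiniteMeasure μ₀ := isFiniteMeasure_withDensity_ofReal hρi.2
  have hTm : Measurable (circleReflection σ) := (continuous_circleReflection σ).measurable
  have hμ₀u : μ₀ Set.univ = ENNReal.ofReal m := by
    rw [hμ₀, withDensity_apply _ MeasurableSet.univ, Measure.restrict_univ,
      ofReal_integral_eq_lintegral_ofReal hρi (Eventually.of_forall hρ0)]
  have h1S : (1 : ℂ) ∈ Metric.sphere (0 : ℂ) 1 := by simp
  -- The missing mass goes to κ = 1, where the kernel vanishes.
  refine ⟨μ₀.map (circleReflection σ) + ENNReal.ofReal (1 - m) • Measure.dirac ⟨1, h1S⟩,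
    ⟨?_⟩, fun z hz => ?_⟩
  · rw [Measure.add_apply, Measure.map_apply hTm MeasurableSet.univ, Set.preimage_univ, hμ₀u,
      Measure.smul_apply, measure_univ, smul_eq_mul, mul_one,
      ← ENNReal.ofReal_add hm0 (by linarith)]
    norm_num
  · have hk := continuous_moebius_kernel σ hz
    have hi : ∀ μ : Measure UnitCircle, IsFiniteMeasure μ → Integrable
        (fun κ : UnitCircle => (1 - (κ : ℂ)) / (1 - (κ : ℂ) * conj (σ : ℂ) * z)) μ := fun μ _ =>
      hk.integrable_of_hasCompactSupport (HasCompactSupport.of_compactSpace _)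
    rw [integral_add_measure (hi _ inferInstance)
      ((hi _ inferInstance).smul_measure ENNReal.ofReal_ne_top), integral_smul_measure,
      integral_dirac, integral_map hTm.aemeasurable hk.aestronglyMeasurable,
      integral_withDensity_ofReal hρm hρ0, h.herglotz_eq hz]
    simp only [sub_self, zero_div, smul_zero, add_zero]
    rw [mul_comm (c : ℂ), mul_assoc]
    congr 1
    rw [← integral_const_mul]
    refine integral_congr_ae (Eventually.of_forall fun κ => ?_)
    simp only [hρ, coe_circleReflection_mul_conj, Complex.real_smul]
    rw [coe_circleReflection]
    have : (c : ℂ) ≠ 0 := Complex.ofReal_ne_zero.2 hc.ne'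
    push_cast
    field_simp

/-- Reflect μ and multiply by (c/2)|κ - σ|². Mass of μ at 1 is sent to σ and destroyed by the
density, so the derivative bound need not be attained. -/
theorem exists_nullAt_of_probabilityMeasure (σ : UnitCircle) {c : ℝ} (hc : 0 < c)
    (μ : Measure UnitCircle) [IsProbabilityMeasure μ] :
    ∃ (β : ℝ) (ν : Measure UnitCircle), IsFiniteMeasure ν ∧ NullAt β ν σ ∧
      2 * ∫ κ : UnitCircle, (‖(κ : ℂ) - σ‖ ^ 2)⁻¹ ∂ν ≤ c ∧ ∀ z : ℂ, ‖z‖ < 1 →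
      herglotz β ν z = c * (1 - conj (σ : ℂ) * z) *
        ∫ κ : UnitCircle, (1 - (κ : ℂ)) / (1 - (κ : ℂ) * conj (σ : ℂ) * z) ∂μ := by
  have hTm : Measurable (circleReflection σ) := (continuous_circleReflection σ).measurable
  set μ' := μ.map (circleReflection σ) with hμ'
  have hμ'p : IsProbabilityMeasure μ' := Measure.isProbabilityMeasure_map hTm.aemeasurable
  set ρ : UnitCircle → ℝ := fun κ => c / 2 * ‖(κ : ℂ) - σ‖ ^ 2 with hρ
  have hρc : Continuous ρ := by fun_prop
  have hρ0 : ∀ κ, 0 ≤ ρ κ := fun κ => by positivity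
  have hρi : Integrable ρ μ' :=
    hρc.integrable_of_hasCompactSupport (HasCompactSupport.of_compactSpace _)
  set ν := μ'.withDensity fun κ => ENNReal.ofReal (ρ κ) with hν
  have hfin : IsFiniteMeasure ν := isFiniteMeasure_withDensity_ofReal hρi.2
  have hw : ∀ κ : UnitCircle, ρ κ • (‖(κ : ℂ) - σ‖ ^ 2)⁻¹ ≤ c / 2 := by
    intro κ
    simp only [hρ, smul_eq_mul, mul_assoc]
    exact mul_le_of_le_one_right (by positivity) mul_inv_le_one
  have hw0 : ∀ κ : UnitCircle, 0 ≤ ρ κ • (‖(κ : ℂ) - σ‖ ^ 2)⁻¹ := fun κ =>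
    mul_nonneg (hρ0 κ) (by positivity)
  have hwi : Integrable (fun κ : UnitCircle => ρ κ • (‖(κ : ℂ) - σ‖ ^ 2)⁻¹) μ' := by
    refine Integrable.of_bound (C := c / 2) (Measurable.aestronglyMeasurable ?_)
      (Eventually.of_forall fun κ => ?_)
    · exact hρc.measurable.smul (by fun_prop)
    · rw [Real.norm_of_nonneg (hw0 κ)]; exact hw κ
  have hint : Integrable (fun κ : UnitCircle => (‖(κ : ℂ) - σ‖ ^ 2)⁻¹) ν :=
    (integrable_withDensity_ofReal_iff hρc.measurable hρ0).2 hwi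
  have hzero : ν {σ} = 0 := by
    rw [hν, withDensity_apply _ (measurableSet_singleton σ), lintegral_singleton]
    simp [hρ]
  set J := ∫ κ : UnitCircle, ((κ : ℂ) + σ) / ((κ : ℂ) - σ) ∂ν with hJ
  -- The boundary integral J is purely imaginary, so the imaginary constant can be chosen to cancel
  -- it.
  have hN : NullAt (-J.im) ν σ := by
    refine ⟨hzero, hint, ?_⟩
    have h1 := re_integral_cayley_boundary hint
    rw [herglotz, ← hJ]
    apply Complex.ext
    · simp [hJ, h1]
    · simp
  refine ⟨-J.im, ν, hfin, hN, ?_, fun z hz => ?_⟩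
  · rw [integral_withDensity_ofReal hρc.measurable hρ0]
    have h1 := integral_mono hwi (integrable_const (c / 2)) hw
    rw [integral_const, probReal_univ, one_smul] at h1
    linarith
  · have hk := continuous_moebius_kernel σ hz
    have hk2 := continuous_boundary_kernel σ hz
    have hmap : ∫ κ : UnitCircle, (1 - conj (κ : ℂ) * σ) / (1 - conj (κ : ℂ) * z) ∂μ'
        = ∫ κ : UnitCircle, (1 - (κ : ℂ)) / (1 - (κ : ℂ) * conj (σ : ℂ) * z) ∂μ := by
      rw [hμ', integral_map hTm.aemeasurable hk2.aestronglyMeasurable]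
      refine integral_congr_ae (Eventually.of_forall fun κ => ?_)
      simp only [conj_circleReflection_mul]
      rw [conj_circleReflection]
    rw [hN.herglotz_eq hz, integral_withDensity_ofReal hρc.measurable hρ0, ← hmap,
      mul_comm (c : ℂ), mul_assoc]
    congr 1
    rw [← integral_const_mul]
    refine integral_congr_ae (Eventually.of_forall fun κ => ?_)
    by_cases hκ : κ = σ
    · subst hκ
      simp [κ.conj_mul_coe]
    · have : ((‖(κ : ℂ) - σ‖ : ℝ) : ℂ) ≠ 0 := Complex.ofReal_ne_zero.2
        (norm_ne_zero_iff.2 (sub_ne_zero.2 fun h' => hκ (Subtype.ext h')))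
      simp only [hρ, Complex.real_smul]
      push_cast
      field_simp

theorem mem_genClass_single_iff {τ : ℂ} (hτ : ‖τ‖ ≤ 1) (σ : UnitCircle) (hσ : τ ≠ (σ : ℂ))
    {l : ℝ} (hl : l < 0) (G : 𝔻 → ℂ) :
    G ∈ GenClass τ (fun _ : Fin 1 => σ) (fun _ : Fin 1 => l) ↔
      ∃ μ : Measure UnitCircle, IsProbabilityMeasure μ ∧
        ∀ z : 𝔻, G z = ((|l| / ‖(σ : ℂ) - τ‖ ^ 2 : ℝ) : ℂ) * (τ - (z : ℂ)) *
          (1 - conj τ * (z : ℂ)) * (1 - conj (σ : ℂ) * (z : ℂ)) *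
            ∫ κ : UnitCircle, (1 - (κ : ℂ)) / (1 - (κ : ℂ) * conj (σ : ℂ) * (z : ℂ)) ∂μ := by
  have hc : 0 < |l| / ‖(σ : ℂ) - τ‖ ^ 2 :=
    div_pos (abs_pos.2 hl.ne) (pow_pos (norm_pos_iff.2 (sub_ne_zero.2 hσ.symm)) 2)
  constructor
  · intro hG
    obtain ⟨β, ν, hν, hGν, hN⟩ := exists_herglotz_of_mem_genClass hτ (fun _ => hσ) (fun _ => hl) hG
    obtain ⟨hN, hle⟩ := hN 0
    rw [norm_sub_rev τ] at hle
    obtain ⟨μ, hμ, hμz⟩ := hN.exists_probabilityMeasure hc hle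
    refine ⟨μ, hμ, fun z => ?_⟩
    rw [hGν, hμz z z.norm_lt_one]
    ring
  · rintro ⟨μ, hμ, hG⟩
    obtain ⟨β, ν, hν, hN, hle, hz⟩ := exists_nullAt_of_probabilityMeasure σ hc μ
    have hGe : G = fun z : 𝔻 => (τ - z) * (1 - conj τ * z) * herglotz β ν z := by
      funext z
      rw [hG, hz z z.norm_lt_one]
      ring
    rw [hGe]
    rw [norm_sub_rev] at hle
    exact mem_genClass_of_nullAt hτ (fun _ => hσ) (fun _ => hl) fun _ => ⟨hN, hle⟩

/-! ### Uniqueness of the Herglotz measure -/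

theorem UnitCircle.integrable_of_continuous {E : Type*} [NormedAddCommGroup E]
    {f : UnitCircle → E} (hf : Continuous f) (ν : Measure UnitCircle) [IsFiniteMeasure ν] :
    Integrable f ν :=
  hf.integrable_of_hasCompactSupport (HasCompactSupport.of_compactSpace _)

/-- Conjugation supplies the remaining moments. On the circle every monomial in κ and κ̄ reduces to
a power of one of them, and the star algebra generated by the coordinate separates points. -/
theorem UnitCircle.measure_ext_of_moments {ν ν' : Measure UnitCircle} [IsFiniteMeasure ν]
    [IsFiniteMeasure ν']
    (h : ∀ m : ℕ, ∫ κ : UnitCircle, conj (κ : ℂ) ^ m ∂ν = ∫ κ : UnitCircle, conj (κ : ℂ) ^ m ∂ν') :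
    ν = ν' := by
  have h' : ∀ m : ℕ, ∫ κ : UnitCircle, (κ : ℂ) ^ m ∂ν = ∫ κ : UnitCircle, (κ : ℂ) ^ m ∂ν' := by
    intro m
    have := congrArg conj (h m)
    rw [← integral_conj, ← integral_conj] at this
    simpa using this
  let f : BoundedContinuousFunction UnitCircle ℂ :=
    BoundedContinuousFunction.mkOfCompact ⟨fun κ => (κ : ℂ), continuous_subtype_val⟩
  refine ext_of_forall_mem_subalgebra_integral_eq_of_polish (𝕜 := ℂ)
    (A := StarAlgebra.adjoin ℂ {f}) ?_ fun g hg => ?_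
  · intro x y hxy
    refine ⟨_, ⟨_, ⟨f, StarAlgebra.self_mem_adjoin_singleton ℂ f, rfl⟩, rfl⟩, ?_⟩
    exact fun h => hxy (Subtype.ext h)
  · have hg' : g ∈ Submodule.span ℂ
        (Submonoid.closure ({f, star f} : Set (BoundedContinuousFunction UnitCircle ℂ)) :
          Set (BoundedContinuousFunction UnitCircle ℂ)) := by
      have h1 : ({f, star f} : Set (BoundedContinuousFunction UnitCircle ℂ)) = {f} ∪ star {f} := by
        rw [Set.star_singleton]; rfl
      rw [h1, ← Algebra.adjoin_eq_span, ← StarAlgebra.adjoin_toSubalgebra]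
      exact hg
    clear hg
    induction hg' using Submodule.span_induction with
    | mem x hx =>
      obtain ⟨m, l, rfl⟩ := (Submonoid.mem_closure_pair _ _ _).1 hx
      have hval : ∀ κ : UnitCircle, (f ^ m * star f ^ l) κ = (κ : ℂ) ^ m * conj (κ : ℂ) ^ l :=
        fun κ => rfl
      simp only [hval]
      rcases le_total l m with hlm | hlm
      · have : ∀ κ : UnitCircle, (κ : ℂ) ^ m * conj (κ : ℂ) ^ l = (κ : ℂ) ^ (m - l) := by
          intro κ
          rw [← Nat.sub_add_cancel hlm, pow_add, mul_assoc, ← mul_pow, mul_comm (κ : ℂ) (conj _),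
            κ.conj_mul_coe, one_pow, mul_one, Nat.add_sub_cancel]
        simp only [this, h']
      · have : ∀ κ : UnitCircle, (κ : ℂ) ^ m * conj (κ : ℂ) ^ l = conj (κ : ℂ) ^ (l - m) := by
          intro κ
          rw [← Nat.sub_add_cancel hlm, pow_add, mul_left_comm, ← mul_pow, mul_comm (κ : ℂ) (conj _),
            κ.conj_mul_coe, one_pow, mul_one, Nat.add_sub_cancel]
        simp only [this, h]
    | zero => simp
    | add x y _ _ hx hy =>
      simp only [BoundedContinuousFunction.coe_add, Pi.add_apply]
      rw [integral_add (integrable_of_continuous x.continuous ν)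
        (integrable_of_continuous y.continuous ν), integral_add
        (integrable_of_continuous x.continuous ν') (integrable_of_continuous y.continuous ν'),
        hx, hy]
    | smul a x _ hx =>
      simp only [BoundedContinuousFunction.coe_smul]
      rw [integral_smul, integral_smul, hx]

theorem integrable_cauchy_kernel (ν : Measure UnitCircle) [IsFiniteMeasure ν] (m : ℕ) {z : ℂ}
    (hz : ‖z‖ < 1) :
    Integrable (fun κ : UnitCircle => conj (κ : ℂ) ^ m / (1 - conj (κ : ℂ) * z)) ν :=
  UnitCircle.integrable_of_continuous (Continuous.div (by fun_prop) (by fun_prop) fun κ =>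
    κ.one_sub_conj_mul_ne_zero hz) ν

theorem integral_cauchy_kernel_eq (ν : Measure UnitCircle) [IsFiniteMeasure ν] (m : ℕ) {z : ℂ}
    (hz : ‖z‖ < 1) :
    ∫ κ : UnitCircle, conj (κ : ℂ) ^ m / (1 - conj (κ : ℂ) * z) ∂ν =
      ∫ κ : UnitCircle, conj (κ : ℂ) ^ m ∂ν +
        z * ∫ κ : UnitCircle, conj (κ : ℂ) ^ (m + 1) / (1 - conj (κ : ℂ) * z) ∂ν := by
  rw [← integral_const_mul, ← integral_add (UnitCircle.integrable_of_continuous (by fun_prop) ν)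
    ((integrable_cauchy_kernel ν _ hz).const_mul z)]
  refine integral_congr_ae (Eventually.of_forall fun κ => ?_)
  have := κ.one_sub_conj_mul_ne_zero hz
  simp only
  field_simp
  ring

theorem norm_integral_cauchy_kernel_le (ν : Measure UnitCircle) [IsFiniteMeasure ν] (m : ℕ) {z : ℂ}
    (hz : ‖z‖ < 1) :
    ‖∫ κ : UnitCircle, conj (κ : ℂ) ^ m / (1 - conj (κ : ℂ) * z) ∂ν‖ ≤
      (1 - ‖z‖)⁻¹ * ν.real Set.univ := by
  refine norm_integral_le_of_norm_le_const (Eventually.of_forall fun κ => ?_)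
  rw [norm_div, norm_pow, RCLike.norm_conj, κ.norm_coe, one_pow, κ.norm_one_sub_conj_mul, one_div]
  exact inv_anti₀ (by linarith) (one_sub_norm_le_norm_coe_sub κ z)

/-- This is a comparison of Taylor coefficients: from the m-th transform subtract the m-th moment
and divide by z, recovering z = 0 by continuity. -/
theorem moments_eq_of_cauchy_eq {ν ν' : Measure UnitCircle} [IsFiniteMeasure ν]
    [IsFiniteMeasure ν']
    (h : ∀ z : ℂ, ‖z‖ < 1 → ∫ κ : UnitCircle, (1 - conj (κ : ℂ) * z)⁻¹ ∂ν =
      ∫ κ : UnitCircle, (1 - conj (κ : ℂ) * z)⁻¹ ∂ν') (m : ℕ) :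
    ∫ κ : UnitCircle, conj (κ : ℂ) ^ m ∂ν = ∫ κ : UnitCircle, conj (κ : ℂ) ^ m ∂ν' := by
  set D : Measure UnitCircle → ℕ → ℂ → ℂ := fun ν m z =>
    ∫ κ : UnitCircle, conj (κ : ℂ) ^ m / (1 - conj (κ : ℂ) * z) ∂ν with hD
  suffices hm : ∀ z : ℂ, ‖z‖ < 1 → D ν m z = D ν' m z by simpa [hD] using hm 0 (by simp)
  induction m with
  | zero => simpa [hD] using h
  | succ m ih =>
    have h0 : ∫ κ : UnitCircle, conj (κ : ℂ) ^ m ∂ν = ∫ κ : UnitCircle, conj (κ : ℂ) ^ m ∂ν' := by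
      simpa [hD] using ih 0 (by simp)
    have hne : ∀ z : ℂ, ‖z‖ < 1 → z ≠ 0 → D ν (m + 1) z = D ν' (m + 1) z := by
      intro z hz hz0
      have h1 := ih z hz
      simp only [hD] at h1 ⊢
      rw [integral_cauchy_kernel_eq ν m hz, integral_cauchy_kernel_eq ν' m hz, h0] at h1
      exact mul_left_cancel₀ hz0 (add_left_cancel h1)
    intro z hz
    by_cases hz0 : z = 0
    · subst hz0
      have hlim : ∀ (μ : Measure UnitCircle) [IsFiniteMeasure μ],
          Tendsto (D μ (m + 1)) (𝓝[≠] 0) (𝓝 (D μ (m + 1) 0)) := by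
        intro μ _
        refine tendsto_nhdsWithin_of_tendsto_nhds ?_
        have hb : ∀ᶠ w : ℂ in 𝓝 0, ‖D μ (m + 1) w - D μ (m + 1) 0‖
            ≤ ‖w‖ * ((1 - ‖w‖)⁻¹ * μ.real Set.univ) := by
          filter_upwards [Metric.ball_mem_nhds (0 : ℂ) one_pos] with w hw
          have hw' : ‖w‖ < 1 := by simpa using hw
          have h1 : D μ (m + 1) w - D μ (m + 1) 0 = w * D μ (m + 2) w := by
            simp only [hD]
            rw [integral_cauchy_kernel_eq μ (m + 1) hw']
            simp
          rw [h1, norm_mul]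
          gcongr
          exact norm_integral_cauchy_kernel_le μ _ hw'
        rw [tendsto_iff_norm_sub_tendsto_zero]
        refine squeeze_zero' (Eventually.of_forall fun _ => norm_nonneg _) hb ?_
        have : ContinuousAt (fun w : ℂ => ‖w‖ * ((1 - ‖w‖)⁻¹ * μ.real Set.univ)) 0 :=
          continuous_norm.continuousAt.mul
            ((ContinuousAt.inv₀ (by fun_prop) (by simp)).mul continuousAt_const)
        simpa [ContinuousAt] using this
      refine tendsto_nhds_unique (hlim ν) ((hlim ν').congr' ?_)
      filter_upwards [self_mem_nhdsWithin, nhdsWithin_le_nhds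
        (Metric.ball_mem_nhds (0 : ℂ) one_pos)] with w hw0 hw
      exact (hne w (by simpa using hw) hw0).symm
    · exact hne z hz hz0

theorem herglotz_eq_cauchy (β : ℝ) (ν : Measure UnitCircle) [IsFiniteMeasure ν] {z : ℂ}
    (hz : ‖z‖ < 1) :
    herglotz β ν z = Complex.I * β - (ν.real Set.univ : ℝ) +
      2 * ∫ κ : UnitCircle, (1 - conj (κ : ℂ) * z)⁻¹ ∂ν := by
  have hi : Integrable (fun κ : UnitCircle => (1 - conj (κ : ℂ) * z)⁻¹) ν := by
    simpa using integrable_cauchy_kernel ν 0 hz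
  have h1 : ∫ κ : UnitCircle, ((κ : ℂ) + z) / ((κ : ℂ) - z) ∂ν =
      ∫ κ : UnitCircle, (2 * (1 - conj (κ : ℂ) * z)⁻¹ - 1) ∂ν := by
    refine integral_congr_ae (Eventually.of_forall fun κ => ?_)
    have h2 : (κ : ℂ) - z ≠ 0 := coe_sub_ne_zero κ hz
    have h3 : 1 - conj (κ : ℂ) * z = conj (κ : ℂ) * (κ - z) := by
      rw [mul_sub, κ.conj_mul_coe]
    have h4 : conj (κ : ℂ) * κ = 1 := κ.conj_mul_coe
    have h5 : conj (κ : ℂ) ≠ 0 := left_ne_zero_of_mul_eq_one h4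
    simp only
    rw [h3]
    field_simp
    linear_combination (2 : ℂ) * h4
  rw [herglotz, h1, integral_sub (hi.const_mul 2) (integrable_const 1), integral_const_mul]
  simp
  ring

theorem herglotz_injective {β β' : ℝ} {ν ν' : Measure UnitCircle} [IsFiniteMeasure ν]
    [IsFiniteMeasure ν'] (h : ∀ z : ℂ, ‖z‖ < 1 → herglotz β ν z = herglotz β' ν' z) :
    ν = ν' := by
  have h0 := h 0 (by simp)
  rw [herglotz_eq_cauchy β ν (by simp), herglotz_eq_cauchy β' ν' (by simp)] at h0
  have hre := congrArg Complex.re h0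
  have him := congrArg Complex.im h0
  simp [-Complex.coe_smul] at hre him
  refine UnitCircle.measure_ext_of_moments (moments_eq_of_cauchy_eq fun z hz => ?_)
  have := h z hz
  rw [herglotz_eq_cauchy β ν hz, herglotz_eq_cauchy β' ν' hz, him] at this
  have hre' : ν.real Set.univ = ν'.real Set.univ := by linarith
  rw [hre'] at this
  linear_combination this / 2

/-- The Berkson–Porta factor vanishes at an interior τ, so equality of generators says nothing about
p there; continuity fills the gap. -/
theorem herglotz_injective_of_punctured {β β' : ℝ} {ν ν' : Measure UnitCircle} [IsFiniteMeasure ν]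
    [IsFiniteMeasure ν'] (τ : ℂ)
    (h : ∀ z : ℂ, ‖z‖ < 1 → z ≠ τ → herglotz β ν z = herglotz β' ν' z) : ν = ν' := by
  refine herglotz_injective (β := β) (β' := β') fun z hz => ?_
  by_cases hzτ : z = τ
  · subst hzτ
    have hmem : Metric.ball (0 : ℂ) 1 ∈ 𝓝 z := Metric.isOpen_ball.mem_nhds (by simpa using hz)
    have hlim : ∀ (b : ℝ) (μ : Measure UnitCircle) [IsFiniteMeasure μ],
        Tendsto (herglotz b μ) (𝓝[≠] z) (𝓝 (herglotz b μ z)) := fun b μ _ =>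
      tendsto_nhdsWithin_of_tendsto_nhds
        ((differentiableOn_herglotz b μ).continuousOn.continuousAt hmem)
    refine tendsto_nhds_unique (hlim β ν) ((hlim β' ν').congr' ?_)
    filter_upwards [self_mem_nhdsWithin, nhdsWithin_le_nhds hmem] with w hw0 hw
    exact (h w (by simpa using hw) hw0).symm
  · exact h z hz hzτ

/-! ### Extreme points have finitely supported Herglotz measures -/

/-- Any m points of the support would have disjoint open neighbourhoods, all of positive measure, so
the support has fewer than m points. Being finite, it is discrete, and each of its points is an
atom. -/
theorem exists_finset_of_disjoint_null {X : Type*} [TopologicalSpace X] [T2Space X]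
    [SecondCountableTopology X] [MeasurableSpace X] [OpensMeasurableSpace X] (ν : Measure X) {m : ℕ}
    (h : ∀ A : Fin m → Set X, (∀ j, MeasurableSet (A j)) → Pairwise (Function.onFun Disjoint A) →
      ∃ j, ν (A j) = 0) :
    ∃ S : Finset X, S.card < m ∧ ν (S : Set X)ᶜ = 0 ∧ ∀ x ∈ S, ν {x} ≠ 0 := by
  have hT : ∀ T : Finset X, (T : Set X) ⊆ ν.support → T.card ≠ m := by
    rintro T hT rfl
    obtain ⟨U, hU, hd⟩ := T.finite_toSet.t2_separation
    let e := T.equivFin.symm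
    obtain ⟨j, hj⟩ := h (fun j => U (e j)) (fun j => (hU _).2.measurableSet) fun i j hij =>
      hd (e i).2 (e j).2 fun h' => hij (e.injective (Subtype.ext h'))
    exact ((Measure.mem_support_iff_forall _).1 (hT (e j).2) _
      ((hU _).2.mem_nhds (hU _).1)).ne' hj
  have hfin : ν.support.Finite := by
    by_contra hinf
    obtain ⟨T, hT1, hT2⟩ := Set.Infinite.exists_subset_card_eq hinf m
    exact hT T hT1 hT2
  refine ⟨hfin.toFinset, ?_, by simp, fun x hx h0 => ?_⟩
  · by_contra! hle
    obtain ⟨T, hT1, hT2⟩ := Finset.exists_subset_card_eq hle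
    exact hT T (fun x hx => by simpa using hT1 hx) hT2
  · have hx' : x ∈ ν.support := by simpa using hx
    have hopen : IsOpen (ν.support \ {x})ᶜ := (hfin.subset Set.sdiff_subset).isClosed.isOpen_compl
    have hpos := (Measure.mem_support_iff_forall _).1 hx' _ (hopen.mem_nhds (by simp))
    refine hpos.ne' (measure_mono_null (t := {x} ∪ ν.supportᶜ) (fun y hy => ?_)
      (measure_union_null h0 Measure.measure_compl_support))
    by_cases hyx : y = x
    · exact Or.inl hyx
    · exact Or.inr fun hy' => hy ⟨hy', hyx⟩

theorem integral_eq_sum_of_measure_compl_finset {X E : Type*} [MeasurableSpace X]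
    [MeasurableSingletonClass X] [NormedAddCommGroup E] [NormedSpace ℝ E] [CompleteSpace E]
    {ν : Measure X} [IsFiniteMeasure ν] {S : Finset X} (hS : ν (S : Set X)ᶜ = 0) (f : X → E) :
    ∫ x, f x ∂ν = ∑ x ∈ S, ν.real {x} • f x := by
  rw [← setIntegral_finset S IntegrableOn.finset, Measure.restrict_eq_self_of_ae_mem]
  exact hS

/-! ### Perturbing the Herglotz measure of an extreme point -/

/-- The density `1 + ε h` perturbing a Herglotz measure. -/
noncomputable def perturbedMeasure (ν : Measure UnitCircle) (h : UnitCircle → ℝ) (ε : ℝ) :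
    Measure UnitCircle :=
  ν.withDensity fun κ => ENNReal.ofReal (1 + ε * h κ)

section Perturbation

variable {ν : Measure UnitCircle} {h : UnitCircle → ℝ} {C ε : ℝ}

theorem integrable_mul_smul_of_bounded {E : Type*} [NormedAddCommGroup E] [NormedSpace ℝ E]
    (hm : Measurable h) (hC : ∀ κ, |h κ| ≤ C) {f : UnitCircle → E} (hf : Integrable f ν) :
    Integrable (fun κ => h κ • f κ) ν :=
  hf.bdd_smul C hm.aestronglyMeasurable (Eventually.of_forall hC)

theorem isFiniteMeasure_perturbedMeasure [IsFiniteMeasure ν] (hm : Measurable h) (hC : ∀ κ, |h κ| ≤ C) (ε : ℝ) :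
    IsFiniteMeasure (perturbedMeasure ν h ε) := by
  refine isFiniteMeasure_withDensity_ofReal (Integrable.hasFiniteIntegral ?_)
  have := integrable_mul_smul_of_bounded hm hC (integrable_const (μ := ν) (1 : ℝ))
  simp only [smul_eq_mul, mul_one] at this
  exact (integrable_const 1).add (this.const_mul ε)

theorem integrable_perturbedMeasure {E : Type*} [NormedAddCommGroup E] [NormedSpace ℝ E]
    (hm : Measurable h) (hC : ∀ κ, |h κ| ≤ C) (hε : ∀ κ, 0 ≤ 1 + ε * h κ)
    {f : UnitCircle → E} (hf : Integrable f ν) : Integrable f (perturbedMeasure ν h ε) := by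
  rw [perturbedMeasure, integrable_withDensity_ofReal_iff (by fun_prop) hε]
  simp only [add_smul, one_smul, mul_smul]
  exact hf.add ((integrable_mul_smul_of_bounded hm hC hf).smul ε)

theorem integral_perturbedMeasure {E : Type*} [NormedAddCommGroup E] [NormedSpace ℝ E]
    (hm : Measurable h) (hC : ∀ κ, |h κ| ≤ C) (hε : ∀ κ, 0 ≤ 1 + ε * h κ)
    {f : UnitCircle → E} (hf : Integrable f ν) :
    ∫ κ, f κ ∂(perturbedMeasure ν h ε) = ∫ κ, f κ ∂ν + ε • ∫ κ, h κ • f κ ∂ν := by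
  rw [perturbedMeasure, integral_withDensity_ofReal (by fun_prop) hε, ← integral_smul]
  simp only [add_smul, one_smul, mul_smul]
  exact integral_add hf ((integrable_mul_smul_of_bounded hm hC hf).smul ε)

theorem herglotz_perturbedMeasure (hm : Measurable h) (hC : ∀ κ, |h κ| ≤ C)
    (hε : ∀ κ, 0 ≤ 1 + ε * h κ) (β b : ℝ) {z : ℂ}
    (hi : Integrable (fun κ : UnitCircle => ((κ : ℂ) + z) / ((κ : ℂ) - z)) ν) :
    herglotz (β + ε * b) (perturbedMeasure ν h ε) z = herglotz β ν z +
      ε * (Complex.I * b + ∫ κ : UnitCircle, h κ • (((κ : ℂ) + z) / ((κ : ℂ) - z)) ∂ν) := by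
  rw [herglotz, herglotz, integral_perturbedMeasure hm hC hε hi, Complex.real_smul]
  push_cast
  ring

end Perturbation

/-- For small ε the data (β ± εb, ν(1 ± εh)) stay admissible: the zeros at σ_k and the saturated
bounds are preserved exactly, the strict bounds by continuity. G is the midpoint of the two
generators, so extremality and uniqueness of the Herglotz measure give ν(1 + εh) = ν. -/
theorem ae_eq_zero_of_mem_extremePoints {τ : ℂ} (hτ1 : ‖τ‖ ≤ 1) {n : ℕ} {σ : Fin n → UnitCircle}
    {Λ : Fin n → ℝ} (hσ : ∀ k, τ ≠ (σ k : ℂ)) (hΛ : ∀ k, Λ k < 0) {β : ℝ}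
    {ν : Measure UnitCircle} [IsFiniteMeasure ν]
    (hN : ∀ k, NullAt β ν (σ k) ∧ 2 * ∫ κ : UnitCircle, (‖(κ : ℂ) - σ k‖ ^ 2)⁻¹ ∂ν ≤
      |Λ k| / ‖τ - σ k‖ ^ 2)
    (hext : (fun z : 𝔻 => (τ - z) * (1 - conj τ * z) * herglotz β ν z) ∈
      (GenClass τ σ Λ).extremePoints ℝ)
    {h : UnitCircle → ℝ} (hm : Measurable h) {C : ℝ} (hC : ∀ κ, |h κ| ≤ C) {b : ℝ}
    (h1 : ∀ k, Complex.I * b +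
      ∫ κ : UnitCircle, h κ • (((κ : ℂ) + σ k) / ((κ : ℂ) - σ k)) ∂ν = 0)
    (h2 : ∀ k, 2 * ∫ κ : UnitCircle, (‖(κ : ℂ) - σ k‖ ^ 2)⁻¹ ∂ν = |Λ k| / ‖τ - σ k‖ ^ 2 →
      ∫ κ : UnitCircle, h κ • (‖(κ : ℂ) - σ k‖ ^ 2)⁻¹ ∂ν = 0) :
    h =ᵐ[ν] 0 := by
  have hgood : ∀ᶠ ε in 𝓝 (0 : ℝ), (∀ κ, 0 ≤ 1 + ε * h κ) ∧
      ∀ k, 2 * (∫ κ : UnitCircle, (‖(κ : ℂ) - σ k‖ ^ 2)⁻¹ ∂ν +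
        ε * ∫ κ : UnitCircle, h κ • (‖(κ : ℂ) - σ k‖ ^ 2)⁻¹ ∂ν) ≤ |Λ k| / ‖τ - σ k‖ ^ 2 := by
    refine Eventually.and ?_ (eventually_all.2 fun k => ?_)
    · have : Tendsto (fun ε : ℝ => |ε| * C) (𝓝 0) (𝓝 0) := by
        simpa using (continuous_abs.tendsto (0 : ℝ)).mul_const C
      filter_upwards [this.eventually_lt_const one_pos] with ε hε κ
      have h3 : |ε * h κ| ≤ |ε| * C := by
        rw [abs_mul]; exact mul_le_mul_of_nonneg_left (hC κ) (abs_nonneg _)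
      linarith [neg_abs_le (ε * h κ)]
    · rcases (hN k).2.eq_or_lt with heq | hlt
      · refine Eventually.of_forall fun ε => ?_
        rw [h2 k heq, mul_zero, add_zero, heq]
      · have : Tendsto (fun ε : ℝ => 2 * (∫ κ : UnitCircle, (‖(κ : ℂ) - σ k‖ ^ 2)⁻¹ ∂ν +
            ε * ∫ κ : UnitCircle, h κ • (‖(κ : ℂ) - σ k‖ ^ 2)⁻¹ ∂ν)) (𝓝 0)
            (𝓝 (2 * ∫ κ : UnitCircle, (‖(κ : ℂ) - σ k‖ ^ 2)⁻¹ ∂ν)) :=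
          Continuous.tendsto' (by fun_prop) _ _ (by simp)
        exact (this.eventually_lt_const hlt).mono fun _ => le_of_lt
  have hneg : Tendsto (fun ε : ℝ => -ε) (𝓝 0) (𝓝 0) := by
    simpa using continuous_neg.tendsto (0 : ℝ)
  obtain ⟨ε, ⟨hp, hm'⟩, hε0⟩ := (((hgood.and (hneg.eventually hgood)).filter_mono
    (nhdsWithin_le_nhds (s := Set.Ioi 0))).and self_mem_nhdsWithin).exists
  have hε0 : 0 < ε := hε0
  set H : ℂ → ℂ := fun z =>
    Complex.I * b + ∫ κ : UnitCircle, h κ • (((κ : ℂ) + z) / ((κ : ℂ) - z)) ∂ν with hH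
  set A : ℂ → ℂ := fun z => (τ - z) * (1 - conj τ * z) with hA
  have hmem : ∀ e : ℝ, ((∀ κ, 0 ≤ 1 + e * h κ) ∧
      ∀ k, 2 * (∫ κ : UnitCircle, (‖(κ : ℂ) - σ k‖ ^ 2)⁻¹ ∂ν +
        e * ∫ κ : UnitCircle, h κ • (‖(κ : ℂ) - σ k‖ ^ 2)⁻¹ ∂ν) ≤ |Λ k| / ‖τ - σ k‖ ^ 2) →
      (fun z : 𝔻 => A z * (herglotz β ν z + e * H z)) ∈ GenClass τ σ Λ := by
    rintro e ⟨he, hek⟩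
    have hfin := isFiniteMeasure_perturbedMeasure (ν := ν) hm hC e
    have hG := mem_genClass_of_nullAt (β := β + e * b) (ν := perturbedMeasure ν h e) hτ1 hσ hΛ
      fun k => ?_
    · convert hG using 2 with z
      rw [herglotz_perturbedMeasure hm hC he β b (integrable_cayley ν z.norm_lt_one)]
    · refine ⟨⟨withDensity_absolutelyContinuous _ _ (hN k).1.measure_singleton,
        integrable_perturbedMeasure hm hC he (hN k).1.integrable, ?_⟩, ?_⟩
      · rw [herglotz_perturbedMeasure hm hC he β b
          (integrable_cayley_boundary (hN k).1.integrable), (hN k).1.eq_zero, h1 k]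
        simp
      · rw [integral_perturbedMeasure hm hC he (hN k).1.integrable, smul_eq_mul]
        exact hek k
  have hseg := (mem_extremePoints.1 hext).2 _ (hmem ε hp) _ (hmem (-ε) hm')
    ⟨1 / 2, 1 / 2, by norm_num, by norm_num, by norm_num, by
      funext z
      simp only [Pi.add_apply, Pi.smul_apply, Complex.real_smul, hA]
      push_cast
      ring⟩
  have hz0 : ∀ z : ℂ, ‖z‖ < 1 → z ≠ τ → H z = 0 := by
    intro z hz hzτ
    have h3 := congrFun hseg.1 (Complex.UnitDisc.mk z hz)
    simp only [Complex.UnitDisc.coe_mk] at h3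
    have hA0 : A z ≠ 0 := by
      refine mul_ne_zero (sub_ne_zero.2 hzτ.symm) fun h0 => ?_
      have h4 : ‖conj τ * z‖ = 1 := by rw [← sub_eq_zero.1 h0, norm_one]
      rw [norm_mul, RCLike.norm_conj] at h4
      nlinarith [norm_nonneg z, norm_nonneg τ]
    have h5 : (ε : ℂ) * H z = 0 := by
      have := mul_left_cancel₀ hA0 h3
      simpa using this
    exact (mul_eq_zero.1 h5).resolve_left (Complex.ofReal_ne_zero.2 hε0.ne')
  have hfin := isFiniteMeasure_perturbedMeasure (ν := ν) hm hC ε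
  have hν : perturbedMeasure ν h ε = ν := by
    refine herglotz_injective_of_punctured (β := β + ε * b) (β' := β) τ fun z hz hzτ => ?_
    rw [herglotz_perturbedMeasure hm hC hp.1 β b (integrable_cayley ν hz)]
    have := hz0 z hz hzτ
    simp only [hH] at this
    rw [this]
    simp
  have hν1 : perturbedMeasure ν h ε = ν.withDensity 1 := by rw [hν, withDensity_one]
  rw [perturbedMeasure, withDensity_eq_iff (by fun_prop) measurable_one.aemeasurable] at hν1
  · filter_upwards [hν1] with κ hκ
    rw [Pi.one_apply, ENNReal.ofReal_eq_one] at hκ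
    have : ε * h κ = 0 := by linarith
    exact (mul_eq_zero.1 this).resolve_left hε0.ne'
  · have := hfin.measure_univ_lt_top
    rw [perturbedMeasure, withDensity_apply _ MeasurableSet.univ, Measure.restrict_univ] at this
    exact this.ne

/-- If n + |J| disjoint sets were charged, step functions on them together with b would form a real
space of dimension n + |J| + 1, against n + |J| linear constraints. A nonzero solution contradicts
the vanishing of admissible perturbations. -/
theorem exists_finset_of_mem_extremePoints {τ : ℂ} (hτ1 : ‖τ‖ ≤ 1) {n : ℕ} (hn : 1 ≤ n)
    {σ : Fin n → UnitCircle} {Λ : Fin n → ℝ} (hσ : ∀ k, τ ≠ (σ k : ℂ)) (hΛ : ∀ k, Λ k < 0)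
    {β : ℝ} {ν : Measure UnitCircle} [IsFiniteMeasure ν]
    (hN : ∀ k, NullAt β ν (σ k) ∧ 2 * ∫ κ : UnitCircle, (‖(κ : ℂ) - σ k‖ ^ 2)⁻¹ ∂ν ≤
      |Λ k| / ‖τ - σ k‖ ^ 2)
    (hext : (fun z : 𝔻 => (τ - z) * (1 - conj τ * z) * herglotz β ν z) ∈
      (GenClass τ σ Λ).extremePoints ℝ)
    (J : Finset (Fin n)) (hJ : ∀ k, 2 * ∫ κ : UnitCircle, (‖(κ : ℂ) - σ k‖ ^ 2)⁻¹ ∂ν =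
      |Λ k| / ‖τ - σ k‖ ^ 2 → k ∈ J) :
    ∃ S : Finset UnitCircle, S.card < n + J.card ∧ ν (S : Set UnitCircle)ᶜ = 0 ∧
      ∀ κ ∈ S, ν {κ} ≠ 0 := by
  refine exists_finset_of_disjoint_null ν fun A hAm hAd => ?_
  by_contra! hpos
  let B : Fin n → Fin (n + J.card) → ℂ := fun k j =>
    ∫ κ in A j, (((κ : ℂ) + σ k) / ((κ : ℂ) - σ k)) ∂ν
  let W : Fin n → Fin (n + J.card) → ℝ := fun k j => ∫ κ in A j, (‖(κ : ℂ) - σ k‖ ^ 2)⁻¹ ∂ν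
  let Φ : ((Fin (n + J.card) → ℝ) × ℝ) →ₗ[ℝ] (Fin n → ℝ) × (J → ℝ) :=
    { toFun := fun x => (fun k => x.2 + ∑ j, x.1 j * (B k j).im, fun k => ∑ j, x.1 j * W k j)
      map_add' := fun x y => by
        ext k <;> simp [add_mul, Finset.sum_add_distrib]
        ring
      map_smul' := fun a x => by
        ext k <;> simp [Finset.mul_sum, mul_assoc, mul_add] }
  have hker : LinearMap.ker Φ ≠ ⊥ := LinearMap.ker_ne_bot_of_finrank_lt (by simp)
  obtain ⟨⟨c, b⟩, hx, hx0⟩ := (Submodule.ne_bot_iff _).1 hker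
  rw [LinearMap.mem_ker] at hx
  have hb : ∀ k, b + ∑ j, c j * (B k j).im = 0 := fun k => congrFun (congrArg Prod.fst hx) k
  have hw : ∀ k ∈ J, ∑ j, c j * W k j = 0 := fun k hk => congrFun (congrArg Prod.snd hx) ⟨k, hk⟩
  set h : UnitCircle → ℝ := fun κ => ∑ j, (A j).indicator (fun _ => c j) κ with hh
  have hmeas : Measurable h :=
    Finset.measurable_fun_sum _ fun j _ => measurable_const.indicator (hAm j)
  have hbd : ∀ κ, |h κ| ≤ ∑ j, |c j| := fun κ =>
    (Finset.abs_sum_le_sum_abs _ _).trans (Finset.sum_le_sum fun j _ => by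
      by_cases hκ : κ ∈ A j <;> simp [hκ])
  have hint : ∀ {E : Type} [NormedAddCommGroup E] [NormedSpace ℝ E]
      (f : UnitCircle → E) (_ : Integrable f ν),
      ∫ κ, h κ • f κ ∂ν = ∑ j, c j • ∫ κ in A j, f κ ∂ν := by
    intro E _ _ f hf
    have h1 : ∀ κ, h κ • f κ = ∑ j, c j • (A j).indicator f κ := by
      intro κ
      simp only [hh, Finset.sum_smul]
      exact Finset.sum_congr rfl fun j _ => by by_cases hκ : κ ∈ A j <;> simp [hκ]
    simp only [h1]
    refine (integral_finsetSum _ fun j _ => (hf.indicator (hAm j)).smul (c j)).trans ?_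
    exact Finset.sum_congr rfl fun j _ => by
      simp only [Pi.smul_apply, integral_smul, integral_indicator (hAm j)]
  -- Cayley kernels are purely imaginary on the circle, so each zero condition costs only one real
  -- equation.
  have hBre : ∀ k j, (B k j).re = 0 := fun k j =>
    re_integral_cayley_boundary (hN k).1.integrable.integrableOn
  have hae := ae_eq_zero_of_mem_extremePoints hτ1 hσ hΛ hN hext hmeas hbd (b := b)
    (fun k => by
      rw [hint _ (integrable_cayley_boundary (hN k).1.integrable)]
      change Complex.I * b + ∑ j, c j • B k j = 0
      apply Complex.ext
      · simp [hBre k]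
      · simpa using hb k)
    (fun k hk => by
      rw [hint _ (hN k).1.integrable]
      exact hw k (hJ k hk))
  have hc : c = 0 := by
    funext j
    by_contra hcj
    refine hpos j (measure_mono_null (fun κ hκ => ?_) (ae_iff.1 hae))
    have : h κ = c j := by
      simp only [hh]
      rw [Finset.sum_eq_single j, Set.indicator_of_mem hκ]
      · exact fun i _ hij => Set.indicator_of_notMem (Set.disjoint_right.1 (hAd hij) hκ) _
      · simp
    simpa [this] using hcj
  subst hc
  -- With c = 0, a single zero condition, available because n ≥ 1, also forces b = 0.
  have hb0 : b = 0 := by simpa using hb ⟨0, hn⟩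
  exact hx0 (by rw [hb0]; rfl)

/-! ### Reciprocals of finite Herglotz sums -/

section RationalHerglotz

open Polynomial Lagrange

/-- The Herglotz sum `i β + ∑ m κ (κ + z) / (κ - z)` over a finite subset of the circle. -/
noncomputable def herglotzSum (β : ℝ) (m : UnitCircle → ℝ) (S : Finset UnitCircle) (z : ℂ) : ℂ :=
  Complex.I * β + ∑ κ ∈ S, (m κ : ℂ) * (((κ : ℂ) + z) / ((κ : ℂ) - z))

theorem herglotzSum_re (β : ℝ) (m : UnitCircle → ℝ) (S : Finset UnitCircle) (z : ℂ) :
    (herglotzSum β m S z).re = ∑ κ ∈ S, m κ * ((1 - ‖z‖ ^ 2) / ‖(κ : ℂ) - z‖ ^ 2) := by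
  simp [herglotzSum, re_cayley]

theorem UnitCircle.injOn_coe (S : Finset UnitCircle) :
    Set.InjOn (fun κ : UnitCircle => (κ : ℂ)) S :=
  Subtype.val_injective.injOn

theorem UnitCircle.eval_nodal_ne_zero {S : Finset UnitCircle} {z : ℂ} (hz : ∀ κ ∈ S, z ≠ κ) :
    (nodal S (fun κ : UnitCircle => (κ : ℂ))).eval z ≠ 0 :=
  eval_nodal_not_at_node hz

theorem UnitCircle.eval_nodal_eq {S : Finset UnitCircle} {κ : UnitCircle} (hκ : κ ∈ S) (z : ℂ) :
    (nodal S (fun κ : UnitCircle => (κ : ℂ))).eval z =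
      (z - κ) * (nodal (S.erase κ) (fun κ : UnitCircle => (κ : ℂ))).eval z := by
  rw [nodal_eq_mul_nodal_erase hκ]
  simp

theorem UnitCircle.natDegree_X_add_C_mul_nodal {S : Finset UnitCircle} {κ : UnitCircle}
    (hκ : κ ∈ S) :
    ((X + C (κ : ℂ)) * nodal (S.erase κ) (fun κ : UnitCircle => (κ : ℂ))).natDegree = S.card := by
  rw [(monic_X_add_C _).natDegree_mul (nodal_monic), natDegree_X_add_C, natDegree_nodal,
    Finset.card_erase_of_mem hκ]
  have := Finset.card_pos.2 ⟨κ, hκ⟩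
  omega

theorem UnitCircle.coeff_X_add_C_mul_nodal {S : Finset UnitCircle} {κ : UnitCircle}
    (hκ : κ ∈ S) :
    ((X + C (κ : ℂ)) * nodal (S.erase κ) (fun κ : UnitCircle => (κ : ℂ))).coeff S.card = 1 := by
  rw [← natDegree_X_add_C_mul_nodal hκ]
  exact (monic_X_add_C _).mul nodal_monic

/-- Partial fractions with simple poles on the circle, written with Cayley kernels. -/
theorem exists_div_eq_add_cayley {Z : Finset UnitCircle} {P Q : ℂ[X]} {c : ℂ} (hc : c ≠ 0)
    (hP : P = C c * nodal Z (fun κ : UnitCircle => (κ : ℂ))) (hQ : Q.natDegree ≤ Z.card)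
    {a : UnitCircle → ℝ} (ha : ∀ s ∈ Z, Q.eval (s : ℂ) + 2 * s * a s * P.derivative.eval (s : ℂ) = 0) :
    ∃ d : ℂ, ∀ z : ℂ, (∀ s ∈ Z, z ≠ s) →
      Q.eval z / P.eval z = d + ∑ s ∈ Z, (a s : ℂ) * (((s : ℂ) + z) / ((s : ℂ) - z)) := by
  set v : UnitCircle → ℂ := fun κ => (κ : ℂ) with hv
  -- The hypothesis on a matches residues: the kernel with weight a(s) has residue -2s·a(s) at s. So
  -- E vanishes on Z, and having degree at most |Z| it is a constant multiple of the nodal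
  -- polynomial.
  set E : ℂ[X] := Q + ∑ s ∈ Z, C (a s * c) * ((X + C (s : ℂ)) * nodal (Z.erase s) v) with hE
  have hEv : ∀ s ∈ Z, E.eval (s : ℂ) = 0 := by
    intro s hs
    have h1 : ∑ x ∈ Z, (a x * c) * (((s : ℂ) + x) * (nodal (Z.erase x) v).eval (s : ℂ)) =
        (a s * c) * (((s : ℂ) + s) * (nodal (Z.erase s) v).eval (s : ℂ)) := by
      refine Finset.sum_eq_single_of_mem s hs fun x _ hxs => ?_
      rw [show (s : ℂ) = v s from rfl, eval_nodal_at_node (Finset.mem_erase.2 ⟨hxs.symm, hs⟩)]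
      ring
    have h2 := ha s hs
    rw [hP, derivative_C_mul, eval_C_mul, eval_nodal_derivative_eval_node_eq hs] at h2
    rw [hE, eval_add, eval_finsetSum]
    simp only [eval_mul, eval_C, eval_add, eval_X]
    rw [h1]
    linear_combination h2
  have hEd : E.natDegree ≤ Z.card := by
    refine (natDegree_add_le _ _).trans (max_le hQ (natDegree_sum_le_of_forall_le _ _ fun s hs => ?_))
    exact (natDegree_C_mul_le _ _).trans (UnitCircle.natDegree_X_add_C_mul_nodal hs).le
  set e := E.coeff Z.card with he
  have hEe : E = C e * nodal Z v := by
    refine eq_of_degree_sub_lt_of_eval_index_eq (v := v) Z (UnitCircle.injOn_coe Z) ?_ fun s hs => ?_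
    · rw [degree_lt_iff_coeff_zero]
      intro k hk
      rw [coeff_sub, coeff_C_mul]
      rcases hk.eq_or_lt with rfl | hlt
      · have : (nodal Z v).coeff Z.card = 1 := by
          have := (nodal_monic (s := Z) (v := v)).coeff_natDegree
          rwa [natDegree_nodal] at this
        rw [this, he, mul_one, sub_self]
      · rw [coeff_eq_zero_of_natDegree_lt (hEd.trans_lt hlt),
          coeff_eq_zero_of_natDegree_lt (by rwa [natDegree_nodal]), mul_zero, sub_self]
    · rw [eval_C_mul, eval_nodal_at_node hs, mul_zero]
      exact hEv s hs
  refine ⟨e / c, fun z hz => ?_⟩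
  have hn := UnitCircle.eval_nodal_ne_zero hz
  have h1 := congrArg (eval z) hEe
  rw [hE, eval_add, eval_finsetSum, eval_C_mul] at h1
  simp only [eval_mul, eval_C, eval_add, eval_X] at h1
  rw [hP, eval_C_mul, eq_sub_of_add_eq h1, sub_div, mul_div_mul_right _ _ hn, sub_eq_add_neg,
    Finset.sum_div, ← Finset.sum_neg_distrib]
  congr 1
  refine Finset.sum_congr rfl fun s hs => ?_
  have hzs : z - s ≠ 0 := sub_ne_zero.2 (hz s hs)
  have hzs' : (s : ℂ) - z ≠ 0 := sub_ne_zero.2 (hz s hs).symm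
  have hn' : (nodal (Z.erase s) v).eval z ≠ 0 := by
    intro h0
    rw [UnitCircle.eval_nodal_eq hs] at hn
    exact hn (by rw [h0, mul_zero])
  rw [UnitCircle.eval_nodal_eq hs]
  simp only [← hv]
  rw [← neg_sub z (s : ℂ)]
  field_simp
  ring

/-- The numerator of a Herglotz sum over the common denominator `∏ (z - κ)`. -/
noncomputable def herglotzNumerator (β : ℝ) (m : UnitCircle → ℝ) (S : Finset UnitCircle) : ℂ[X] :=
  C (Complex.I * β) * nodal S (fun κ : UnitCircle => (κ : ℂ)) -
    ∑ κ ∈ S, C (m κ : ℂ) * ((X + C (κ : ℂ)) * nodal (S.erase κ) (fun κ : UnitCircle => (κ : ℂ)))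

variable {β : ℝ} {m : UnitCircle → ℝ} {S : Finset UnitCircle}

theorem eval_herglotzNumerator {z : ℂ} (hz : ∀ κ ∈ S, z ≠ κ) :
    (herglotzNumerator β m S).eval z =
      herglotzSum β m S z * (nodal S (fun κ : UnitCircle => (κ : ℂ))).eval z := by
  rw [herglotzNumerator, herglotzSum, eval_sub, eval_finsetSum, eval_C_mul, add_mul, sub_eq_add_neg,
    ← Finset.sum_neg_distrib, Finset.sum_mul]
  congr 1
  refine Finset.sum_congr rfl fun κ hκ => ?_
  have hzs : (κ : ℂ) - z ≠ 0 := sub_ne_zero.2 (hz κ hκ).symm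
  rw [UnitCircle.eval_nodal_eq hκ, ← neg_sub (κ : ℂ) z]
  simp only [eval_mul, eval_C, eval_add, eval_X]
  field_simp
  ring

theorem eval_herglotzNumerator_ne_zero (hm : ∀ κ ∈ S, 0 < m κ) {κ : UnitCircle} (hκ : κ ∈ S) :
    (herglotzNumerator β m S).eval (κ : ℂ) ≠ 0 := by
  set v : UnitCircle → ℂ := fun κ => (κ : ℂ) with hv
  have h1 : ∑ x ∈ S, (m x : ℂ) * (((κ : ℂ) + x) * (nodal (S.erase x) v).eval (κ : ℂ)) =
      (m κ : ℂ) * (((κ : ℂ) + κ) * (nodal (S.erase κ) v).eval (κ : ℂ)) := by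
    refine Finset.sum_eq_single_of_mem κ hκ fun x _ hxs => ?_
    rw [show (κ : ℂ) = v κ from rfl, eval_nodal_at_node (Finset.mem_erase.2 ⟨hxs.symm, hκ⟩)]
    ring
  rw [herglotzNumerator, eval_sub, eval_finsetSum, eval_C_mul]
  simp only [eval_mul, eval_C, eval_add, eval_X, ← hv]
  rw [h1, show (κ : ℂ) = v κ from rfl, eval_nodal_at_node hκ, mul_zero, zero_sub, neg_ne_zero]
  refine mul_ne_zero (Complex.ofReal_ne_zero.2 (hm κ hκ).ne') (mul_ne_zero ?_ ?_)
  · rw [← two_mul]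
    exact mul_ne_zero two_ne_zero κ.coe_ne_zero
  · refine eval_nodal_not_at_node fun x hx h => ?_
    exact (Finset.mem_erase.1 hx).1 (Subtype.ext h.symm)

/-- The top coefficient is iβ - ∑ m κ, whose real part is negative. -/
theorem natDegree_herglotzNumerator (hm : ∀ κ ∈ S, 0 < m κ) (hS : S.Nonempty) :
    (herglotzNumerator β m S).natDegree = S.card := by
  refine natDegree_eq_of_le_of_coeff_ne_zero ?_ ?_
  · refine (natDegree_sub_le _ _).trans (max_le ?_ (natDegree_sum_le_of_forall_le _ _ fun s hs => ?_))
    · exact (natDegree_C_mul_le _ _).trans natDegree_nodal.le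
    · exact (natDegree_C_mul_le _ _).trans (UnitCircle.natDegree_X_add_C_mul_nodal hs).le
  · have h1 : (nodal S (fun κ : UnitCircle => (κ : ℂ))).coeff S.card = 1 := by
      have := (nodal_monic (s := S) (v := fun κ : UnitCircle => (κ : ℂ))).coeff_natDegree
      rwa [natDegree_nodal] at this
    have h2 : (herglotzNumerator β m S).coeff S.card = Complex.I * β - ∑ κ ∈ S, (m κ : ℂ) := by
      rw [herglotzNumerator, coeff_sub, coeff_C_mul, h1, mul_one, finsetSum_coeff]
      congr 1
      refine Finset.sum_congr rfl fun κ hκ => ?_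
      rw [coeff_C_mul, UnitCircle.coeff_X_add_C_mul_nodal hκ, mul_one]
    rw [h2]
    intro h0
    have h3 := congrArg Complex.re h0
    have h4 := Finset.sum_pos hm hS
    simp at h3
    linarith

/-- The real part is 1 - |z|² times a positive sum, inside and outside the disc alike. -/
theorem norm_eq_one_of_herglotzSum_eq_zero (hm : ∀ κ ∈ S, 0 < m κ) (hS : S.Nonempty) {z : ℂ}
    (hz : ∀ κ ∈ S, z ≠ κ) (h0 : herglotzSum β m S z = 0) : ‖z‖ = 1 := by
  have h1 := congrArg Complex.re h0
  rw [herglotzSum_re, Complex.zero_re] at h1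
  have h2 : ∑ κ ∈ S, m κ * ((1 - ‖z‖ ^ 2) / ‖(κ : ℂ) - z‖ ^ 2) =
      (1 - ‖z‖ ^ 2) * ∑ κ ∈ S, m κ / ‖(κ : ℂ) - z‖ ^ 2 := by
    rw [Finset.mul_sum]
    exact Finset.sum_congr rfl fun κ _ => by ring
  have h3 : 0 < ∑ κ ∈ S, m κ / ‖(κ : ℂ) - z‖ ^ 2 :=
    Finset.sum_pos (fun κ hκ => div_pos (hm κ hκ)
      (pow_pos (norm_pos_iff.2 (sub_ne_zero.2 (hz κ hκ).symm)) 2)) hS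
  rw [h2] at h1
  have h4 := (mul_eq_zero.1 h1).resolve_right h3.ne'
  nlinarith [norm_nonneg z]

/-- With positive weights this derivative cannot vanish, so zeros are simple; it also fixes the
residues of the reciprocal. -/
theorem hasDerivAt_herglotzSum {s : UnitCircle} (hs : ∀ κ ∈ S, (s : ℂ) ≠ κ) :
    HasDerivAt (herglotzSum β m S)
      (-(2 * conj (s : ℂ) * (∑ κ ∈ S, m κ / ‖(κ : ℂ) - s‖ ^ 2 : ℝ))) (s : ℂ) := by
  have h1 : ∀ κ ∈ S, HasDerivAt (fun z : ℂ => (m κ : ℂ) * (((κ : ℂ) + z) / ((κ : ℂ) - z)))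
      (-(2 * conj (s : ℂ) * (m κ / ‖(κ : ℂ) - s‖ ^ 2 : ℝ))) (s : ℂ) := by
    intro κ hκ
    have hne : (κ : ℂ) - s ≠ 0 := sub_ne_zero.2 (hs κ hκ).symm
    have h2 := ((((hasDerivAt_id (s : ℂ)).const_add (κ : ℂ)).div
      ((hasDerivAt_id (s : ℂ)).const_sub (κ : ℂ)) hne)).const_mul (m κ : ℂ)
    refine h2.congr_deriv ?_
    have h3 : ((‖(κ : ℂ) - s‖ ^ 2 : ℝ) : ℂ) = ((κ : ℂ) - s) * (conj (κ : ℂ) - conj (s : ℂ)) := by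
      rw [← map_sub, Complex.mul_conj, Complex.normSq_eq_norm_sq]
    have h4 := κ.conj_mul_coe
    have h5 := s.conj_mul_coe
    have hne' : conj (κ : ℂ) - conj (s : ℂ) ≠ 0 := by
      rw [← map_sub]; exact (_root_.map_ne_zero _).2 hne
    simp only [id]
    rw [Complex.ofReal_div, h3]
    field_simp
    linear_combination (m κ : ℂ) * 2 * (h4 - h5)
  exact (HasDerivAt.fun_sum h1).const_add _ |>.congr_deriv (by
    rw [Complex.ofReal_sum, Finset.mul_sum, Finset.sum_neg_distrib])

theorem eval_derivative_herglotzNumerator {s : UnitCircle} (hs : ∀ κ ∈ S, (s : ℂ) ≠ κ)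
    (h0 : herglotzSum β m S s = 0) :
    (herglotzNumerator β m S).derivative.eval (s : ℂ) =
      -(2 * conj (s : ℂ) * (∑ κ ∈ S, m κ / ‖(κ : ℂ) - s‖ ^ 2 : ℝ)) *
        (nodal S (fun κ : UnitCircle => (κ : ℂ))).eval (s : ℂ) := by
  have h1 := (hasDerivAt_herglotzSum (β := β) (m := m) hs).mul
    ((nodal S (fun κ : UnitCircle => (κ : ℂ))).hasDerivAt (s : ℂ))
  have h2 : (fun z => (herglotzNumerator β m S).eval z) =ᶠ[𝓝 (s : ℂ)]
      (herglotzSum β m S * fun z => (nodal S (fun κ : UnitCircle => (κ : ℂ))).eval z) := by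
    have : ∀ᶠ z in 𝓝 (s : ℂ), ∀ κ ∈ S, z ≠ (κ : ℂ) :=
      (Finset.eventually_all S).2 fun κ hκ => isOpen_ne.mem_nhds (hs κ hκ)
    filter_upwards [this] with z hz
    exact eval_herglotzNumerator hz
  have h3 := ((herglotzNumerator β m S).hasDerivAt (s : ℂ)).unique (h1.congr_of_eventuallyEq h2)
  rw [h3, h0, zero_mul, add_zero]

/-- The reciprocal of a Herglotz sum with `N` atoms is a Herglotz sum with `N` atoms. -/
theorem exists_inv_herglotzSum (hm : ∀ κ ∈ S, 0 < m κ) (hS : S.Nonempty) :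
    ∃ (Z : Finset UnitCircle) (b : ℝ), Z.card = S.card ∧
      (∀ s : UnitCircle, s ∉ S → herglotzSum β m S s = 0 → s ∈ Z) ∧
      ∀ z : ℂ, ‖z‖ < 1 → (herglotzSum β m S z)⁻¹ =
        herglotzSum b (fun s => (4 * ∑ κ ∈ S, m κ / ‖(κ : ℂ) - s‖ ^ 2)⁻¹) Z z := by
  set P := herglotzNumerator β m S with hPdef
  have hPd : P.natDegree = S.card := natDegree_herglotzNumerator hm hS
  have hP0 : P ≠ 0 := fun h => by
    rw [h, natDegree_zero] at hPd
    exact hS.card_pos.ne hPd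
  have hroot : ∀ z : ℂ, P.eval z = 0 → (∀ κ ∈ S, z ≠ κ) ∧ herglotzSum β m S z = 0 := by
    intro z hz
    have hzS : ∀ κ ∈ S, z ≠ κ := by
      rintro κ hκ rfl
      exact eval_herglotzNumerator_ne_zero hm hκ hz
    refine ⟨hzS, ?_⟩
    rw [eval_herglotzNumerator hzS] at hz
    exact (mul_eq_zero.1 hz).resolve_right (UnitCircle.eval_nodal_ne_zero hzS)
  have hW : ∀ s : UnitCircle, (∀ κ ∈ S, (s : ℂ) ≠ κ) →
      0 < ∑ κ ∈ S, m κ / ‖(κ : ℂ) - s‖ ^ 2 := fun s hs =>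
    Finset.sum_pos (fun κ hκ => div_pos (hm κ hκ)
      (pow_pos (norm_pos_iff.2 (sub_ne_zero.2 (hs κ hκ).symm)) 2)) hS
  have hcirc : ∀ z ∈ P.roots, z ∈ Metric.sphere (0 : ℂ) 1 := fun z hz => by
    obtain ⟨h1, h2⟩ := hroot z ((mem_roots hP0).1 hz)
    simpa using norm_eq_one_of_herglotzSum_eq_zero hm hS h1 h2
  obtain ⟨M, hM⟩ : ∃ M : Multiset UnitCircle, M.map (fun κ : UnitCircle => (κ : ℂ)) = P.roots :=
    CanLift.prf (self := Multiset.canLift _ _) P.roots hcirc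
  have hnd : P.roots.Nodup := by
    refine Multiset.nodup_iff_count_le_one.2 fun z => ?_
    rw [count_roots]
    by_contra! hlt
    obtain ⟨h1, h2⟩ := (one_lt_rootMultiplicity_iff_isRoot hP0).1 hlt
    obtain ⟨hzS, hz0⟩ := hroot z h1
    obtain ⟨s, rfl⟩ : ∃ s : UnitCircle, (s : ℂ) = z :=
      ⟨⟨z, hcirc z ((mem_roots hP0).2 h1)⟩, rfl⟩
    rw [IsRoot, eval_derivative_herglotzNumerator hzS hz0] at h2
    refine mul_ne_zero (neg_ne_zero.2 (mul_ne_zero (mul_ne_zero two_ne_zero ?_) ?_))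
      (UnitCircle.eval_nodal_ne_zero hzS) h2
    · exact (_root_.map_ne_zero _).2 s.coe_ne_zero
    · exact Complex.ofReal_ne_zero.2 (hW s hzS).ne'
  set Z : Finset UnitCircle := ⟨M, Multiset.Nodup.of_map (fun κ : UnitCircle => (κ : ℂ)) (hM ▸ hnd)⟩
    with hZ
  have hsplit := IsAlgClosed.splits P
  have hZc : Z.card = S.card := by
    rw [← hPd, hsplit.natDegree_eq_card_roots, ← hM, Multiset.card_map]
    rfl
  have hmemZ : ∀ s : UnitCircle, s ∈ Z ↔ P.eval (s : ℂ) = 0 := by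
    intro s
    rw [← IsRoot, ← mem_roots hP0, ← hM, Multiset.mem_map_of_injective Subtype.val_injective]
    rfl
  have hPeq : P = C P.leadingCoeff * nodal Z (fun κ : UnitCircle => (κ : ℂ)) := by
    conv_lhs => rw [hsplit.eq_prod_roots, ← hM, Multiset.map_map]
    rfl
  -- At a zero s the numerator has derivative -2s̄W times the nodal value, W being the sum in this
  -- definition; the residue condition becomes 1 - 4a(s)W = 0.
  set a : UnitCircle → ℝ := fun s => (4 * ∑ κ ∈ S, m κ / ‖(κ : ℂ) - s‖ ^ 2)⁻¹ with ha
  obtain ⟨d, hd⟩ := exists_div_eq_add_cayley (Z := Z) (P := P)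
    (Q := nodal S (fun κ : UnitCircle => (κ : ℂ))) (a := a) (leadingCoeff_ne_zero.2 hP0) hPeq
    (by rw [natDegree_nodal, hZc]) fun s hs => by
      obtain ⟨hsS, hs0⟩ := hroot s ((hmemZ s).1 hs)
      rw [eval_derivative_herglotzNumerator hsS hs0]
      have h1 := s.conj_mul_coe
      have h2 : (((∑ κ ∈ S, m κ / ‖(κ : ℂ) - s‖ ^ 2 : ℝ)) : ℂ) ≠ 0 :=
        Complex.ofReal_ne_zero.2 (hW s hsS).ne'
      have h3 : (a s : ℂ) * (∑ κ ∈ S, m κ / ‖(κ : ℂ) - s‖ ^ 2 : ℝ) = 1 / 4 := by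
        rw [ha, Complex.ofReal_inv, Complex.ofReal_mul]
        field_simp
        norm_num
      linear_combination (-4 * (a s : ℂ) * (∑ κ ∈ S, m κ / ‖(κ : ℂ) - s‖ ^ 2 : ℝ) *
        (nodal S (fun κ : UnitCircle => (κ : ℂ))).eval (s : ℂ)) * h1 -
        4 * (nodal S (fun κ : UnitCircle => (κ : ℂ))).eval (s : ℂ) * h3
  have hdiv : ∀ z : ℂ, (∀ κ ∈ S, z ≠ κ) → (∀ s ∈ Z, z ≠ s) → (herglotzSum β m S z)⁻¹ =
      d + ∑ s ∈ Z, (a s : ℂ) * (((s : ℂ) + z) / ((s : ℂ) - z)) := by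
    intro z hzS hzZ
    rw [← hd z hzZ, eval_herglotzNumerator hzS, div_mul_cancel_right₀
      (UnitCircle.eval_nodal_ne_zero hzS)]
  -- At a circle point off S and Z both the sum and all the kernels are purely imaginary, hence so
  -- is d.
  have hdre : d.re = 0 := by
    obtain ⟨x, hx⟩ : ∃ x : UnitCircle, x ∉ S ∪ Z := by
      have : Infinite UnitCircle := Set.infinite_coe_iff.2
        ((isPreconnected_sphere (by simp) (0 : ℂ) 1).infinite_of_nontrivial
          ⟨1, by simp, -1, by simp, by norm_num⟩)
      exact Infinite.exists_notMem_finset _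
    rw [Finset.mem_union, not_or] at hx
    have h1 := congrArg Complex.re (hdiv x (fun κ hκ h => hx.1 (Subtype.ext h ▸ hκ))
      fun κ hκ h => hx.2 (Subtype.ext h ▸ hκ))
    have h2 : (herglotzSum β m S x).re = 0 := by
      rw [herglotzSum_re, x.norm_coe]; simp
    rw [Complex.inv_re, h2] at h1
    simpa [re_cayley_boundary, re_cayley] using h1.symm
  refine ⟨Z, d.im, hZc, fun s hs h0 => ?_, fun z hz => ?_⟩
  · have hsS : ∀ κ ∈ S, (s : ℂ) ≠ κ := fun κ hκ h => hs ((Subtype.ext h : s = κ) ▸ hκ)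
    rw [hmemZ, eval_herglotzNumerator hsS, h0, zero_mul]
  · have hne : ∀ κ : UnitCircle, z ≠ κ := fun κ h => by
      rw [h, κ.norm_coe] at hz
      exact lt_irrefl _ hz
    rw [hdiv z (fun κ _ => hne κ) fun κ _ => hne κ, herglotzSum]
    congr 1
    apply Complex.ext <;> simp [hdre]

end RationalHerglotz

/-! ### Extreme points -/

/-- Unused indices receive weight 0 at a default point, so a shorter sum can be written with exactly
M terms. -/
theorem exists_fin_sum_eq_of_card_le {X : Type*} [Inhabited X] {T : Finset X} {M : ℕ}
    (hT : T.card ≤ M) {a : X → ℝ} (ha : ∀ x ∈ T, 0 ≤ a x) :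
    ∃ (w : Fin M → ℝ) (s : Fin M → X), (∀ j, 0 ≤ w j) ∧
      ∀ F : X → ℂ, ∑ j, (w j : ℂ) * F (s j) = ∑ x ∈ T, (a x : ℂ) * F x := by
  obtain ⟨r, rfl⟩ := Nat.exists_eq_add_of_le hT
  let e := T.equivFin.symm
  refine ⟨Fin.append (fun i => a (e i)) fun _ => 0, Fin.append (fun i => (e i : X)) default,
    fun j => ?_, fun F => ?_⟩
  · refine Fin.addCases (fun i => ?_) (fun i => ?_) j
    · simpa using ha _ (e i).2
    · simp
  · rw [Fin.sum_univ_add]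
    simp only [Fin.append_left, Fin.append_right, Complex.ofReal_zero, zero_mul,
      Finset.sum_const_zero, add_zero]
    rw [Equiv.sum_comp e fun x : T => (a x : ℂ) * F x, Finset.sum_coe_sort T fun x => (a x : ℂ) * F x]

theorem UnitCircle.herglotz_eq_herglotzSum {ν : Measure UnitCircle} [IsFiniteMeasure ν]
    {S : Finset UnitCircle} (hS : ν (S : Set UnitCircle)ᶜ = 0) (β : ℝ) (z : ℂ) :
    herglotz β ν z = herglotzSum β (fun κ => ν.real {κ}) S z := by
  rw [herglotz, herglotzSum, integral_eq_sum_of_measure_compl_finset hS]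
  simp only [Complex.real_smul]

/-- The reciprocal of p has at most n + |J| - 1 atoms. Its weight at σ_k is 1/(2c_k), where c_k =
2∫|κ - σ_k|⁻² dν is the angular derivative of p; the bound on c_k makes this at least α_k, with
equality exactly at saturation. -/
theorem exists_rational_form_of_mem_extremePoints {τ : ℂ} (hτ : ‖τ‖ ≤ 1) {n : ℕ} (hn : 1 ≤ n)
    {σ : Fin n → UnitCircle} (hσi : Function.Injective σ) (hσ : ∀ k, τ ≠ (σ k : ℂ))
    {Λ : Fin n → ℝ} (hΛ : ∀ k, Λ k < 0) {G : 𝔻 → ℂ}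
    (hG : G ∈ (GenClass τ σ Λ).extremePoints ℝ) (hG0 : G ≠ 0) :
    ∃ (b : ℝ) (a : Fin (n - 1) → ℝ) (s : Fin (n - 1) → UnitCircle), (∀ j, 0 ≤ a j) ∧
      ∀ z : 𝔻, G z = ((τ - (z : ℂ)) * (1 - conj τ * (z : ℂ))) /
        (Complex.I * (b : ℂ)
          + ∑ j, (a j : ℂ) * (((s j : ℂ) + (z : ℂ)) / ((s j : ℂ) - (z : ℂ)))
          + pZero τ σ Λ (z : ℂ)) := by
  obtain ⟨β, ν, hν, hGz, hN⟩ := exists_herglotz_of_mem_genClass hτ hσ hΛ hG.1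
  obtain rfl : G = fun z : 𝔻 => (τ - z) * (1 - conj τ * z) * herglotz β ν z := funext hGz
  set J : Finset (Fin n) := Finset.univ.filter fun k =>
    2 * ∫ κ : UnitCircle, (‖(κ : ℂ) - σ k‖ ^ 2)⁻¹ ∂ν = |Λ k| / ‖τ - σ k‖ ^ 2 with hJ
  obtain ⟨S, hSc, hS0, hSpos⟩ := exists_finset_of_mem_extremePoints hτ hn hσ hΛ hN hG J
    fun k hk => by simp [hJ, hk]
  set m : UnitCircle → ℝ := fun κ => ν.real {κ} with hm
  have hher : ∀ z, herglotz β ν z = herglotzSum β m S z :=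
    UnitCircle.herglotz_eq_herglotzSum hS0 β
  have hmpos : ∀ κ ∈ S, 0 < m κ := fun κ hκ =>
    ENNReal.toReal_pos (hSpos κ hκ) (measure_ne_top _ _)
  -- Without atoms p is the constant iβ, which vanishes at a σ_k, so G would be 0.
  have hSne : S.Nonempty := by
    by_contra hemp
    rw [Finset.not_nonempty_iff_eq_empty] at hemp
    have h1 := (hN ⟨0, hn⟩).1.eq_zero
    have h2 : ∀ z, herglotz β ν z = Complex.I * β := fun z => by
      rw [hher, herglotzSum, hemp, Finset.sum_empty, add_zero]
    rw [h2] at h1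
    exact hG0 (funext fun z => by simp only [h2, h1, mul_zero, Pi.zero_apply])
  obtain ⟨Z, b, hZc, hZ0, hinv⟩ := exists_inv_herglotzSum (β := β) hmpos hSne
  set a : UnitCircle → ℝ := fun s => (4 * ∑ κ ∈ S, m κ / ‖(κ : ℂ) - s‖ ^ 2)⁻¹ with ha
  have hσS : ∀ k, σ k ∉ S := fun k hk => hSpos _ hk (hN k).1.measure_singleton
  have hσZ : ∀ k, σ k ∈ Z := fun k => hZ0 _ (hσS k) (by rw [← hher]; exact (hN k).1.eq_zero)
  have ha0 : ∀ s, 0 ≤ a s := fun s =>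
    inv_nonneg.2 (mul_nonneg (by norm_num) (Finset.sum_nonneg fun κ hκ =>
      div_nonneg (hmpos κ hκ).le (by positivity)))
  set α : Fin n → ℝ := fun k => ‖τ - (σ k : ℂ)‖ ^ 2 / (2 * |Λ k|) with hα
  have haσ : ∀ k, a (σ k) = (2 * (2 * ∫ κ : UnitCircle, (‖(κ : ℂ) - σ k‖ ^ 2)⁻¹ ∂ν))⁻¹ := by
    intro k
    rw [integral_eq_sum_of_measure_compl_finset hS0]
    simp only [ha, hm, smul_eq_mul, div_eq_mul_inv]
    rw [← mul_assoc]
    norm_num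
  have hαi : ∀ k, α k = (2 * (|Λ k| / ‖τ - σ k‖ ^ 2))⁻¹ := by
    intro k
    rw [hα, ← mul_div_assoc, inv_div]
  have hWpos : ∀ k, 0 < 2 * ∫ κ : UnitCircle, (‖(κ : ℂ) - σ k‖ ^ 2)⁻¹ ∂ν := by
    intro k
    rw [integral_eq_sum_of_measure_compl_finset hS0]
    refine mul_pos two_pos (Finset.sum_pos (fun κ hκ => ?_) hSne)
    have : (κ : ℂ) - σ k ≠ 0 := sub_ne_zero.2 fun h =>
      hσS k ((Subtype.ext h : κ = σ k) ▸ hκ)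
    exact mul_pos (hmpos κ hκ) (inv_pos.2 (pow_pos (norm_pos_iff.2 this) 2))
  have hle : ∀ k, α k ≤ a (σ k) := by
    intro k
    rw [haσ, hαi]
    exact inv_anti₀ (mul_pos two_pos (hWpos k)) (by linarith [(hN k).2])
  have heq : ∀ k ∈ J, a (σ k) = α k := by
    intro k hk
    rw [haσ, hαi, (Finset.mem_filter.1 hk).2]
  set a' : UnitCircle → ℝ := fun s => a s - ∑ k, if σ k = s then α k else 0 with ha'
  have ha'σ : ∀ k, a' (σ k) = a (σ k) - α k := by
    intro k
    simp only [ha', hσi.eq_iff, Finset.sum_ite_eq', Finset.mem_univ, if_true]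
  have ha'0 : ∀ s, 0 ≤ a' s := by
    intro s
    by_cases hs : ∃ k, σ k = s
    · obtain ⟨k, rfl⟩ := hs
      rw [ha'σ]
      exact sub_nonneg.2 (hle k)
    · push Not at hs
      simp only [ha', hs, if_false, Finset.sum_const_zero, sub_zero]
      exact ha0 s
  -- After subtracting p₀ the weights at the saturated points are zero; dropping those |J| points
  -- leaves at most n - 1.
  set T := Z \ J.image σ with hT
  have hJZ : J.image σ ⊆ Z := Finset.image_subset_iff.2 fun k _ => hσZ k
  have hTc : T.card ≤ n - 1 := by
    rw [hT, Finset.card_sdiff_of_subset hJZ, Finset.card_image_of_injective _ hσi]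
    omega
  obtain ⟨w, s, hw, hws⟩ := @exists_fin_sum_eq_of_card_le _ ⟨σ ⟨0, hn⟩⟩ T (n - 1) hTc a'
    fun x _ => ha'0 x
  refine ⟨b, w, s, hw, fun z => ?_⟩
  have hsum : ∑ x ∈ Z, (a x : ℂ) * (((x : ℂ) + z) / ((x : ℂ) - z)) =
      ∑ j, (w j : ℂ) * (((s j : ℂ) + z) / ((s j : ℂ) - z)) + pZero τ σ Λ z := by
    rw [hws fun x : UnitCircle => ((x : ℂ) + z) / ((x : ℂ) - z)]
    have h1 : ∑ x ∈ T, (a' x : ℂ) * (((x : ℂ) + z) / ((x : ℂ) - z)) =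
        ∑ x ∈ Z, (a' x : ℂ) * (((x : ℂ) + z) / ((x : ℂ) - z)) := by
      refine Finset.sum_subset Finset.sdiff_subset fun x hx hxT => ?_
      have hxJ : x ∈ J.image σ := by
        by_contra h
        exact hxT (Finset.mem_sdiff.2 ⟨hx, h⟩)
      obtain ⟨k, hk, rfl⟩ := Finset.mem_image.1 hxJ
      rw [ha'σ, heq k hk, sub_self, Complex.ofReal_zero, zero_mul]
    have h2 : pZero τ σ Λ z = ∑ x ∈ Z, ((∑ k, if σ k = x then α k else 0 : ℝ) : ℂ) *
        (((x : ℂ) + z) / ((x : ℂ) - z)) := by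
      simp only [Complex.ofReal_sum, Finset.sum_mul]
      rw [Finset.sum_comm]
      refine Finset.sum_congr rfl fun k _ => ?_
      rw [Finset.sum_eq_single_of_mem (σ k) (hσZ k) fun x _ hx => by rw [if_neg hx.symm]; simp]
      rw [if_pos rfl]
    rw [h1, h2, ← Finset.sum_add_distrib]
    refine Finset.sum_congr rfl fun x _ => ?_
    rw [← add_mul, ← Complex.ofReal_add, ha', sub_add_cancel]
  have hz := hinv z z.norm_lt_one
  rw [herglotzSum.eq_def b, hsum, ← add_assoc] at hz
  rw [← hz, div_inv_eq_mul, hGz, hher]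

theorem mainTheorem8 (τ : ℂ) (hτ : ‖τ‖ ≤ 1) :
    (∀ (n : ℕ) (_ : 1 ≤ n) (σ : Fin n → UnitCircle) (_ : Function.Injective σ)
      (_ : ∀ k, τ ≠ (σ k : ℂ)) (Λ : Fin n → ℝ) (_ : ∀ k, Λ k < 0) (G : 𝔻 → ℂ),
      G ∈ (GenClass τ σ Λ).extremePoints ℝ → G ≠ 0 →
        ∃ (b : ℝ) (a : Fin (n - 1) → ℝ) (s : Fin (n - 1) → UnitCircle), (∀ j, 0 ≤ a j) ∧
          ∀ z : 𝔻, G z = ((τ - (z : ℂ)) * (1 - conj τ * (z : ℂ))) /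
            (Complex.I * (b : ℂ)
              + ∑ j, (a j : ℂ) * (((s j : ℂ) + (z : ℂ)) / ((s j : ℂ) - (z : ℂ)))
              + pZero τ σ Λ (z : ℂ))) ∧
    (∀ (σ : UnitCircle) (_ : τ ≠ (σ : ℂ)) (lam : ℝ) (_ : lam < 0) (G : 𝔻 → ℂ),
      G ∈ GenClass τ (fun _ : Fin 1 => σ) (fun _ : Fin 1 => lam) ↔
        ∃ μ : Measure UnitCircle, IsProbabilityMeasure μ ∧
          ∀ z : 𝔻, G z = ((|lam| / ‖(σ : ℂ) - τ‖ ^ 2 : ℝ) : ℂ) * (τ - (z : ℂ)) *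
            (1 - conj τ * (z : ℂ)) * (1 - conj (σ : ℂ) * (z : ℂ)) *
              ∫ κ : UnitCircle, (1 - (κ : ℂ)) / (1 - (κ : ℂ) * conj (σ : ℂ) * (z : ℂ)) ∂μ) := by
  exact ⟨fun n hn σ hσi hσ Λ hΛ G hG hG0 =>
      exists_rational_form_of_mem_extremePoints hτ hn hσi hσ hΛ hG hG0,
    fun σ hσ lam hlam G => mem_genClass_single_iff hτ σ hσ hlam G⟩
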